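/- Let $\mathbb K$ be an algebraically closed field of characteristic $0$. Let $P_1,\dots,P_4\in\mathbb K[t,s,v]$ be forms of the same degree with $\gcd(P_1,\dots,P_4)=1$ and such that $P_i\neq\lambda P_j$ for all $i\ne j$ and $\lambda\in\mathbb K$. Suppose that $(P_1:P_2:P_3:P_4)$ parametrizes (not necessarily birationally) a surface $\mathcal S\subset\mathbb P^3(\mathbb K)$ which is not a plane: $\mathcal S$ is the zero set of an irreducible form $F(x_1,\dots,x_4)$ of degree different from $1$ and is the Zariski closure of the image of the parametrization. Let $\mathcal S_{x_4}\subset\mathbb K^3$ be the affine surface $F(x_1,x_2,x_3,1)=0$. For $i=1,2,3$ write $P_i(t,s,1)/P_4(t,s,1)=p_i(t,s)/q_i(t,s)$ in reduced form, put $\mathcal P_{x_4}=(p_1/q_1,p_2/q_2,p_3/q_3)$, and let $\Delta_4\subset\mathbb K^2$ be the zero set of $\operatorname{lcm}(q_1,q_2,q_3)$. Assume that no projective curve defined by (the homogenization of) a nonconstant polynomial among $p_1,p_2,p_3,q_1,q_2,q_3$ passes through $(0:1:0)$. Let $t,s,h_1,h_2,\bar t,\bar s,X_1,X_2,W_1,W_2,\dots$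 be independent variables. Below, "numerator" and "denominator" refer to the reduced form of a rational function in these variables (unique up to nonzero constants), gcds are taken in the polynomial ring over $\mathbb K$ in these variables, and all zero sets are sets of points $(\bar t,\bar s)\in\mathbb K^2$; the zero set of a set of polynomials is the set of their common zeros. For $i=1,2$ let $$\chi_i(t,s,\bar t,\bar s)=\frac{q_{i+1}(\bar t,\bar s)p_{i+1}(t,s)-p_{i+1}(\bar t,\bar s)q_{i+1}(t,s)}{q_1(\bar t,\bar s)p_1(t,s)-p_1(\bar t,\bar s)q_1(t,s)}\cdot\frac{q_1(t,s)}{q_{i+1}(t,s)}\cdot\frac{q_1(\bar t,\bar s)}{q_{i+1}(\bar t,\bar s)} .$$ * $\Delta_0^*$: Let $g_i$ be the numerator of $\chi_i(t,s,\bar t,\bar s)-\chi_i(h_1,h_2,\bar t,\bar s)$, let $\Upsilon_i$ be its leading coefficient with respect to $t$, let $\mathfrak r=\operatorname{Res}_t(g_1,g_2)$ and $K=\gcd(g_1,g_2)$. Then $\Delta_0^*$ is the union of the zero set of all coefficients (in $\mathbb K[\bar t,\bar s]$) of $\Upsilon_1$ and $\Upsilon_2$, the zero set of all coefficients of $\mathfrak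 r$, and the zero set of all coefficients of the homogeneous form of maximum degree of $K$ (as a polynomial over $\mathbb K[\bar t,\bar s]$). * $\Delta_1^*$: Let $H_i$ be the numerator of $\chi_i-X_i$ and $M_i$ its leading coefficient with respect to $s$. Then $\Delta_1^*$ is the union of the zero set of all coefficients (in $\mathbb K[\bar t,\bar s]$) of $M_1$, the zero set of all coefficients of $M_2$, and the zero sets of the four polynomials of $\mathbb K[\bar t,\bar s]$ obtained by homogenizing, with respect to $\{t,s\}$, the numerators and denominators of $\chi_1,\chi_2$ and evaluating at $(0:1:0)$. * $\Delta_2^*$: Let $R=\operatorname{Res}_s(H_1,H_2)$. Then $\Delta_2^*$ is the zero set of all coefficients (in $\mathbb K[\bar t,\bar s]$) of the leading coefficient of $R$ with respect to $t$. * $\Delta_3^*,\Delta_4^*$: Write $R=\sum_{m\in J}\bar a_m(t,\bar t,\bar s)X_1^{m_1}X_2^{m_2}$ with all $\bar a_m\ne0$, let $a=\gcd\{\bar a_m: m\in J\}$ and $a_m=\bar a_m/a$, let $N(\bar t,\bar s)$ be the leading coefficient of $a$ with respect to $t$, and fix any enumeration of $J$ (since $\mathcal S$ is not a plane, $J$ has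 at least two elements). If $J=\{m,m'\}$ has two elements, then $\Delta_3^*$ is the union of the common zero set of the two leading coefficients of $\bar a_{m},\bar a_{m'}$ with respect to $t$ and the zero set of $\operatorname{Res}_t(a_{m},a_{m'})$, and $\Delta_4^*$ is the zero set of $N$. If $J=\{m^{(1)},\dots,m^{(\ell)}\}$ with $\ell>2$, then $\Delta_3^*$ is the zero set of all coefficients (in $\mathbb K[\bar t,\bar s]$) of $\operatorname{Res}_t\bigl(a_{m^{(1)}},\,a_{m^{(2)}}+\sum_{k=3}^{\ell}W_{k-2}a_{m^{(k)}}\bigr)$, and $\Delta_4^*$ is the union of the zero set of the leading coefficient of $\bar a_{m^{(1)}}$ with respect to $t$ and the zero set of $N$. Let $\Delta^*=\Delta_0^*\cup\Delta_1^*\cup\Delta_2^*\cup\Delta_3^*\cup\Delta_4^*$. Then $\Delta^*$ is a Zariski closed subset of $\mathbb K^2$, and for every $(t_0,s_0)\in\mathbb K^2\setminus(\Delta_4\cup\Delta^*)$ the point $\mathcal P_{x_4}(t_0,s_0)$ is a simple point of $\mathcal S_{x_4}$, that is, it lies on $\mathcal S_{x_4}$ and has multiplicity $1$ on it. -/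

import Mathlib

open MvPolynomial

noncomputable section

namespace ParamSurface

/-! ### Divisibility in factorial rings -/

/-- A greatest common divisor of two elements of a factorial ring (unique up to a unit). -/
def polyGcd {R : Type*} [CommRing R] [IsDomain R] [UniqueFactorizationMonoid R] (f g : R) : R :=
  letI := UniqueFactorizationMonoid.toGCDMonoid R
  GCDMonoid.gcd f g

/-- A least common multiple of two elements of a factorial ring (unique up to a unit). -/
def polyLcm {R : Type*} [CommRing R] [IsDomain R] [UniqueFactorizationMonoid R] (f g : R) : R :=
  letI := UniqueFactorizationMonoid.toGCDMonoid R
  GCDMonoid.lcm f g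

/-- A greatest common divisor of a finite family in a factorial ring (unique up to a unit). -/
def familyGcd {R : Type*} [CommRing R] [IsDomain R] [UniqueFactorizationMonoid R]
    {ι : Type*} (J : Finset ι) (f : ι → R) : R :=
  letI : NormalizedGCDMonoid R := Classical.choice inferInstance
  J.gcd f

open Classical in
/-- The quotient `f / g` when `g` divides `f`. -/
def exactQuot {R : Type*} [CommRing R] (f g : R) : R :=
  if h : g ∣ f then h.choose else 0

/-! ### Surfaces, parametrizations and simple points -/

section Surface

variable {K : Type*} [Field K]

/-- The form `F` in `x₁, x₂, x₃, x₄` defines the Zariski closure in projective 3-space of the image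
of the rational map `(P₁ : P₂ : P₃ : P₄)` on the projective plane: a form vanishes on the image
if and only if it vanishes on the projective surface `F = 0`. -/
def Parametrizes (P : Fin 4 → MvPolynomial (Fin 3) K) (F : MvPolynomial (Fin 4) K) : Prop :=
  ∀ (e : ℕ) (G : MvPolynomial (Fin 4) K), G.IsHomogeneous e →
    ((∀ α : Fin 3 → K, (∃ i, eval α (P i) ≠ 0) → eval (fun i => eval α (P i)) G = 0) ↔
      ∀ x : Fin 4 → K, x ≠ 0 → eval x F = 0 → eval x G = 0)

/-- The defining polynomial of the affine surface obtained by setting `x₄ = 1`. -/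
def affinePoly (F : MvPolynomial (Fin 4) K) : MvPolynomial (Fin 3) K :=
  aeval ![X 0, X 1, X 2, 1] F

/-- The multiplicity of the point `A` on the affine surface with defining polynomial `f`: the least
degree of a nonzero homogeneous component of `f(x + a, y + b, z + c)`. -/
def pointMult (f : MvPolynomial (Fin 3) K) (A : Fin 3 → K) : ℕ :=
  sInf {n | homogeneousComponent n (aeval (fun i => X i + C (A i)) f : MvPolynomial (Fin 3) K) ≠ 0}

/-- `A` is a simple point of the affine surface with defining polynomial `f`. -/
def IsSimplePoint (f : MvPolynomial (Fin 3) K) (A : Fin 3 → K) : Prop :=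
  eval A f = 0 ∧ pointMult f A = 1

/-- `p̃ᵢ(t, s) = Pᵢ(t, s, 1)`. -/
def dehom (P : Fin 4 → MvPolynomial (Fin 3) K) (i : Fin 4) : MvPolynomial (Fin 2) K :=
  aeval ![X 0, X 1, 1] (P i)

/-- The `i`-th component `p̃ᵢ / p̃₄` of the affine parametrization `P_{x₄}(t, s)`. -/
def comp (P : Fin 4 → MvPolynomial (Fin 3) K) (i : Fin 3) :
    FractionRing (MvPolynomial (Fin 2) K) :=
  algebraMap _ _ (dehom P i.castSucc) / algebraMap _ _ (dehom P 3)

/-- The numerator `pᵢ(t, s)` of the `i`-th component in reduced form. -/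
def num (P : Fin 4 → MvPolynomial (Fin 3) K) (i : Fin 3) : MvPolynomial (Fin 2) K :=
  IsFractionRing.num (MvPolynomial (Fin 2) K) (comp P i)

/-- The denominator `q_{4,i}(t, s)` of the `i`-th component in reduced form. -/
def den (P : Fin 4 → MvPolynomial (Fin 3) K) (i : Fin 3) : MvPolynomial (Fin 2) K :=
  (IsFractionRing.den (MvPolynomial (Fin 2) K) (comp P i) : MvPolynomial (Fin 2) K)

/-- `Δ₄`: the zero set of the least common multiple of the three reduced denominators. -/
def Delta4 (P : Fin 4 → MvPolynomial (Fin 3) K) : Set (Fin 2 → K) :=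
  {c | eval c (polyLcm (den P 0) (polyLcm (den P 1) (den P 2))) = 0}

/-- The point `P_{x₄}(t₀, s₀)`. -/
def affinePoint (P : Fin 4 → MvPolynomial (Fin 3) K) (c : Fin 2 → K) : Fin 3 → K :=
  fun i => eval c (num P i) / eval c (den P i)

end Surface

/-! ### The working polynomial ring -/

/-- The variables besides the parameters `t̄, s̄` of the generic point: `t, s`, the copies `h₁, h₂`
of `t, s`, the variables `𝒳₁, 𝒳₂`, the variables `W₀, W₁, …`, and the homogenizing variable `v`. -/
inductive Var : Type
  | t : Var
  | s : Var
  | h1 : Var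
  | h2 : Var
  | x1 : Var
  | x2 : Var
  | W (n : ℕ) : Var
  | v : Var
  deriving DecidableEq

/-- `K[t̄, s̄]`. -/
abbrev Base (K : Type*) [Field K] : Type _ := MvPolynomial (Fin 2) K

/-- `K[t̄, s̄][t, s, h₁, h₂, 𝒳₁, 𝒳₂, W₀, W₁, …, v]`. -/
abbrev Big (K : Type*) [Field K] : Type _ := MvPolynomial Var (Base K)

section Ring

variable {K : Type*} [Field K]

/-- `f(t, s)` as an element of the working ring. -/
def atTS (f : MvPolynomial (Fin 2) K) : Big K := aeval ![X Var.t, X Var.s] f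

/-- `f(h₁, h₂)` as an element of the working ring. -/
def atH (f : MvPolynomial (Fin 2) K) : Big K := aeval ![X Var.h1, X Var.h2] f

/-- `f(t̄, s̄)` as an element of the working ring. -/
def atBar (f : MvPolynomial (Fin 2) K) : Big K := C f

/-- A polynomial seen as a univariate polynomial in the variable `x`. -/
def asUni (x : Var) : Big K →ₐ[Base K] Polynomial (Big K) :=
  aeval (fun w => if w = x then Polynomial.X else Polynomial.C (X w))

/-- The leading coefficient with respect to the variable `x`. -/
def lc (x : Var) (f : Big K) : Big K := (asUni x f).leadingCoeff

/-- The resultant with respect to the variable `x`. -/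
def res (x : Var) (f g : Big K) : Big K := Polynomial.resultant (asUni x f) (asUni x g)

/-- A polynomial seen as a polynomial in `𝒳₁, 𝒳₂`. -/
def asX : Big K →ₐ[Base K] MvPolynomial (Fin 2) (Big K) :=
  aeval (fun w => match w with
    | Var.x1 => X 0
    | Var.x2 => X 1
    | w => C (X w))

/-- The set of all `(t̄, s̄) ∈ K²` at which all the coefficients (elements of `K[t̄, s̄]`)
of `f` vanish. -/
def coeffZeros (f : Big K) : Set (Fin 2 → K) := {c | ∀ m : Var →₀ ℕ, eval c (coeff m f) = 0}

/-- The homogenization of `f ∈ K[t̄, s̄][t, s]` with respect to `t, s`, with new variable `v`. -/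
def homogenize (f : Big K) : Big K :=
  ∑ m ∈ f.support,
    monomial (m + Finsupp.single Var.v (f.totalDegree - m.degree)) (coeff m f)

/-- The homogenization of `f ∈ K[t̄, s̄][t, s]` evaluated at `(t : s : v) = (0 : 1 : 0)`. -/
def atInfty (f : Big K) : Base K :=
  eval (fun w => if w = Var.s then 1 else 0) (homogenize f)

end Ring

/-! ### The generic objects attached to `P` -/

section Generic

variable {K : Type*} [Field K] (P : Fin 4 → MvPolynomial (Fin 3) K)

/-- The rational function `(q_j(t̄,s̄) p_j - p_j(t̄,s̄) q_j) / (q_1(t̄,s̄) p_1 - p_1(t̄,s̄) q_1) ·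
(q_1 / q_j) · (q_1(t̄,s̄) / q_j(t̄,s̄))`, where `emb` is the pair of variables in which the
polynomials `p, q` without explicit argument are written (index `0` is the first coordinate). -/
def chiAux (emb : MvPolynomial (Fin 2) K → Big K) (j : Fin 3) : FractionRing (Big K) :=
  algebraMap (Big K) (FractionRing (Big K))
      (atBar (den P j) * emb (num P j) - atBar (num P j) * emb (den P j)) /
    algebraMap (Big K) (FractionRing (Big K))
      (atBar (den P 0) * emb (num P 0) - atBar (num P 0) * emb (den P 0)) *
  (algebraMap (Big K) (FractionRing (Big K)) (emb (den P 0)) /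
    algebraMap (Big K) (FractionRing (Big K)) (emb (den P j))) *
  (algebraMap (Big K) (FractionRing (Big K)) (atBar (den P 0)) /
    algebraMap (Big K) (FractionRing (Big K)) (atBar (den P j)))

/-- `χ_i(t, s, t̄, s̄)`, for `i = 1, 2` (here `i : Fin 2`). -/
def chi (i : Fin 2) : FractionRing (Big K) := chiAux P atTS i.succ

/-- `χ_i(h₁, h₂, t̄, s̄)`. -/
def chiH (i : Fin 2) : FractionRing (Big K) := chiAux P atH i.succ

/-- `𝔤_i`: the numerator of `χ_i(t, s, t̄, s̄) - χ_i(h₁, h₂, t̄, s̄)` in reduced form. -/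
def gPoly (i : Fin 2) : Big K := IsFractionRing.num (Big K) (chi P i - chiH P i)

/-- `K = gcd(𝔤₁, 𝔤₂)`. -/
def gcdK : Big K := polyGcd (gPoly P 0) (gPoly P 1)

/-- The common zeros of the coefficients of the form of maximum degree of `gcdK`. -/
def ZK : Set (Fin 2 → K) := coeffZeros (homogeneousComponent (gcdK P).totalDegree (gcdK P))

/-- `Δ*₀`. -/
def DeltaStar0 : Set (Fin 2 → K) :=
  (coeffZeros (lc Var.t (gPoly P 0)) ∩ coeffZeros (lc Var.t (gPoly P 1))) ∪
    coeffZeros (res Var.t (gPoly P 0) (gPoly P 1)) ∪ ZK P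

/-- The union of the zero sets of the values at `(0 : 1 : 0)` of the homogenized numerators and
denominators of `χ₁, χ₂`. -/
def ZInfty : Set (Fin 2 → K) :=
  {c | ∃ i : Fin 2, eval c (atInfty (IsFractionRing.num (Big K) (chi P i))) = 0 ∨
    eval c (atInfty (IsFractionRing.den (Big K) (chi P i) : Big K)) = 0}

/-- `H_i`: the numerator of `χ_i - 𝒳_i` in reduced form. -/
def HPoly (i : Fin 2) : Big K :=
  IsFractionRing.num (Big K)
    (chi P i - algebraMap (Big K) (FractionRing (Big K)) (X (![Var.x1, Var.x2] i)))

/-- `Δ*₁`. -/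
def DeltaStar1 : Set (Fin 2 → K) :=
  coeffZeros (lc Var.s (HPoly P 0)) ∪ coeffZeros (lc Var.s (HPoly P 1)) ∪ ZInfty P

/-- `R = Res_s(H₁, H₂)`. -/
def RPoly : Big K := res Var.s (HPoly P 0) (HPoly P 1)

/-- `Δ*₂`. -/
def DeltaStar2 : Set (Fin 2 → K) := coeffZeros (lc Var.t (RPoly P))

/-- The index set `J` of the nonzero coefficients of `R` with respect to `𝒳₁, 𝒳₂`. -/
def J : Finset (Fin 2 →₀ ℕ) := (asX (RPoly P)).support

/-- The coefficient `ā_m(t, t̄, s̄)` of `R` with respect to `𝒳₁, 𝒳₂`. -/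
def aBar (m : Fin 2 →₀ ℕ) : Big K := coeff m (asX (RPoly P))

/-- The content `a(t, t̄, s̄)` of `R` with respect to `𝒳₁, 𝒳₂`. -/
def content : Big K := familyGcd (J P) (aBar P)

/-- `a_m = ā_m / a`. -/
def aRed (m : Fin 2 →₀ ℕ) : Big K := exactQuot (aBar P m) (content P)

/-- `Δ*₃`, relative to an enumeration `l` of `J`: `card J = 2` is the first case and `card J > 2`
the second one. (Only a plane can have `card J < 2`.) -/
def DeltaStar3 (l : List (Fin 2 →₀ ℕ)) : Set (Fin 2 → K) :=
  match l with
  | [m₀, m₁] =>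
      (coeffZeros (lc Var.t (aBar P m₀)) ∩ coeffZeros (lc Var.t (aBar P m₁))) ∪
        coeffZeros (res Var.t (aRed P m₀) (aRed P m₁))
  | m₁ :: m₂ :: r =>
      coeffZeros (res Var.t (aRed P m₁)
        (aRed P m₂ + ∑ k : Fin r.length, X (Var.W k) * aRed P (r.get k)))
  | _ => ∅

/-- `Δ*₄`, relative to an enumeration `l` of `J`. -/
def DeltaStar4 (l : List (Fin 2 →₀ ℕ)) : Set (Fin 2 → K) :=
  match l with
  | m₁ :: _ :: _ :: _ => coeffZeros (lc Var.t (aBar P m₁)) ∪ coeffZeros (lc Var.t (content P))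
  | _ => coeffZeros (lc Var.t (content P))

/-- `Δ* = Δ*₀ ∪ Δ*₁ ∪ Δ*₂ ∪ Δ*₃ ∪ Δ*₄`, relative to an enumeration `l` of `J`. -/
def DeltaStar (l : List (Fin 2 →₀ ℕ)) : Set (Fin 2 → K) :=
  DeltaStar0 P ∪ DeltaStar1 P ∪ DeltaStar2 P ∪ DeltaStar3 P l ∪ DeltaStar4 P l

/-- None of the projective curves defined by the nonconstant polynomials among the reduced
numerators and denominators of `P_{x₄}` passes through `(0 : 1 : 0)`. -/
def AvoidsInfty : Prop :=
  ∀ i : Fin 3,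
    ((num P i).totalDegree ≠ 0 → atInfty (atTS (num P i)) ≠ 0) ∧
    ((den P i).totalDegree ≠ 0 → atInfty (atTS (den P i)) ≠ 0)

end Generic

end ParamSurface

end

open MvPolynomial

noncomputable section

/-! Closedness holds because Δ* is built by finite unions and intersections from common zero sets of
polynomials in t̄, s̄. Simplicity is proved by contradiction: suppose that all partial derivatives
of the affine equation f vanish at A = P(c).

A place (`exists_place`) specializes the generic parameters (t̄, s̄) to c inside a valuation ring V
of an algebraically closed field Ω, and keeps two extra elements x₀, x₁ algebraically independent.
Consider the line through the generic point a = P(t̄, s̄) with direction (1, x₀, x₁). Along it f(a +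
v·dir) = v·G(v). In characteristic 0 the generic point is simple, so G(0) ≠ 0. Since A is singular,
G(0) reduces to 0, although G itself does not. Hence G has a nonzero root v in the maximal ideal
(`Place.exists_intersection`): a second intersection point Q of the line and the surface collapses
to A.

The point Q is again generic on the surface, so it has a preimage y under the parametrization
(`Place.exists_preimage`). There χ_i takes the value of the i-th slope, so H₁, H₂ and R vanish at y
and these slopes. Avoiding Δ*₂ and the conditions at (0 : 1 : 0) forces both coordinates of y into
V. Avoiding Δ*₃ makes the reduction of the first coordinate transcendental over K. Avoiding Δ*₂
again leaves some χ_i with nonzero denominator at the reduced preimage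
(`Place.IsPreimage.exists_redEval_chiDen_ne_zero`).

For this i, consider the first component and the one that occurs in χ_i. They cannot be independent:
the two cross differences would share a prime factor that vanishes at the reduced preimage, and
independence would force that factor into K[t̄, s̄], making the first component constant. They
cannot be dependent either: their relation is a plane curve through the corresponding projection of
A, and its strict transform in the blow-up at that point would contain a point of the exceptional
line with transcendental slope, hence the whole line. These two facts,
`Place.IsPreimage.not_algebraicIndependent_comp` and `Place.IsPreimage.algebraicIndependent_comp`,
give the contradiction. -/

namespace ParamSurface

/-! ### Zariski closed subsets of the affine plane -/

section ZariskiClosed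

variable {K : Type*} [Field K]

/-- A subset of the affine plane is Zariski closed if it is the zero locus of an ideal. -/
def IsZariskiClosed (S : Set (Fin 2 → K)) : Prop :=
  ∃ I : Ideal (MvPolynomial (Fin 2) K), S = zeroLocus K I

lemma isZariskiClosed_setOf_forall {ι : Type*} (g : ι → MvPolynomial (Fin 2) K) :
    IsZariskiClosed {c | ∀ i, eval c (g i) = 0} := by
  refine ⟨Ideal.span (Set.range g), ?_⟩
  ext c
  simp [zeroLocus_span]

lemma IsZariskiClosed.union {S T : Set (Fin 2 → K)} (hS : IsZariskiClosed S)
    (hT : IsZariskiClosed T) : IsZariskiClosed (S ∪ T) := by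
  obtain ⟨I, rfl⟩ := hS
  obtain ⟨J, rfl⟩ := hT
  refine ⟨I * J, ?_⟩
  ext c
  simp only [Set.mem_union, mem_zeroLocus_iff]
  constructor
  · rintro (h | h) p hp
    · exact h p ((Ideal.mul_le_left : I * J ≤ I) hp)
    · exact h p ((Ideal.mul_le_right : I * J ≤ J) hp)
  · intro h
    by_contra! hc
    obtain ⟨⟨p, hp, hp0⟩, q, hq, hq0⟩ := hc
    have := h (p * q) (Ideal.mul_mem_mul hp hq)
    rw [map_mul] at this
    exact (mul_ne_zero hp0 hq0) this

lemma IsZariskiClosed.inter {S T : Set (Fin 2 → K)} (hS : IsZariskiClosed S)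
    (hT : IsZariskiClosed T) : IsZariskiClosed (S ∩ T) := by
  obtain ⟨I, rfl⟩ := hS
  obtain ⟨J, rfl⟩ := hT
  refine ⟨I ⊔ J, ?_⟩
  ext c
  simp only [Set.mem_inter_iff, mem_zeroLocus_iff]
  constructor
  · rintro ⟨h₁, h₂⟩ p hp
    obtain ⟨a, ha, b, hb, rfl⟩ := Submodule.mem_sup.1 hp
    rw [map_add, h₁ a ha, h₂ b hb, add_zero]
  · intro h
    exact ⟨fun p hp => h p (Ideal.mem_sup_left hp), fun p hp => h p (Ideal.mem_sup_right hp)⟩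

lemma isZariskiClosed_empty : IsZariskiClosed (∅ : Set (Fin 2 → K)) :=
  ⟨⊤, by simp [zeroLocus_top]⟩

lemma isZariskiClosed_coeffZeros (f : Big K) : IsZariskiClosed (coeffZeros f) :=
  isZariskiClosed_setOf_forall _

lemma isZariskiClosed_zeros (g : MvPolynomial (Fin 2) K) : IsZariskiClosed {c | eval c g = 0} := by
  simpa using isZariskiClosed_setOf_forall (fun _ : Unit => g)

lemma isZariskiClosed_DeltaStar (P : Fin 4 → MvPolynomial (Fin 3) K) (l : List (Fin 2 →₀ ℕ)) :
    IsZariskiClosed (DeltaStar P l) := by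
  have h0 : IsZariskiClosed (DeltaStar0 P) :=
    (((isZariskiClosed_coeffZeros _).inter (isZariskiClosed_coeffZeros _)).union
      (isZariskiClosed_coeffZeros _)).union (isZariskiClosed_coeffZeros _)
  have hinf : IsZariskiClosed (ZInfty P) := by
    have : ZInfty P = ({c | eval c (atInfty (IsFractionRing.num (Big K) (chi P 0))) = 0} ∪
        {c | eval c (atInfty (IsFractionRing.den (Big K) (chi P 0) : Big K)) = 0}) ∪
        ({c | eval c (atInfty (IsFractionRing.num (Big K) (chi P 1))) = 0} ∪
        {c | eval c (atInfty (IsFractionRing.den (Big K) (chi P 1) : Big K)) = 0}) := by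
      ext c
      simp [ZInfty, Fin.exists_fin_two]
    rw [this]
    exact ((isZariskiClosed_zeros _).union (isZariskiClosed_zeros _)).union
      ((isZariskiClosed_zeros _).union (isZariskiClosed_zeros _))
  have h1 : IsZariskiClosed (DeltaStar1 P) :=
    ((isZariskiClosed_coeffZeros _).union (isZariskiClosed_coeffZeros _)).union hinf
  have h3 : IsZariskiClosed (DeltaStar3 P l) := by
    unfold DeltaStar3
    split
    · exact ((isZariskiClosed_coeffZeros _).inter (isZariskiClosed_coeffZeros _)).union
        (isZariskiClosed_coeffZeros _)
    · exact isZariskiClosed_coeffZeros _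
    · exact isZariskiClosed_empty
  have h4 : IsZariskiClosed (DeltaStar4 P l) := by
    unfold DeltaStar4
    split
    · exact (isZariskiClosed_coeffZeros _).union (isZariskiClosed_coeffZeros _)
    · exact isZariskiClosed_coeffZeros _
  exact (((h0.union h1).union (isZariskiClosed_coeffZeros _)).union h3).union h4

end ZariskiClosed

/-! ### Specialization of relations between fractions -/

section Denominators

/-- Denominators of the value of a polynomial at fractions, cleared compatibly with two
homomorphisms. -/
lemma exists_clear_denominators {K σ R M E : Type*} [CommRing K] [CommRing R] [CommRing M]
    [IsDomain M] [CommRing E] [Algebra K R] [Algebra K M] [Algebra K E] (φ : R →ₐ[K] M)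
    (ψ : R →ₐ[K] E) (n d : σ → R) (y : σ → M) (z : σ → E) (hy : ∀ i, φ (d i) * y i = φ (n i))
    (hz : ∀ i, ψ (d i) * z i = ψ (n i)) (hd : ∀ i, φ (d i) ≠ 0) (F : MvPolynomial σ K) :
    ∃ D N : R, φ D ≠ 0 ∧ φ D * aeval y F = φ N ∧ ψ D * aeval z F = ψ N := by
  induction F using MvPolynomial.induction_on with
  | C a =>
    exact ⟨1, algebraMap K R a, by simp, by simp, by simp⟩
  | add p q hp hq =>
    obtain ⟨D, N, h0, h1, h2⟩ := hp
    obtain ⟨D', N', h0', h1', h2'⟩ := hq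
    refine ⟨D * D', N * D' + D * N', by rw [map_mul]; exact mul_ne_zero h0 h0', ?_, ?_⟩
    · simp only [map_add, map_mul, ← h1, ← h1']; ring
    · simp only [map_add, map_mul, ← h2, ← h2']; ring
  | mul_X p i hp =>
    obtain ⟨D, N, h0, h1, h2⟩ := hp
    refine ⟨D * d i, N * n i, by rw [map_mul]; exact mul_ne_zero h0 (hd i), ?_, ?_⟩
    · simp only [map_mul, aeval_X, ← h1, ← hy]; ring
    · simp only [map_mul, aeval_X, ← h2, ← hz]; ring

/-- A polynomial relation between fractions specializes whenever the denominators do not vanish. -/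
lemma aeval_eq_zero_of_fractions {K σ R M : Type*} [CommRing K] [CommRing R] [IsDomain R]
    [CommRing M] [IsDomain M] [Algebra K R] [Algebra K M] (φ : R →ₐ[K] M) (n d : σ → R)
    (y : σ → M) (z : σ → FractionRing R) (hy : ∀ i, φ (d i) * y i = φ (n i))
    (hz : ∀ i, algebraMap R _ (d i) * z i = algebraMap R _ (n i)) (hd : ∀ i, φ (d i) ≠ 0)
    (F : MvPolynomial σ K) (hF : aeval z F = 0) : aeval y F = 0 := by
  obtain ⟨D, N, h0, h1, h2⟩ := exists_clear_denominators φ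
    (IsScalarTower.toAlgHom K R (FractionRing R)) n d y z hy hz hd F
  rw [hF, mul_zero] at h2
  -- The cleared numerator already vanishes in `R`, so it vanishes under every specialization.
  have hN : N = 0 := by
    apply IsFractionRing.injective R (FractionRing R)
    rw [map_zero]; exact h2.symm
  rw [hN, map_zero] at h1
  exact (mul_eq_zero.1 h1).resolve_left h0

end Denominators

/-! ### Forms and dehomogenization -/

section Homogeneous

lemma _root_.MvPolynomial.IsHomogeneous.aeval_mul {R σ S : Type*} [CommSemiring R] [CommSemiring S] [Algebra R S]
    {A : MvPolynomial σ R} {n : ℕ} (hA : A.IsHomogeneous n) (a : S) (y : σ → S) :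
    aeval (fun j => a * y j) A = a ^ n * aeval y A := by
  rw [aeval_def, aeval_def, eval₂_eq, eval₂_eq, Finset.mul_sum]
  refine Finset.sum_congr rfl fun m hm => ?_
  have : (∑ i ∈ m.support, m i) = n := hA.degree_eq_sum_deg_support hm ▸ rfl
  simp only [mul_pow, Finset.prod_mul_distrib, Finset.prod_pow_eq_pow_sum, this]
  ring

variable {K : Type*} [Field K] [Infinite K]

/-- A form that vanishes at all points with `i`-th coordinate `1` is zero. -/
lemma _root_.MvPolynomial.IsHomogeneous.eq_zero_of_eval_eq_zero {σ : Type*} {A : MvPolynomial σ K} {n : ℕ}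
    (hA : A.IsHomogeneous n) (i : σ) (h : ∀ β : σ → K, β i = 1 → eval β A = 0) : A = 0 := by
  -- The factor `X i` takes care of the hyperplane αᵢ = 0, to which scaling does not reach.
  have key : X i * A = 0 := by
    apply MvPolynomial.funext
    intro α
    rw [map_mul, eval_X, map_zero]
    by_cases hα : α i = 0
    · rw [hα, zero_mul]
    · have h1 := h (fun j => (α i)⁻¹ * α j) (inv_mul_cancel₀ hα)
      have h2 : eval (fun j => α i * ((α i)⁻¹ * α j)) A
          = α i ^ n * eval (fun j => (α i)⁻¹ * α j) A := by
        simpa [aeval_eq_eval] using hA.aeval_mul (α i) (fun j => (α i)⁻¹ * α j)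
      have h3 : (fun j => α i * ((α i)⁻¹ * α j)) = α := by
        funext j; rw [mul_inv_cancel_left₀ hα]
      rw [h3, h1, mul_zero] at h2
      rw [h2, mul_zero]
  exact (mul_eq_zero.1 key).resolve_left (X_ne_zero i)

end Homogeneous

/-! ### The equation of the surface and its generic point -/

section Surface

variable {K : Type*} [Field K]

lemma den_ne_zero (P : Fin 4 → MvPolynomial (Fin 3) K) (i : Fin 3) : den P i ≠ 0 :=
  nonZeroDivisors.coe_ne_zero _

lemma den_mul_comp (P : Fin 4 → MvPolynomial (Fin 3) K) (i : Fin 3) :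
    algebraMap _ (FractionRing (MvPolynomial (Fin 2) K)) (den P i) * comp P i
      = algebraMap _ _ (num P i) := by
  rw [mul_comm]
  exact IsFractionRing.num_mul_den_eq_num_iff_eq.2 rfl

lemma eval_dehom (P : Fin 4 → MvPolynomial (Fin 3) K) (i : Fin 4) (c : Fin 2 → K) :
    eval c (dehom P i) = eval ![c 0, c 1, 1] (P i) := by
  rw [dehom, ← aeval_eq_eval, ← aeval_eq_eval]
  change ((aeval c).comp (aeval ![X 0, X 1, 1])) (P i) = _
  rw [comp_aeval]
  congr 2
  funext j
  fin_cases j <;> simp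

lemma eval_affinePoly (F : MvPolynomial (Fin 4) K) (a : Fin 3 → K) :
    eval a (affinePoly F) = eval ![a 0, a 1, a 2, 1] F := by
  rw [affinePoly, ← aeval_eq_eval, ← aeval_eq_eval]
  change ((aeval a).comp (aeval ![X 0, X 1, X 2, 1])) F = _
  rw [comp_aeval]
  congr 2
  funext j
  fin_cases j <;> simp

lemma aeval_affinePoly {S : Type*} [CommRing S] [Algebra K S] (F : MvPolynomial (Fin 4) K)
    (a : Fin 3 → S) : aeval a (affinePoly F) = aeval ![a 0, a 1, a 2, 1] F := by
  rw [affinePoly]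
  change ((aeval a).comp (aeval ![X 0, X 1, X 2, 1])) F = _
  rw [comp_aeval]
  congr 2
  funext j
  fin_cases j <;> simp

/-- The homogenization of `h` to degree `e`. -/
lemma exists_homogenization (h : MvPolynomial (Fin 3) K) :
    ∃ (e : ℕ) (G : MvPolynomial (Fin 4) K), G.IsHomogeneous e ∧ e ≠ 0 ∧ affinePoly G = h := by
  -- One degree more than necessary: a form of positive degree vanishes at the origin, which the
  -- Nullstellensatz argument below requires.
  refine ⟨h.totalDegree + 1, ∑ n ∈ Finset.range (h.totalDegree + 1),
    X 3 ^ (h.totalDegree + 1 - n) * rename Fin.castSucc (homogeneousComponent n h), ?_, by simp, ?_⟩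
  · refine IsHomogeneous.sum _ _ _ fun n hn => ?_
    have hn' : n < h.totalDegree + 1 := Finset.mem_range.1 hn
    have := (isHomogeneous_X_pow (R := K) (3 : Fin 4) (h.totalDegree + 1 - n)).mul
      ((homogeneousComponent_isHomogeneous n h).rename_isHomogeneous (f := Fin.castSucc))
    rwa [Nat.sub_add_cancel hn'.le] at this
  · rw [affinePoly, map_sum]
    conv_rhs => rw [← sum_homogeneousComponent h]
    refine Finset.sum_congr rfl fun n hn => ?_
    rw [map_mul, map_pow, aeval_X, aeval_rename]
    have : (![X 0, X 1, X 2, 1] ∘ Fin.castSucc : Fin 3 → MvPolynomial (Fin 3) K) = X := by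
      funext j; fin_cases j <;> rfl
    rw [this, aeval_X_left]
    simp

section Infinite

variable [Infinite K]

lemma eq_zero_of_dehom_eq_zero {A : MvPolynomial (Fin 3) K} {n : ℕ} (hA : A.IsHomogeneous n)
    (h : (aeval ![X 0, X 1, 1] A : MvPolynomial (Fin 2) K) = 0) : A = 0 := by
  refine hA.eq_zero_of_eval_eq_zero 2 fun β hβ => ?_
  have := eval_dehom (fun _ => A) 0 ![β 0, β 1]
  rw [dehom, h, map_zero] at this
  rw [this]
  congr 2
  funext j
  fin_cases j <;> simp [hβ]

lemma dehom_ne_zero {P : Fin 4 → MvPolynomial (Fin 3) K} {γ : ℕ}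
    (hP : ∀ i, (P i).IsHomogeneous γ) (hprop : ∀ i j, i ≠ j → ∀ c : K, P i ≠ C c * P j)
    (i : Fin 4) : dehom P i ≠ 0 := by
  intro h
  obtain ⟨j, hj⟩ := exists_ne i
  -- The zero form is the multiple by 0 of any other one.
  exact hprop i j hj.symm 0 (by simpa using eq_zero_of_dehom_eq_zero (hP i) h)

/-- No component of the affine parametrization is constant. -/
lemma comp_ne_algebraMap {P : Fin 4 → MvPolynomial (Fin 3) K} {γ : ℕ}
    (hP : ∀ i, (P i).IsHomogeneous γ) (hprop : ∀ i j, i ≠ j → ∀ c : K, P i ≠ C c * P j)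
    (i : Fin 3) (a : K) : comp P i ≠ algebraMap K _ a := by
  intro h
  have h3 := dehom_ne_zero hP hprop 3
  rw [comp, div_eq_iff (by simpa using h3),
    IsScalarTower.algebraMap_apply K (MvPolynomial (Fin 2) K), ← map_mul] at h
  have h' := IsFractionRing.injective (MvPolynomial (Fin 2) K) _ h
  have hhom : (P i.castSucc - C a * P 3).IsHomogeneous γ :=
    (hP _).sub ((hP 3).C_mul a)
  have h0 := eq_zero_of_dehom_eq_zero hhom (by
    rw [map_sub, map_mul]
    change dehom P i.castSucc - _ * dehom P 3 = 0
    rw [h', sub_eq_zero]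
    simp [algebraMap_eq])
  refine hprop i.castSucc 3 ?_ a (sub_eq_zero.1 h0)
  intro h
  have := congrArg Fin.val h
  simp at this
  omega

lemma affinePoly_ne_zero {F : MvPolynomial (Fin 4) K} {d : ℕ} (hF : F.IsHomogeneous d)
    (h0 : F ≠ 0) : affinePoly F ≠ 0 := by
  intro h
  refine h0 (hF.eq_zero_of_eval_eq_zero 3 fun β hβ => ?_)
  have := eval_affinePoly F ![β 0, β 1, β 2]
  rw [h, map_zero] at this
  rw [this]
  congr 2
  funext j
  fin_cases j <;> simp [hβ]

lemma aeval_parametrization_eq_zero {P : Fin 4 → MvPolynomial (Fin 3) K}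
    {F : MvPolynomial (Fin 4) K} {d : ℕ} (hF : F.IsHomogeneous d) (hirr : Irreducible F)
    (hparam : Parametrizes P F) : aeval P F = 0 := by
  apply MvPolynomial.funext
  intro α
  have hev : eval α (aeval P F) = eval (fun i => eval α (P i)) F := by
    rw [← aeval_eq_eval, ← aeval_eq_eval]
    change ((aeval α).comp (aeval P)) F = _
    rw [comp_aeval]
  rw [hev, map_zero]
  by_cases h : ∃ i, eval α (P i) ≠ 0
  · exact (hparam d F hF).2 (fun x _ hx => hx) α h
  · push Not at h
    -- `Parametrizes` says nothing at the base points of the parametrization. There every Pᵢ is 0,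
    -- and F vanishes at the origin because its degree is positive.
    have hd : d ≠ 0 := by
      rintro rfl
      rw [← totalDegree_zero_iff_isHomogeneous, totalDegree_eq_zero_iff_eq_C] at hF
      have hne := hirr.ne_zero
      apply hirr.not_isUnit
      rw [hF] at hne ⊢
      exact (IsUnit.mk0 _ (by simpa using hne)).map C
    have h0 := hF.aeval_mul (S := K) 0 (fun i => eval α (P i))
    rw [zero_pow hd, zero_mul] at h0
    rw [← aeval_eq_eval]
    simpa [h] using h0

lemma aeval_comp_affinePoly {P : Fin 4 → MvPolynomial (Fin 3) K}
    {F : MvPolynomial (Fin 4) K} {d : ℕ} (hF : F.IsHomogeneous d) (hirr : Irreducible F)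
    (hparam : Parametrizes P F) (h3 : dehom P 3 ≠ 0) :
    aeval (comp P) (affinePoly F) = 0 := by
  set a := algebraMap (MvPolynomial (Fin 2) K) (FractionRing (MvPolynomial (Fin 2) K)) with ha
  have ha3 : a (dehom P 3) ≠ 0 := by simpa [ha] using h3
  rw [aeval_affinePoly]
  have h1 := hF.aeval_mul (a (dehom P 3)) ![comp P 0, comp P 1, comp P 2, 1]
  have h2 : (fun j => a (dehom P 3) * (![comp P 0, comp P 1, comp P 2, 1] : Fin 4 → _) j)
      = fun j => a (dehom P j) := by
    funext j
    fin_cases j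
    · exact mul_div_cancel₀ _ ha3
    · exact mul_div_cancel₀ _ ha3
    · exact mul_div_cancel₀ _ ha3
    · exact mul_one _
  have h4 : aeval (fun j => a (dehom P j)) F = 0 := by
    have : aeval (fun j => a (dehom P j)) F = a (aeval ![X 0, X 1, 1] (aeval P F)) := by
      rw [← AlgHom.comp_apply, comp_aeval, ha, ← aeval_algebraMap_apply]
      rfl
    rw [this, aeval_parametrization_eq_zero hF hirr hparam, map_zero, map_zero]
  rw [h2, h4] at h1
  exact (mul_eq_zero.1 h1.symm).resolve_left (pow_ne_zero _ ha3)

end Infinite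

/-- The polynomial relations between the components of the affine parametrization are the
multiples of the equation of the affine surface. -/
lemma affinePoly_dvd_of_aeval_comp_eq_zero [IsAlgClosed K] {P : Fin 4 → MvPolynomial (Fin 3) K}
    {γ : ℕ} (hP : ∀ i, (P i).IsHomogeneous γ)
    {F : MvPolynomial (Fin 4) K} (hirr : Irreducible F)
    (hparam : Parametrizes P F) (h3 : dehom P 3 ≠ 0) (h : MvPolynomial (Fin 3) K)
    (hh : aeval (comp P) h = 0) : affinePoly F ∣ h := by
  obtain ⟨e, G, hG, he, rfl⟩ := exists_homogenization h
  set a := algebraMap (MvPolynomial (Fin 2) K) (FractionRing (MvPolynomial (Fin 2) K)) with ha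
  have ha3 : a (dehom P 3) ≠ 0 := by simpa [ha] using h3
  have hGP : aeval P G = 0 := by
    apply eq_zero_of_dehom_eq_zero (hG.aeval (n := γ) P hP)
    apply IsFractionRing.injective (MvPolynomial (Fin 2) K) (FractionRing (MvPolynomial (Fin 2) K))
    rw [← AlgHom.comp_apply, comp_aeval, ← aeval_algebraMap_apply, map_zero]
    change aeval (fun j => a (dehom P j)) G = 0
    rw [aeval_affinePoly] at hh
    have h1 := hG.aeval_mul (a (dehom P 3)) ![comp P 0, comp P 1, comp P 2, 1]
    have h2 : (fun j => a (dehom P 3) * (![comp P 0, comp P 1, comp P 2, 1] : Fin 4 → _) j)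
        = fun j => a (dehom P j) := by
      funext j
      fin_cases j
      · exact mul_div_cancel₀ _ ha3
      · exact mul_div_cancel₀ _ ha3
      · exact mul_div_cancel₀ _ ha3
      · exact mul_one _
    rw [← h2, h1, hh, mul_zero]
  have hvan := (hparam e G hG).1 (fun α _ => by
    have hev : eval α (aeval P G) = eval (fun i => eval α (P i)) G := by
      rw [← aeval_eq_eval, ← aeval_eq_eval]
      change ((aeval α).comp (aeval P)) G = _
      rw [comp_aeval]
    rw [← hev, hGP, map_zero])
  -- Nullstellensatz in affine 4-space. `Parametrizes` covers the nonzero points, and `he` covers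
  -- the origin.
  have hmem : G ∈ (Ideal.span {F}).radical := by
    rw [← vanishingIdeal_zeroLocus_eq_radical (K := K), mem_vanishingIdeal_iff]
    intro x hx
    rw [zeroLocus_span] at hx
    have hx' : eval x F = 0 := by simpa using hx
    by_cases hx0 : x = 0
    · have h0 := hG.aeval_mul (S := K) 0 (0 : Fin 4 → K)
      rw [zero_pow he, zero_mul] at h0
      rw [hx0]
      simpa using h0
    · simpa using hvan x hx0 hx'
  obtain ⟨n, hn⟩ := hmem
  rw [Ideal.mem_span_singleton] at hn
  obtain ⟨B, hB⟩ := hirr.prime.dvd_of_dvd_pow hn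
  exact ⟨affinePoly B, by rw [hB, affinePoly, map_mul]; rfl⟩

/-- Some partial derivative of the equation of the surface does not vanish at the generic point. -/
lemma exists_aeval_comp_pderiv_ne_zero [IsAlgClosed K] [CharZero K]
    {P : Fin 4 → MvPolynomial (Fin 3) K} {γ : ℕ} (hP : ∀ i, (P i).IsHomogeneous γ)
    {F : MvPolynomial (Fin 4) K} {d : ℕ} (hF : F.IsHomogeneous d) (hirr : Irreducible F)
    (hparam : Parametrizes P F) (h3 : dehom P 3 ≠ 0) :
    ∃ j, aeval (comp P) (pderiv j (affinePoly F)) ≠ 0 := by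
  by_contra! hall
  have hf0 := affinePoly_ne_zero hF hirr.ne_zero
  have hfP := aeval_comp_affinePoly hF hirr hparam h3
  set f := affinePoly F with hf
  -- A partial derivative that vanishes at the generic point is a multiple of f, but its degree in
  -- xⱼ is smaller, so it is 0. In characteristic 0 this means that f does not involve xⱼ.
  have hdeg : ∀ j, degreeOf j f = 0 := by
    intro j
    by_contra hj
    obtain ⟨m, hm, hmj⟩ : ∃ m ∈ f.support, m j ≠ 0 := by
      by_contra! hcon
      apply hj
      rw [degreeOf_eq_sup]
      exact Nat.le_zero.1 (Finset.sup_le fun m hm => (hcon m hm).le)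
    have hne : pderiv j f ≠ 0 := by
      intro h0
      have := congrArg (coeff (m - Finsupp.single j 1)) h0
      rw [coeff_pderiv, coeff_zero, Finsupp.sub_add_single_one_cancel hmj] at this
      exact (mul_ne_zero (mem_support_iff.1 hm) (Nat.cast_add_one_ne_zero _)) this
    obtain ⟨B, hB⟩ := affinePoly_dvd_of_aeval_comp_eq_zero hP hirr hparam h3 _ (hall j)
    have hB0 : B ≠ 0 := by rintro rfl; exact hne (by rw [hB, mul_zero])
    have hlt : degreeOf j (pderiv j f) < degreeOf j f := by
      rw [degreeOf_lt_iff (Nat.pos_of_ne_zero hj)]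
      intro u hu
      rw [mem_support_iff, coeff_pderiv] at hu
      have : u + Finsupp.single j 1 ∈ f.support := mem_support_iff.2 (left_ne_zero_of_mul hu)
      have := monomial_le_degreeOf j this
      simp at this
      omega
    rw [hB, degreeOf_mul_eq hf0 hB0] at hlt
    omega
  have hC : f = C (coeff 0 f) := by
    rw [← totalDegree_eq_zero_iff_eq_C, totalDegree_eq_zero_iff]
    intro m hm j
    have := monomial_le_degreeOf j hm
    rw [hdeg] at this
    omega
  rw [hC, aeval_C] at hfP
  have h0 : coeff 0 f = 0 := by simpa using hfP
  exact hf0 (by rw [hC, h0, C_0])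

end Surface

/-! ### Places over a point of the parameter plane -/

section Place

/-- A place of an extension `Ω` of `K(t̄, s̄)(x₀, x₁)` that specializes `(t̄, s̄)` to the point `c`
and keeps `x₀, x₁` algebraically independent: `V` is its valuation ring and `k` contains its
residue field. -/
structure Place {K : Type*} [Field K] (c : Fin 2 → K) (V Ω k : Type*) [CommRing V] [Field Ω]
    [Field k] [Algebra K V] [Algebra K Ω] [Algebra K k] where
  /-- The inclusion of the valuation ring. -/
  incl : V →ₐ[K] Ω
  /-- The reduction map. -/
  red : V →ₐ[K] k
  /-- The inclusion of the ring `K[t̄, s̄]`. -/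
  par : Base K →ₐ[K] V
  /-- The two independent slopes. -/
  x : Fin 2 → V
  incl_injective : Function.Injective incl
  mem_or_inv_mem : ∀ y : Ω, (∃ v, incl v = y) ∨ ∃ v, incl v = y⁻¹
  isUnit_of_red_ne_zero : ∀ v, red v ≠ 0 → IsUnit v
  red_par : ∀ g, red (par g) = algebraMap K k (eval c g)
  indep : Function.Injective
    (eval₂Hom ((incl : V →+* Ω).comp (par : Base K →+* V)) (fun i => incl (x i)))
  indep_red : AlgebraicIndependent K (fun i => red (x i))

/-- The place is built from K(x₀, x₁)[t̄, s̄], whereas independence of the slopes is a statement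
about K[t̄, s̄][x₀, x₁]. This identity exchanges the two pairs of variables. -/
lemma eval₂Hom_map_eq_map_commAlgEquiv {K L : Type*} [CommRing K] [CommRing L] [Algebra K L]
    [Algebra (MvPolynomial (Fin 2) K) L] [IsScalarTower K (MvPolynomial (Fin 2) K) L]
    (g : MvPolynomial (Fin 2) (MvPolynomial (Fin 2) K)) :
    eval₂Hom (MvPolynomial.map (algebraMap K L) : MvPolynomial (Fin 2) K →+* MvPolynomial (Fin 2) L)
        (fun i => C (algebraMap (MvPolynomial (Fin 2) K) L (X i))) g
      = MvPolynomial.map (algebraMap (MvPolynomial (Fin 2) K) L)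
          (commAlgEquiv K (Fin 2) (Fin 2) g) := by
  induction g using MvPolynomial.induction_on with
  | C a =>
    rw [coe_eval₂Hom, eval₂_C, commAlgEquiv_C, map_map,
      IsScalarTower.algebraMap_eq K (MvPolynomial (Fin 2) K) L]
    rfl
  | add p q hp hq => rw [map_add, map_add, map_add, hp, hq]
  | mul_X p i hp => rw [map_mul, map_mul, map_mul, hp, commAlgEquiv_X, map_C, coe_eval₂Hom, eval₂_X]

universe u

/-- Localize K(x₀, x₁)[t̄, s̄] at the maximal ideal of the point c and dominate this local ring by a
valuation ring of an algebraically closed field. Since x₀, x₁ are constants of the coefficient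
field, and a field embeds into the residue field, they remain independent after reduction. -/
theorem exists_place {K : Type u} [Field K] (c : Fin 2 → K) :
    ∃ (Ω : Type u) (_ : Field Ω) (_ : IsAlgClosed Ω) (_ : Algebra K Ω) (V : Type u)
      (_ : CommRing V) (_ : Algebra K V) (k : Type u) (_ : Field k) (_ : Algebra K k),
      Nonempty (Place c V Ω k) := by
  let K' := FractionRing (MvPolynomial (Fin 2) K)
  let O := MvPolynomial (Fin 2) K'
  let Ω := AlgebraicClosure (FractionRing O)
  let ε : O →+* K' := eval (fun i => algebraMap K K' (c i))
  let 𝔪 : Ideal O := RingHom.ker ε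
  have h𝔪 : 𝔪.IsPrime := RingHom.ker_isPrime ε
  have hinj : Function.Injective (algebraMap O Ω) := by
    rw [IsScalarTower.algebraMap_eq O (FractionRing O) Ω]
    exact (algebraMap (FractionRing O) Ω).injective.comp (IsFractionRing.injective O _)
  have hunits : ∀ y : 𝔪.primeCompl, IsUnit (algebraMap O Ω y) := by
    intro y
    refine IsUnit.mk0 _ fun h => ?_
    rw [map_eq_zero_iff _ hinj] at h
    exact y.2 (h ▸ 𝔪.zero_mem)
  let f : Localization.AtPrime 𝔪 →+* Ω := IsLocalization.lift hunits
  -- Domination: nonunits of the localization stay nonunits in `A`, so polynomials vanishing at c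
  -- reduce to 0.
  obtain ⟨A, hA, hloc⟩ := IsLocalRing.exists_factor_valuationRing (R := Localization.AtPrime 𝔪) (K := Ω) f
  let f' : Localization.AtPrime 𝔪 →+* A := f.codRestrict A.toSubring hA
  have hloc' : IsLocalHom f' := hloc
  let o : O →+* A := f'.comp (algebraMap O (Localization.AtPrime 𝔪))
  have ho : ∀ g, ((o g : A) : Ω) = algebraMap O Ω g := fun g => IsLocalization.lift_eq hunits g
  let r : A →+* IsLocalRing.ResidueField A := IsLocalRing.residue A
  have hro : ∀ g, ε g = 0 → r (o g) = 0 := by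
    intro g hg
    rw [IsLocalRing.residue_eq_zero_iff, IsLocalRing.mem_maximalIdeal, mem_nonunits_iff]
    intro hu
    have h1 : IsUnit (algebraMap O (Localization.AtPrime 𝔪) g) := isUnit_of_map_unit f' _ hu
    rw [IsLocalization.AtPrime.isUnit_to_map_iff _ 𝔪] at h1
    exact h1 hg
  let κ : K →+* A := o.comp ((C : K' →+* O).comp (algebraMap K K'))
  let aV : Algebra K A := κ.toAlgebra
  let aΩ : Algebra K Ω := (A.subtype.comp κ).toAlgebra
  let ak : Algebra K (IsLocalRing.ResidueField A) := (r.comp κ).toAlgebra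
  let bO : Base K →+* O := MvPolynomial.map (algebraMap K K')
  have hpar : ∀ a, (o.comp bO) (algebraMap K (Base K) a) = algebraMap K A a := by
    intro a
    exact congrArg o (map_C (algebraMap K K') a)
  have hεb : ∀ g, ε (bO g) = algebraMap K K' (eval c g) := by
    intro g
    have : ε.comp bO = (algebraMap K K').comp (eval c) := by
      apply ringHom_ext
      · intro a
        change ε (bO (C a)) = algebraMap K K' (eval c (C a))
        rw [eval_C, show bO (C a) = C (algebraMap K K' a) from map_C _ a]
        exact eval_C _
      · intro i
        change ε (bO (X i)) = algebraMap K K' (eval c (X i))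
        rw [eval_X, show bO (X i) = X i from map_X _ i]
        exact eval_X _
    exact RingHom.congr_fun this g
  refine ⟨Ω, inferInstance, inferInstance, aΩ, A, inferInstance, aV, IsLocalRing.ResidueField A,
    inferInstance, ak, ⟨{
      incl := { A.subtype with commutes' := fun a => rfl }
      red := { r with commutes' := fun a => rfl }
      par := { o.comp bO with commutes' := hpar }
      x := fun i => o (C (algebraMap (MvPolynomial (Fin 2) K) K' (X i)))
      incl_injective := Subtype.val_injective
      mem_or_inv_mem := fun y => (A.mem_or_inv_mem y).imp (fun h => ⟨⟨_, h⟩, rfl⟩)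
        (fun h => ⟨⟨_, h⟩, rfl⟩)
      isUnit_of_red_ne_zero := fun v hv => by
        by_contra hu
        exact hv ((IsLocalRing.residue_eq_zero_iff v).2 hu)
      red_par := fun g => by
        change r (o (bO g)) = r (o (C (algebraMap K K' (eval c g))))
        rw [← sub_eq_zero, ← map_sub, ← map_sub]
        apply hro
        rw [map_sub, sub_eq_zero]
        rw [hεb]
        exact (eval_C _).symm
      indep := ?_
      indep_red := ?_ }⟩⟩
  · have key : ∀ g, eval₂Hom (A.subtype.comp (o.comp bO))
        (fun i => (o (C (algebraMap (MvPolynomial (Fin 2) K) K' (X i))) : Ω)) g = algebraMap O Ω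
          (eval₂Hom bO (fun i => (C (algebraMap (MvPolynomial (Fin 2) K) K' (X i)) : O)) g) := by
      intro g
      rw [← RingHom.comp_apply]
      congr 1
      apply ringHom_ext
      · intro a; simp [ho]
      · intro i; simp [ho]
    have hcomm : ∀ g, eval₂Hom bO
        (fun i => (C (algebraMap (MvPolynomial (Fin 2) K) K' (X i)) : O)) g
        = MvPolynomial.map (algebraMap (MvPolynomial (Fin 2) K) K')
          (commAlgEquiv K (Fin 2) (Fin 2) g) := by
      exact eval₂Hom_map_eq_map_commAlgEquiv
    intro g g' hg
    have hg' : algebraMap O Ω _ = algebraMap O Ω _ := (key g).symm.trans (hg.trans (key g'))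
    have h2 := hinj hg'
    rw [hcomm, hcomm] at h2
    exact (commAlgEquiv K (Fin 2) (Fin 2)).injective
      (map_injective _ (IsFractionRing.injective _ _) h2)
  · let ρ : K' →+* IsLocalRing.ResidueField A := (r.comp o).comp C
    have hX : AlgebraicIndependent K (X : Fin 2 → MvPolynomial (Fin 2) K) :=
      algebraicIndependent_X _ _
    let ρ' : MvPolynomial (Fin 2) K →ₐ[K] IsLocalRing.ResidueField A :=
      { ρ.comp (algebraMap (MvPolynomial (Fin 2) K) K') with commutes' := fun a => rfl }
    exact hX.map' (f := ρ') (ρ.injective.comp (IsFractionRing.injective _ _))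

end Place

namespace Place

variable {K V Ω k : Type*} [Field K] [CommRing V] [Field Ω] [Field k] [Algebra K V] [Algebra K Ω]
  [Algebra K k] {c : Fin 2 → K}

lemma isDomain (p : Place c V Ω k) : IsDomain V := p.incl_injective.isDomain (p.incl : V →+* Ω)

variable (p : Place c V Ω k)

/-- An element outside a valuation ring is the inverse of an element of the maximal ideal. -/
lemma exists_incl_eq_or_inv (y : Ω) :
    (∃ v, p.incl v = y) ∨ ∃ z, p.incl z * y = 1 ∧ p.red z = 0 := by
  by_cases h : ∃ v, p.incl v = y
  · exact Or.inl h
  right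
  obtain ⟨z, hz⟩ := (p.mem_or_inv_mem y).resolve_left h
  have hy : y ≠ 0 := by
    rintro rfl
    exact h ⟨0, map_zero _⟩
  refine ⟨z, by rw [hz, inv_mul_cancel₀ hy], ?_⟩
  by_contra hr
  obtain ⟨w, hw⟩ := (p.isUnit_of_red_ne_zero z hr).exists_left_inv
  refine h ⟨w, ?_⟩
  have h1 : p.incl w * p.incl z = 1 := by rw [← map_mul, hw, map_one]
  rw [hz] at h1
  exact (mul_inv_eq_one₀ hy).1 h1

/-- A root of a polynomial over the valuation ring whose leading coefficient reduces to a nonzero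
element belongs to the valuation ring. -/
lemma exists_incl_eq_of_root {f : Polynomial V} {n : ℕ} (hn : f.natDegree ≤ n)
    (hf : p.red (f.coeff n) ≠ 0) {y : Ω} (hy : f.eval₂ (p.incl : V →+* Ω) y = 0) :
    ∃ v, p.incl v = y := by
  refine (p.exists_incl_eq_or_inv y).resolve_right ?_
  rintro ⟨z, hz, hz0⟩
  -- Here z = 1/y lies in the maximal ideal. Multiplying the equation by zⁿ and reducing leaves only
  -- the coefficient of index n, which would then reduce to 0.
  have key : ∑ i ∈ Finset.range (n + 1), f.coeff i * z ^ (n - i) = 0 := by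
    apply p.incl_injective
    rw [map_zero, map_sum]
    rw [Polynomial.eval₂_eq_sum_range' _ (Nat.lt_succ_of_le hn)] at hy
    have : ∀ i ∈ Finset.range (n + 1), p.incl (f.coeff i * z ^ (n - i))
        = p.incl z ^ n * ((p.incl : V →+* Ω) (f.coeff i) * y ^ i) := by
      intro i hi
      have hi' : i ≤ n := Nat.lt_succ_iff.1 (Finset.mem_range.1 hi)
      have h1 : p.incl z ^ n * y ^ i = p.incl z ^ (n - i) := by
        conv_lhs => rw [← Nat.sub_add_cancel hi', pow_add, mul_assoc, ← mul_pow, hz, one_pow,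
          mul_one]
      rw [map_mul, map_pow, ← h1]
      change _ = _ * (p.incl (f.coeff i) * _)
      ring
    rw [Finset.sum_congr rfl this, ← Finset.mul_sum, hy, mul_zero]
  have h2 := congrArg p.red key
  rw [map_zero, map_sum, Finset.sum_range_succ, Finset.sum_eq_zero] at h2
  · exact hf (by simpa using h2)
  · intro i hi
    have : n - i ≠ 0 := by have := Finset.mem_range.1 hi; omega
    rw [map_mul, map_pow, hz0, zero_pow this, mul_zero]

/-- A polynomial over the valuation ring that does not reduce to zero, but whose constant
coefficient does, has a root in the maximal ideal. -/
lemma exists_root_of_red_coeff_zero [IsAlgClosed Ω] (G : Polynomial V)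
    (h0 : p.red (G.coeff 0) = 0) (h0' : G.coeff 0 ≠ 0) (hG : G.map (p.red : V →+* k) ≠ 0) :
    ∃ v : V, v ≠ 0 ∧ p.red v = 0 ∧ G.eval v = 0 := by
  have := p.isDomain
  have hinj : Function.Injective (p.incl : V →+* Ω) := p.incl_injective
  -- Roots outside the maximal ideal have an inverse z in `V`, and the factor 1 − zX can be divided
  -- out over `V`. This lowers the degree and preserves the constant coefficient.
  induction hn : G.natDegree generalizing G with
  | zero =>
    rw [Polynomial.eq_C_of_natDegree_eq_zero hn, Polynomial.map_C] at hG
    exact absurd (by rw [RingHom.coe_coe, h0, Polynomial.C_0]) hG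
  | succ n ih =>
    obtain ⟨r, hr⟩ := IsAlgClosed.exists_root (G.map (p.incl : V →+* Ω)) (by
      rw [Polynomial.degree_map_eq_of_injective hinj,
        Polynomial.degree_eq_natDegree (by rintro rfl; simp at h0'), hn]
      exact_mod_cast Nat.succ_ne_zero n)
    by_cases hv : ∃ v, p.incl v = r ∧ p.red v = 0
    · obtain ⟨v, rfl, hv0⟩ := hv
      have hev : G.eval v = 0 := by
        apply p.incl_injective
        rw [Polynomial.IsRoot, Polynomial.eval_map] at hr
        rw [map_zero, ← hr]
        exact Polynomial.hom_eval₂ G (RingHom.id V) (p.incl : V →+* Ω) v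
      refine ⟨v, ?_, hv0, hev⟩
      rintro rfl
      rw [← Polynomial.coeff_zero_eq_eval_zero] at hev
      exact h0' hev
    · obtain ⟨z, hz⟩ : ∃ z, p.incl z * r = 1 := by
        rcases p.exists_incl_eq_or_inv r with ⟨v, rfl⟩ | ⟨z, hz, -⟩
        · obtain ⟨w, hw⟩ := (p.isUnit_of_red_ne_zero v (fun h => hv ⟨v, rfl, h⟩)).exists_left_inv
          exact ⟨w, by rw [← map_mul, hw, map_one]⟩
        · exact ⟨z, hz⟩
      obtain ⟨B, hB⟩ := Polynomial.dvd_iff_isRoot.2 hr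
      set B' : Polynomial Ω := Polynomial.C (-r) * B with hB'
      have hGB : G.map (p.incl : V →+* Ω) = (1 - Polynomial.C (p.incl z) * Polynomial.X) * B' := by
        rw [hB, hB']
        have : Polynomial.C (p.incl z) * Polynomial.C r = 1 := by
          rw [← Polynomial.C_mul, hz, Polynomial.C_1]
        rw [Polynomial.C_neg]
        linear_combination (-(Polynomial.X * B)) * this
      -- Division by 1 − zX is a power series recursion: each coefficient of the quotient is the
      -- corresponding coefficient of `G` plus z times the preceding one.
      have hcoeff : ∀ m, B'.coeff m ∈ Set.range (p.incl : V →+* Ω) := by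
        intro m
        induction m with
        | zero =>
          have := congrArg (Polynomial.coeff · 0) hGB
          simp only [Polynomial.coeff_map, sub_mul, one_mul, Polynomial.coeff_sub, mul_assoc,
            Polynomial.mul_coeff_zero, Polynomial.coeff_X_zero, zero_mul,
            mul_zero, sub_zero] at this
          exact ⟨_, this⟩
        | succ m ihm =>
          obtain ⟨b, hb⟩ := ihm
          have := congrArg (Polynomial.coeff · (m + 1)) hGB
          simp only [Polynomial.coeff_map, sub_mul, one_mul, Polynomial.coeff_sub, mul_assoc,
            Polynomial.coeff_C_mul, Polynomial.coeff_X_mul] at this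
          refine ⟨G.coeff (m + 1) + z * b, ?_⟩
          rw [map_add, this, map_mul, hb, RingHom.coe_coe]
          ring
      obtain ⟨G₁, hG₁⟩ := (Polynomial.lifts_iff_coeff_lifts (f := (p.incl : V →+* Ω)) B').2 hcoeff
      rw [Polynomial.coe_mapRingHom] at hG₁
      have hGG : G = (1 - Polynomial.C z * Polynomial.X) * G₁ := by
        apply Polynomial.map_injective _ hinj
        rw [hGB, Polynomial.map_mul, hG₁]
        simp
      have hc0 : G₁.coeff 0 = G.coeff 0 := by
        rw [hGG]
        simp [Polynomial.mul_coeff_zero]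
      have hdeg : G₁.natDegree = n := by
        have h1 : (G.map (p.incl : V →+* Ω)).natDegree = n + 1 := by
          rw [Polynomial.natDegree_map_eq_of_injective hinj, hn]
        have hr0 : r ≠ 0 := right_ne_zero_of_mul_eq_one hz
        have hB0 : B ≠ 0 := by
          rintro rfl
          rw [mul_zero] at hB
          rw [hB] at h1
          simp at h1
        rw [hB, Polynomial.natDegree_mul (Polynomial.X_sub_C_ne_zero r) hB0,
          Polynomial.natDegree_X_sub_C] at h1
        rw [← Polynomial.natDegree_map_eq_of_injective hinj, hG₁, hB',
          Polynomial.natDegree_C_mul (neg_ne_zero.2 hr0)]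
        omega
      obtain ⟨v, hv0, hvr, hve⟩ := ih G₁ (by rw [hc0]; exact h0) (by rw [hc0]; exact h0')
        (by
          intro h
          apply hG
          rw [hGG, Polynomial.map_mul, h, mul_zero]) hdeg
      exact ⟨v, hv0, hvr, by rw [hGG, Polynomial.eval_mul, hve, mul_zero]⟩

end Place

/-! ### Restriction of a polynomial to a line -/

section Lines

lemma aeval_algebraMap_eq {K σ S : Type*} [CommRing K] [CommRing S] [Algebra K S] (A : σ → K)
    (f : MvPolynomial σ K) :
    aeval (fun i => algebraMap K S (A i)) f = algebraMap K S (eval A f) := by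
  rw [← aeval_eq_eval, ← aeval_algebraMap_apply]
  rfl

/-- The restriction of the polynomial `f` to the line through `a` with direction `u`. -/
def alongLine {K σ V : Type*} [CommRing K] [CommRing V] [Algebra K V] (a u : σ → V)
    (f : MvPolynomial σ K) : Polynomial V :=
  aeval (fun j => Polynomial.C (a j) + Polynomial.X * Polynomial.C (u j)) f

lemma eval_alongLine {K σ V : Type*} [CommRing K] [CommRing V] [Algebra K V] (a u : σ → V)
    (f : MvPolynomial σ K) (v : V) :
    (alongLine a u f).eval v = aeval (fun j => a j + v * u j) f := by
  have : (alongLine a u f).eval v = Polynomial.aeval v (alongLine a u f) := by simp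
  rw [this, alongLine]
  change (((Polynomial.aeval (R := V) v).restrictScalars K).comp (aeval _)) f = _
  rw [comp_aeval]
  congr 2
  funext j
  simp
  exact mul_comm _ _

lemma map_alongLine {K σ V W : Type*} [CommRing K] [CommRing V] [Algebra K V] [CommRing W]
    [Algebra K W] (φ : V →ₐ[K] W) (a u : σ → V) (f : MvPolynomial σ K) :
    (alongLine a u f).map (φ : V →+* W) = alongLine (fun j => φ (a j)) (fun j => φ (u j)) f := by
  change (Polynomial.mapAlgHom φ) _ = _
  rw [alongLine, ← AlgHom.comp_apply, comp_aeval, alongLine]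
  congr 2
  funext j
  simp

lemma coeff_zero_alongLine {K σ V : Type*} [CommRing K] [CommRing V] [Algebra K V] (a u : σ → V)
    (f : MvPolynomial σ K) : (alongLine a u f).coeff 0 = aeval a f := by
  rw [Polynomial.coeff_zero_eq_eval_zero, eval_alongLine]
  simp

lemma coeff_one_alongLine {K σ V : Type*} [Fintype σ] [CommRing K] [CommRing V] [Algebra K V]
    (a u : σ → V) (f : MvPolynomial σ K) :
    (alongLine a u f).coeff 1 = ∑ j, aeval a (pderiv j f) * u j := by
  classical
  induction f using MvPolynomial.induction_on with
  | C r =>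
    have : alongLine a u (C r) = Polynomial.C (algebraMap K V r) := by
      rw [alongLine, aeval_C]; rfl
    simp [this]
  | add p q hp hq =>
    have : alongLine a u (p + q) = alongLine a u p + alongLine a u q := map_add _ _ _
    simp only [this, Polynomial.coeff_add, hp, hq, map_add, add_mul, Finset.sum_add_distrib]
  | mul_X p i hp =>
    have : alongLine a u (p * X i)
        = alongLine a u p * (Polynomial.C (a i) + Polynomial.X * Polynomial.C (u i)) := by
      rw [alongLine, map_mul, aeval_X]; rfl
    rw [this, mul_add, Polynomial.coeff_add, Polynomial.coeff_mul_C, hp, ← mul_assoc,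
      Polynomial.coeff_mul_C, Polynomial.coeff_mul_X, coeff_zero_alongLine]
    simp only [pderiv_mul, map_add, map_mul, aeval_X, pderiv_X, add_mul, Finset.sum_add_distrib]
    congr 1
    · rw [Finset.sum_mul]
      exact Finset.sum_congr rfl fun j _ => by ring
    · rw [Finset.sum_eq_single i]
      · simp
      · intro j _ hj
        simp [hj.symm]
      · simp

/-- The restriction of a nonzero polynomial to the line through a given point with generic
direction is not zero. -/
lemma alongLine_ne_zero {K k : Type*} [Field K] [Field k] [Algebra K k] {n : ℕ}
    (a : Fin (n + 1) → K) {u : Fin n → k} (hu : AlgebraicIndependent K u)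
    {f : MvPolynomial (Fin (n + 1)) K} (hf : f ≠ 0) :
    alongLine (fun j => algebraMap K k (a j)) (Fin.cons 1 u : Fin (n + 1) → k) f ≠ 0 := by
  intro h
  let Y : Fin n → MvPolynomial (Fin n) K := X
  -- By independence the direction may be replaced by indeterminates.
  have h1 : alongLine (fun j => algebraMap K (MvPolynomial (Fin n) K) (a j))
      (Fin.cons 1 Y : Fin (n + 1) → _) f = 0 := by
    apply Polynomial.map_injective (aeval u : MvPolynomial (Fin n) K →ₐ[K] k).toRingHom hu
    have h2 := map_alongLine (aeval u : MvPolynomial (Fin n) K →ₐ[K] k)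
      (fun j => algebraMap K (MvPolynomial (Fin n) K) (a j)) (Fin.cons 1 Y : Fin (n + 1) → _) f
    have h3 : (fun j : Fin (n + 1) =>
        aeval u ((Fin.cons 1 Y : Fin (n + 1) → MvPolynomial (Fin n) K) j))
        = (Fin.cons 1 u : Fin (n + 1) → k) := by
      funext j
      refine Fin.cases ?_ (fun i => ?_) j <;> simp [Y]
    simp only [AlgHom.commutes, h3, h] at h2
    rw [Polynomial.map_zero]
    exact h2
  let E := FractionRing (MvPolynomial (Fin (n + 1)) K)
  let z : Fin (n + 1) → E := fun j => algebraMap (MvPolynomial (Fin (n + 1)) K) E (X j)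
  let b : Fin (n + 1) → E := fun j => algebraMap K E (a j)
  have hz : z 0 - b 0 ≠ 0 := by
    intro h
    have h2 : algebraMap (MvPolynomial (Fin (n + 1)) K) E (X 0 - C (a 0)) = 0 := by
      rw [map_sub]
      exact h
    rw [map_eq_zero_iff _ (IsFractionRing.injective _ _)] at h2
    have h3 := congrArg (coeff (Finsupp.single 0 1)) h2
    have hne : (0 : Fin (n + 1) →₀ ℕ) ≠ Finsupp.single 0 1 := by
      intro h; simpa using DFunLike.congr_fun h 0
    classical
    simp [coeff_X, coeff_C, hne] at h3
  -- The line through the base point and the generic point z of affine space has these slopes and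
  -- reaches z at the parameter z₀ − b₀. So f would vanish at z.
  let w : Fin n → E := fun i => (z i.succ - b i.succ) / (z 0 - b 0)
  have h4 := map_alongLine (aeval w : MvPolynomial (Fin n) K →ₐ[K] E)
      (fun j => algebraMap K (MvPolynomial (Fin n) K) (a j)) (Fin.cons 1 Y : Fin (n + 1) → _) f
  rw [h1, Polynomial.map_zero] at h4
  have h5 := congrArg (Polynomial.eval (z 0 - b 0)) h4
  rw [Polynomial.eval_zero, eval_alongLine] at h5
  have h6 : (fun j => aeval w (algebraMap K (MvPolynomial (Fin n) K) (a j)) +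
      (z 0 - b 0) * aeval w ((Fin.cons 1 Y : Fin (n + 1) → MvPolynomial (Fin n) K) j)) = z := by
    funext j
    refine Fin.cases ?_ (fun i => ?_) j
    · simp [b]
    · simp only [AlgHom.commutes, Fin.cons_succ, Y, aeval_X, w]
      rw [mul_div_cancel₀ _ hz]
      simp [b]
  rw [h6] at h5
  apply hf
  apply IsFractionRing.injective (MvPolynomial (Fin (n + 1)) K) E
  rw [map_zero, h5]
  have := aeval_algebraMap_apply E (X : Fin (n + 1) → MvPolynomial (Fin (n + 1)) K) f
  rw [aeval_X_left] at this
  exact this.symm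

end Lines

/-! ### Simple points and partial derivatives -/

section Simple

variable {K : Type*} [Field K]

lemma coeff_zero_translate (f : MvPolynomial (Fin 3) K) (A : Fin 3 → K) :
    coeff 0 (aeval (fun i => X i + C (A i)) f : MvPolynomial (Fin 3) K) = eval A f := by
  rw [← constantCoeff_eq]
  induction f using MvPolynomial.induction_on with
  | C r => simp
  | add p q hp hq => simp only [map_add, hp, hq]
  | mul_X p i hp => simp only [map_mul, hp, aeval_X, eval_X]; simp

lemma coeff_single_translate (f : MvPolynomial (Fin 3) K) (A : Fin 3 → K) (j : Fin 3) :
    coeff (Finsupp.single j 1) (aeval (fun i => X i + C (A i)) f : MvPolynomial (Fin 3) K)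
      = eval A (pderiv j f) := by
  induction f using MvPolynomial.induction_on with
  | C r =>
    rw [aeval_C, algebraMap_eq, coeff_C, if_neg (by
      intro h; simpa using DFunLike.congr_fun h j)]
    simp
  | add p q hp hq => simp only [map_add, coeff_add, hp, hq]
  | mul_X p i hp =>
    rw [map_mul, aeval_X, mul_add, coeff_add, mul_comm _ (C (A i)), coeff_C_mul, hp, pderiv_mul, map_add, map_mul,
      map_mul, eval_X, pderiv_X, coeff_mul_X', add_comm]
    by_cases hij : i = j
    · subst hij
      rw [if_pos (by simp), tsub_self, coeff_zero_translate, Pi.single_eq_same, map_one]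
      ring
    · simp [hij, mul_comm]

lemma isSimplePoint_of_pderiv_ne_zero {f : MvPolynomial (Fin 3) K} {A : Fin 3 → K}
    (h0 : eval A f = 0) (h1 : ∃ j, eval A (pderiv j f) ≠ 0) : IsSimplePoint f A := by
  refine ⟨h0, ?_⟩
  obtain ⟨j, hj⟩ := h1
  have hmem : homogeneousComponent 1
      (aeval (fun i => X i + C (A i)) f : MvPolynomial (Fin 3) K) ≠ 0 := by
    intro h
    have := congrArg (coeff (Finsupp.single j 1)) h
    rw [coeff_homogeneousComponent, if_pos (by simp), coeff_single_translate, coeff_zero] at this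
    exact hj this
  apply le_antisymm
  · exact Nat.sInf_le hmem
  · rw [Nat.one_le_iff_ne_zero]
    intro h
    -- Degree 1 shows that the set is nonempty, which excludes the default value `sInf ∅ = 0`.
    have hs := Nat.sInf_mem (s := {n | homogeneousComponent n
      (aeval (fun i => X i + C (A i)) f : MvPolynomial (Fin 3) K) ≠ 0}) ⟨1, hmem⟩
    rw [← pointMult, h] at hs
    apply hs
    rw [homogeneousComponent_zero, coeff_zero_translate, h0, C_0]

end Simple

/-! ### The second intersection with a generic line -/

namespace Place

variable {K V Ω k : Type*} [Field K] [CommRing V] [Field Ω] [Field k] [Algebra K V] [Algebra K Ω]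
  [Algebra K k] {c : Fin 2 → K} (p : Place c V Ω k)

lemma par_injective : Function.Injective p.par := by
  intro g g' h
  have := @p.indep (C g) (C g') (by simp [h])
  exact C_injective _ _ this

/-- The direction `(1, x₀, x₁)`. -/
def dir : Fin 3 → V := Fin.cons 1 p.x

/-- Independence of the slopes makes 1, x₀, x₁ linearly independent over K[t̄, s̄]. -/
lemma eq_zero_of_sum_par_mul_dir {b : Fin 3 → Base K} (h : ∑ j, p.par (b j) * p.dir j = 0) :
    b = 0 := by
  have h1 : (C (b 0) + C (b 1) * X 0 + C (b 2) * X 1 : MvPolynomial (Fin 2) (Base K)) = 0 := by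
    apply p.indep
    have := congrArg p.incl h
    rw [Fin.sum_univ_three] at this
    simpa [dir, show (Fin.cons 1 p.x : Fin 3 → V) 2 = p.x 1 from rfl] using this
  have h2 := fun m => congrArg (coeff m) h1
  simp only [coeff_add, coeff_C, coeff_C_mul, coeff_X, coeff_zero] at h2
  funext j
  fin_cases j
  · simpa using h2 0
  · have := h2 (Finsupp.single 0 1)
    have h3 : (0 : Fin 2 →₀ ℕ) ≠ Finsupp.single 0 1 := by
      intro h; simpa using DFunLike.congr_fun h 0
    have h4 : (Finsupp.single 1 1 : Fin 2 →₀ ℕ) ≠ Finsupp.single 0 1 := by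
      intro h; simpa using DFunLike.congr_fun h 0
    simpa [h3, h4] using this
  · have := h2 (Finsupp.single 1 1)
    have h3 : (0 : Fin 2 →₀ ℕ) ≠ Finsupp.single 1 1 := by
      intro h; simpa using DFunLike.congr_fun h 1
    have h4 : (Finsupp.single 0 1 : Fin 2 →₀ ℕ) ≠ Finsupp.single 1 1 := by
      intro h; simpa using DFunLike.congr_fun h 0
    simpa [h3, h4] using this

/-- If the specialized point is singular, then some intersection point of the surface with a
generic line through the generic point specializes to it. -/
lemma exists_intersection [IsAlgClosed Ω] {P : Fin 4 → MvPolynomial (Fin 3) K}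
    {f : MvPolynomial (Fin 3) K} (hf0 : f ≠ 0) (hf : aeval (ParamSurface.comp P) f = 0)
    (hf' : ∃ j, aeval (ParamSurface.comp P) (pderiv j f) ≠ 0) {A : Fin 3 → K}
    (hA : ∀ j, eval A (pderiv j f) = 0) {a : Fin 3 → V}
    (ha : ∀ j, p.par (den P j) * a j = p.par (num P j))
    (haA : ∀ j, p.red (a j) = algebraMap K k (A j)) :
    ∃ v : V, v ≠ 0 ∧ p.red v = 0 ∧ aeval (fun j => a j + v * p.dir j) f = 0 := by
  have := p.isDomain
  have hden : ∀ j, p.par (den P j) ≠ 0 := fun j h =>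
    den_ne_zero P j (p.par_injective (by rw [h, map_zero]))
  have hc0 : (alongLine a p.dir f).coeff 0 = 0 := by
    rw [coeff_zero_alongLine]
    exact aeval_eq_zero_of_fractions p.par (num P) (den P) a (ParamSurface.comp P) ha
      (den_mul_comp P) hden f hf
  -- The parameter value 0 is the generic point itself. Dividing it out leaves the other
  -- intersection points, and G(0) is the derivative of f in the direction of the line.
  obtain ⟨G, hG⟩ := Polynomial.X_dvd_iff.2 hc0
  have hG0 : G.coeff 0 = ∑ j, aeval a (pderiv j f) * p.dir j := by
    rw [← coeff_one_alongLine, hG, Polynomial.coeff_X_mul]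
  -- After clearing denominators this is a linear combination of 1, x₀, x₁ over K[t̄, s̄]. If it
  -- were 0, the whole gradient would vanish at the generic point.
  have hne : G.coeff 0 ≠ 0 := by
    intro h
    rw [hG0] at h
    choose D N h1 h2 h3 using fun j => exists_clear_denominators p.par
      (IsScalarTower.toAlgHom K _ (FractionRing (MvPolynomial (Fin 2) K))) (num P) (den P) a
      (ParamSurface.comp P) ha (den_mul_comp P) hden (pderiv j f)
    have h4 : ∑ j, p.par (N j * ∏ i ∈ Finset.univ.erase j, D i) * p.dir j = 0 := by
      have : ∀ j, p.par (N j * ∏ i ∈ Finset.univ.erase j, D i) * p.dir j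
          = p.par (∏ i, D i) * (aeval a (pderiv j f) * p.dir j) := by
        intro j
        rw [← Finset.mul_prod_erase Finset.univ D (Finset.mem_univ j), map_mul, map_mul, ← h2]
        ring
      rw [Finset.sum_congr rfl fun j _ => this j, ← Finset.mul_sum, h, mul_zero]
    have h5 := p.eq_zero_of_sum_par_mul_dir h4
    obtain ⟨j, hj⟩ := hf'
    have hD : ∀ i, D i ≠ 0 := fun i h0 => h1 i (by rw [h0, map_zero])
    have h6 : N j = 0 := (mul_eq_zero.1 (congrFun h5 j)).resolve_right
      (Finset.prod_ne_zero_iff.2 fun i _ => hD i)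
    have h7 := h3 j
    rw [h6, map_zero] at h7
    refine hj ((mul_eq_zero.1 h7).resolve_left ?_)
    change algebraMap _ _ (D j) ≠ 0
    simpa using hD j
  have hred : p.red (G.coeff 0) = 0 := by
    rw [hG0, map_sum]
    refine Finset.sum_eq_zero fun j _ => ?_
    have : p.red (aeval a (pderiv j f)) = algebraMap K k (eval A (pderiv j f)) := by
      rw [← AlgHom.comp_apply, comp_aeval]
      simp only [haA]
      exact aeval_algebraMap_eq _ _
    rw [map_mul, this, hA, map_zero, zero_mul]
  -- The reduced line passes through A with generic direction, so it does not lie on the surface.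
  have hGred : G.map (p.red : V →+* k) ≠ 0 := by
    intro h
    have h1 := congrArg (Polynomial.map (p.red : V →+* k)) hG
    rw [Polynomial.map_mul, h, mul_zero, map_alongLine] at h1
    have h2 : (fun j => p.red (p.dir j)) = (Fin.cons 1 (fun i => p.red (p.x i)) : Fin 3 → k) := by
      funext j
      refine Fin.cases ?_ (fun i => ?_) j <;> simp [dir]
    simp only [haA, h2] at h1
    exact alongLine_ne_zero A p.indep_red hf0 h1
  obtain ⟨v, hv0, hvr, hv⟩ := p.exists_root_of_red_coeff_zero G hred hne hGred
  refine ⟨v, hv0, hvr, ?_⟩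
  rw [← eval_alongLine, hG, Polynomial.eval_mul, hv, mul_zero]

end Place

/-! ### Transcendence degree and generic points -/

section TranscendenceDegree

open Cardinal

/-- If two algebraically independent elements are algebraic over a family, then the family contains
two algebraically independent elements. -/
lemma exists_pair_algebraicIndependent {R A ι : Type*} [CommRing R] [IsDomain R] [CommRing A]
    [IsDomain A] [Algebra R A] {x : Fin 2 → A} (hx : AlgebraicIndependent R x) (y : ι → A)
    (h : ∀ i, IsAlgebraic (Algebra.adjoin R (Set.range y)) (x i)) :
    ∃ j k, j ≠ k ∧ AlgebraicIndependent R ![y j, y k] := by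
  have hinj := hx.algebraMap_injective
  have : FaithfulSMul R A := (faithfulSMul_iff_algebraMap_injective R A).2 hinj
  set M := AlgebraicIndependent.matroid R A with hM
  have hI : M.Indep (Set.range x) :=
    AlgebraicIndependent.matroid_indep_iff.2 hx.to_subtype_range
  have hsub : Set.range x ⊆ M.closure (Set.range y) := by
    rw [AlgebraicIndependent.matroid_closure_eq]
    rintro _ ⟨i, rfl⟩
    exact h i
  obtain ⟨J, hJ⟩ := M.exists_isBasis (Set.range y)
  -- In the matroid of algebraic independence, `J` is a basis of the family, whose closure contains
  -- two independent elements.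
  have hcard : (2 : ℕ∞) ≤ J.encard := by
    rw [hJ.encard_eq_eRk, ← M.eRk_closure_eq]
    refine le_trans ?_ (hI.encard_le_eRk_of_subset hsub)
    rw [← Set.image_univ, hx.injective.encard_image]
    simp
  obtain ⟨a, b, ha, hb, hab⟩ : ∃ a b, a ∈ J ∧ b ∈ J ∧ a ≠ b := by
    have : 1 < J.encard := lt_of_lt_of_le (by norm_num) hcard
    rw [Set.one_lt_encard_iff] at this
    exact this
  obtain ⟨j, rfl⟩ := hJ.subset ha
  obtain ⟨k, rfl⟩ := hJ.subset hb
  refine ⟨j, k, fun h => hab (h ▸ rfl), ?_⟩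
  have hJi : AlgebraicIndependent R ((↑) : J → A) :=
    AlgebraicIndependent.matroid_indep_iff.1 hJ.indep
  have := hJi.comp (![⟨y j, ha⟩, ⟨y k, hb⟩] : Fin 2 → J) (by
    intro i i' hii
    fin_cases i <;> fin_cases i' <;> simp_all [Ne.symm hab])
  convert this using 1
  funext i
  fin_cases i <;> rfl

lemma trdeg_fractionRing {K : Type*} [Field K] :
    Algebra.trdeg K (FractionRing (MvPolynomial (Fin 2) K)) = 2 := by
  have h1 : IsTranscendenceBasis K (X : Fin 2 → MvPolynomial (Fin 2) K) :=
    IsTranscendenceBasis.mvPolynomial _ _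
  have : Algebra.IsAlgebraic (MvPolynomial (Fin 2) K)
    (FractionRing (MvPolynomial (Fin 2) K)) := IsLocalization.isAlgebraic _ (nonZeroDivisors _)
  have h2 := h1.algebraMap_comp (A := FractionRing (MvPolynomial (Fin 2) K))
  have := h2.lift_cardinalMk_eq_trdeg
  simpa using this.symm

/-- The generic point of the parametrized surface can be moved to any other generic point of the
surface. -/
lemma exists_algHom_of_generic_point {K Ω : Type*} [Field K] [Field Ω] [IsAlgClosed Ω]
    [Algebra K Ω] {σ : Type*} (z : σ → FractionRing (MvPolynomial (Fin 2) K)) (Q : σ → Ω)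
    (h : ∀ f : MvPolynomial σ K, aeval z f = 0 → aeval Q f = 0) {j k : σ}
    (hjk : AlgebraicIndependent K ![Q j, Q k]) :
    ∃ φ : FractionRing (MvPolynomial (Fin 2) K) →ₐ[K] Ω, ∀ i, φ (z i) = Q i := by
  let E := FractionRing (MvPolynomial (Fin 2) K)
  let B : Subalgebra K E := (aeval z : MvPolynomial σ K →ₐ[K] E).range
  let zB : σ → B := fun i => ⟨z i, X i, aeval_X _ _⟩
  let ψ : B →ₐ[K] Ω := (Ideal.Quotient.liftₐ (RingHom.ker (aeval z : MvPolynomial σ K →ₐ[K] E))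
    (aeval Q) h).comp
      (Ideal.quotientKerEquivRange (aeval z : MvPolynomial σ K →ₐ[K] E)).symm.toAlgHom
  have hψ : ∀ i, ψ (zB i) = Q i := by
    intro i
    have h1 : (Ideal.quotientKerEquivRange (aeval z : MvPolynomial σ K →ₐ[K] E)).symm (zB i)
        = Ideal.Quotient.mk _ (X i) := by
      rw [AlgEquiv.symm_apply_eq]
      apply Subtype.ext
      exact (aeval_X z i).symm
    change Ideal.Quotient.liftₐ (RingHom.ker (aeval z : MvPolynomial σ K →ₐ[K] E)) (aeval Q) h
      ((Ideal.quotientKerEquivRange (aeval z : MvPolynomial σ K →ₐ[K] E)).symm (zB i)) = _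
    rw [h1]
    exact aeval_X _ _
  -- Relations pass from z to Q, so independence passes from Q to z. Two independent elements are a
  -- transcendence basis here.
  have hind : AlgebraicIndependent K ![z j, z k] := by
    have h1 : AlgebraicIndependent K ![zB j, zB k] := by
      apply AlgebraicIndependent.of_comp ψ
      convert hjk using 1
      funext i
      fin_cases i
      · exact hψ j
      · exact hψ k
    convert h1.map' (f := B.val) Subtype.val_injective using 1
    funext i
    fin_cases i <;> rfl
  have hbasis : IsTranscendenceBasis K ![z j, z k] := by
    apply hind.isTranscendenceBasis_of_lift_trdeg_le_of_finite
    rw [trdeg_fractionRing]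
    simp
  let A := Algebra.adjoin K (Set.range ![z j, z k])
  have hAalg : Algebra.IsAlgebraic A E := hbasis.isAlgebraic
  have hAB : A ≤ B := by
    apply Algebra.adjoin_le
    rintro _ ⟨i, rfl⟩
    fin_cases i
    · exact (zB j).2
    · exact (zB k).2
  let aAB : Algebra A B := (Subalgebra.inclusion hAB).toAlgebra
  have tower : IsScalarTower A B E := IsScalarTower.of_algebraMap_eq fun _ => rfl
  -- A nonzero element of the kernel would be algebraic over K[zⱼ, zₖ], so the kernel would meet
  -- this subring nontrivially. But ψ is injective there, since Qⱼ, Qₖ are independent.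
  have hinj : Function.Injective ψ := by
    rw [injective_iff_map_eq_zero]
    intro b hb
    by_contra hb0
    have hbalg : IsAlgebraic A b := by
      have : IsAlgebraic A (b : E) := hAalg.isAlgebraic _
      exact (isAlgebraic_algebraMap_iff (S := B) (A := E) Subtype.val_injective).1 this
    refine Ideal.comap_ne_bot_of_algebraic_mem (I := RingHom.ker ψ) hb0 hb hbalg ?_
    rw [eq_bot_iff]
    intro a ha
    obtain ⟨a, haA⟩ := a
    have ha' : a ∈ Algebra.adjoin K (Set.range ![z j, z k]) := haA
    rw [Algebra.adjoin_range_eq_range_aeval] at ha'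
    obtain ⟨g, hg⟩ := ha'
    have hg' : aeval ![z j, z k] g = a := hg
    have h2 : ψ (aeval ![zB j, zB k] g) = 0 := by
      have : (aeval ![zB j, zB k] g : B) = algebraMap A B ⟨a, haA⟩ := by
        apply Subtype.ext
        change B.val (aeval ![zB j, zB k] g) = a
        rw [← AlgHom.comp_apply, comp_aeval, ← hg']
        congr 2
        funext i
        fin_cases i <;> rfl
      rw [this]
      exact ha
    rw [← AlgHom.comp_apply, comp_aeval] at h2
    have h3 : (fun i => ψ (![zB j, zB k] i)) = ![Q j, Q k] := by
      funext i
      fin_cases i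
      · exact hψ j
      · exact hψ k
    rw [h3] at h2
    have h4 := hjk.eq_zero_of_aeval_eq_zero g h2
    rw [h4, map_zero] at hg'
    rw [Ideal.mem_bot]
    exact Subtype.ext hg'.symm
  let aBΩ : Algebra B Ω := (ψ : B →+* Ω).toAlgebra
  have : Algebra.IsAlgebraic B E := Algebra.IsAlgebraic.extendScalars (R := A)
    (Subalgebra.inclusion_injective hAB)
  have : Module.IsTorsionFree B Ω := by
    rw [Module.isTorsionFree_iff_algebraMap_injective]
    exact hinj
  have : IsScalarTower K B Ω := IsScalarTower.of_algebraMap_eq fun r => (ψ.commutes r).symm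
  -- The field of rational functions is algebraic over K[z], so ψ extends to it because Ω is
  -- algebraically closed.
  let φ : E →ₐ[B] Ω := IsAlgClosed.lift
  refine ⟨φ.restrictScalars K, fun i => ?_⟩
  have : φ (algebraMap B E (zB i)) = algebraMap B Ω (zB i) := φ.commutes _
  exact this.trans (hψ i)

end TranscendenceDegree

/-! ### Variables, resultants and leading terms in the working ring -/

section WorkingRing

variable {K : Type*} [Field K]

lemma mem_coeffZeros_iff {f : Big K} {c : Fin 2 → K} :
    c ∈ coeffZeros f ↔ MvPolynomial.map (eval c) f = 0 := by
  simp [coeffZeros, MvPolynomial.ext_iff, coeff_map]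

lemma hom_congr_supported {A : Type*} [CommRing A] {T : Set Var} {f : Big K}
    (hf : f ∈ supported (Base K) T) {φ ψ : Big K →+* A} (hC : ∀ b, φ (C b) = ψ (C b))
    (hX : ∀ w ∈ T, φ (X w) = ψ (X w)) : φ f = ψ f := by
  rw [mem_supported] at hf
  exact hom_congr_vars (RingHom.ext hC) (fun w hw _ => hX w (hf hw)) rfl

/-- Degrees in each variable add up in a domain, so a divisor of a nonzero polynomial brings no new
variable. -/
lemma mem_supported_of_dvd {T : Set Var} {f g : Big K} (h : f ∣ g) (hg0 : g ≠ 0)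
    (hg : g ∈ supported (Base K) T) : f ∈ supported (Base K) T := by
  rw [mem_supported] at hg ⊢
  refine subset_trans ?_ hg
  intro w hw
  obtain ⟨u, rfl⟩ := h
  rw [Finset.mem_coe] at hw ⊢
  rw [mem_vars_iff_degreeOf_ne_zero] at hw ⊢
  rw [degreeOf_mul_eq (left_ne_zero_of_mul hg0) (right_ne_zero_of_mul hg0)]
  omega

lemma eval_X_asUni (x : Var) (f : Big K) : (asUni x f).eval (X x) = f := by
  have : ((Polynomial.evalRingHom (X x)).comp
      ((asUni x : Big K →ₐ[Base K] _) : Big K →+* Polynomial (Big K))) = RingHom.id _ := by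
    apply ringHom_ext
    · intro b
      simp [asUni, Polynomial.algebraMap_apply, algebraMap_eq]
    · intro w
      by_cases h : w = x <;> simp [asUni, h]
  exact RingHom.congr_fun this f

lemma hom_eq_eval₂_asUni {A : Type*} [CommRing A] (φ : Big K →+* A) (x : Var) (f : Big K) :
    φ f = (asUni x f).eval₂ φ (φ (X x)) := by
  conv_lhs => rw [← eval_X_asUni x f]
  rw [Polynomial.eval, Polynomial.hom_eval₂]
  rfl

lemma asUni_mem_range (x : Var) {T : Set Var} {f : Big K} (hf : f ∈ supported (Base K) T) :
    asUni x f ∈ (Polynomial.mapAlgHom (supported (Base K) (T \ {x})).val).range := by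
  have : supported (Base K) T ≤
      ((Polynomial.mapAlgHom (supported (Base K) (T \ {x})).val).range.comap (asUni x)) := by
    apply Algebra.adjoin_le
    rintro _ ⟨w, hw, rfl⟩
    rw [SetLike.mem_coe, Subalgebra.mem_comap, asUni, aeval_X]
    split_ifs with h
    · exact ⟨Polynomial.X, by simp⟩
    · exact ⟨Polynomial.C ⟨X w, X_mem_supported.2 ⟨hw, h⟩⟩, by simp⟩
  exact this hf

lemma coeff_asUni_mem (x : Var) {T : Set Var} {f : Big K} (hf : f ∈ supported (Base K) T) (n : ℕ) :
    (asUni x f).coeff n ∈ supported (Base K) (T \ {x}) := by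
  obtain ⟨g, hg⟩ := asUni_mem_range x hf
  rw [← hg]
  change (Polynomial.map _ g).coeff n ∈ _
  rw [Polynomial.coeff_map]
  exact (g.coeff n).2

lemma resultant_mem_range {S R : Type*} [CommRing S] [CommRing R] (φ : S →+* R)
    (hφ : Function.Injective φ) (f g : Polynomial S) :
    ∃ y, φ y = Polynomial.resultant (f.map φ) (g.map φ) := by
  refine ⟨Polynomial.resultant f g, ?_⟩
  rw [Polynomial.natDegree_map_eq_of_injective hφ, Polynomial.natDegree_map_eq_of_injective hφ,
    Polynomial.resultant_map_map]

lemma res_mem_supported (x : Var) {T : Set Var} {f g : Big K} (hf : f ∈ supported (Base K) T)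
    (hg : g ∈ supported (Base K) T) : res x f g ∈ supported (Base K) (T \ {x}) := by
  obtain ⟨f', hf'⟩ := asUni_mem_range x hf
  obtain ⟨g', hg'⟩ := asUni_mem_range x hg
  obtain ⟨y, hy⟩ := resultant_mem_range (S := supported (Base K) (T \ {x})) (supported (Base K) (T \ {x})).val.toRingHom
    Subtype.val_injective f' g'
  have h1 : asUni x f = f'.map (supported (Base K) (T \ {x})).val.toRingHom := hf'.symm
  have h2 : asUni x g = g'.map (supported (Base K) (T \ {x})).val.toRingHom := hg'.symm
  rw [res, h1, h2, ← hy]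
  exact y.2

/-- The resultant lies in the ideal of the two polynomials. The degree condition is needed because
the resultant of two constants is 1. -/
lemma exists_res_eq (x : Var) (f g : Big K)
    (h : (asUni x f).natDegree ≠ 0 ∨ (asUni x g).natDegree ≠ 0) :
    ∃ u v, res x f g = f * u + g * v := by
  obtain ⟨p, q, -, -, hpq⟩ := Polynomial.exists_mul_add_mul_eq_C_resultant (asUni x f) (asUni x g)
    le_rfl le_rfl h
  refine ⟨p.eval (X x), q.eval (X x), ?_⟩
  have := congrArg (Polynomial.eval (X x)) hpq
  rw [Polynomial.eval_add, Polynomial.eval_mul, Polynomial.eval_mul, eval_X_asUni, eval_X_asUni,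
    Polynomial.eval_C] at this
  exact this.symm

lemma mem_supported_of_natDegree_asUni_eq_zero {x : Var} {T : Set Var} {f : Big K}
    (hf : f ∈ supported (Base K) T) (h : (asUni x f).natDegree = 0) :
    f ∈ supported (Base K) (T \ {x}) := by
  rw [← eval_X_asUni x f, Polynomial.eq_C_of_natDegree_eq_zero h, Polynomial.eval_C]
  exact coeff_asUni_mem x hf 0

lemma exists_eq_C_of_mem_supported_empty {f : Big K} (hf : f ∈ supported (Base K) ∅) :
    ∃ b, f = C b := by
  rw [supported_empty, Algebra.mem_bot] at hf
  obtain ⟨b, rfl⟩ := hf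
  exact ⟨b, rfl⟩

lemma aeval_asX (f : Big K) : aeval ![X Var.x1, X Var.x2] (asX f) = f := by
  have : ((aeval ![X Var.x1, X Var.x2] : MvPolynomial (Fin 2) (Big K) →ₐ[Big K] Big K) :
      MvPolynomial (Fin 2) (Big K) →+* Big K).comp
      ((asX : Big K →ₐ[Base K] _) : Big K →+* MvPolynomial (Fin 2) (Big K)) = RingHom.id _ := by
    apply ringHom_ext
    · intro b
      simp [asX, IsScalarTower.algebraMap_apply (Base K) (Big K) (MvPolynomial (Fin 2) (Big K)),
        algebraMap_eq]
    · intro w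
      cases w <;> simp [asX]
  exact RingHom.congr_fun this f

lemma hom_eq_sum_asX {A : Type*} [CommRing A] (φ : Big K →+* A) (f : Big K) :
    φ f = ∑ m ∈ (asX f).support,
      φ (coeff m (asX f)) * (φ (X Var.x1) ^ m 0 * φ (X Var.x2) ^ m 1) := by
  conv_lhs => rw [← aeval_asX f]
  rw [aeval_def, eval₂_eq', map_sum]
  refine Finset.sum_congr rfl fun m _ => ?_
  simp [Fin.prod_univ_two]

lemma coeff_asX_mem {T : Set Var} {f : Big K} (hf : f ∈ supported (Base K) T) (m : Fin 2 →₀ ℕ) :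
    coeff m (asX f) ∈ supported (Base K) (T \ {Var.x1, Var.x2}) := by
  set S := supported (Base K) (T \ {Var.x1, Var.x2}) with hS
  have : supported (Base K) T ≤ ((MvPolynomial.mapAlgHom (σ := Fin 2) S.val).range.comap asX) := by
    apply Algebra.adjoin_le
    rintro _ ⟨w, hw, rfl⟩
    rw [SetLike.mem_coe, Subalgebra.mem_comap, asX, aeval_X]
    have key : ∀ w' : Var, w' ∈ T → w' ≠ Var.x1 → w' ≠ Var.x2 →
        (C (X w') : MvPolynomial (Fin 2) (Big K)) ∈
          (MvPolynomial.mapAlgHom (σ := Fin 2) S.val).range := fun w' hT h1 h2 =>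
      ⟨C ⟨X w', X_mem_supported.2 ⟨hT, by simp [h1, h2]⟩⟩, by
        change MvPolynomial.map _ _ = _
        rw [map_C]; rfl⟩
    cases w with
    | x1 => exact ⟨X 0, map_X _ _⟩
    | x2 => exact ⟨X 1, map_X _ _⟩
    | t => exact key _ hw (by simp) (by simp)
    | s => exact key _ hw (by simp) (by simp)
    | h1 => exact key _ hw (by simp) (by simp)
    | h2 => exact key _ hw (by simp) (by simp)
    | W n => exact key _ hw (by simp) (by simp)
    | v => exact key _ hw (by simp) (by simp)
  obtain ⟨g, hg⟩ := this hf
  have hg' : MvPolynomial.map (S.val : S →+* Big K) g = asX f := hg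
  rw [← hg', coeff_map]
  exact (coeff m g).2

lemma asUni_monomial (x : Var) (m : Var →₀ ℕ) (a : Base K) :
    asUni x (monomial m a)
      = Polynomial.C (monomial (m.erase x) a) * Polynomial.X ^ (m x) := by
  have h1 : monomial m a = monomial (m.erase x) a * (X x : Big K) ^ (m x) := by
    rw [X_pow_eq_monomial, monomial_mul, mul_one, Finsupp.erase_add_single]
  have h2 : asUni x (monomial (m.erase x) a) = Polynomial.C (monomial (m.erase x) a) := by
    rw [asUni, aeval_monomial, Finsupp.prod, monomial_eq, Finsupp.prod, Polynomial.C_mul, map_prod]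
    congr 1
    refine Finset.prod_congr rfl fun w hw => ?_
    rw [if_neg (by rintro rfl; simp at hw), Polynomial.C_pow]
  have h3 : asUni x (X x : Big K) = Polynomial.X := by
    rw [asUni, aeval_X, if_pos rfl]
  rw [h1, map_mul, map_pow, h2, h3]

lemma natDegree_asUni_le_totalDegree (x : Var) (f : Big K) :
    (asUni x f).natDegree ≤ f.totalDegree := by
  conv_lhs => rw [f.as_sum, map_sum]
  refine Polynomial.natDegree_sum_le_of_forall_le _ _ fun m hm => ?_
  rw [asUni_monomial]
  refine (Polynomial.natDegree_C_mul_X_pow_le _ _).trans ?_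
  refine (Finsupp.le_degree x m).trans ?_
  rw [Finsupp.degree_apply]
  exact le_totalDegree hm

/-- A monomial of total degree n whose exponent in x is n can only be xⁿ. -/
lemma coeff_totalDegree_asUni (x : Var) (f : Big K) :
    (asUni x f).coeff f.totalDegree = C (coeff (Finsupp.single x f.totalDegree) f) := by
  conv_lhs => rw [f.as_sum, map_sum, ← f.as_sum]
  rw [Polynomial.finsetSum_coeff]
  have hterm : ∀ m ∈ f.support, (asUni x (monomial m (coeff m f))).coeff f.totalDegree
      = if m = Finsupp.single x f.totalDegree then C (coeff m f) else 0 := by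
    intro m hm
    rw [asUni_monomial, Polynomial.coeff_C_mul_X_pow]
    have hdeg : m.degree ≤ f.totalDegree := by
      rw [Finsupp.degree_apply]
      exact le_totalDegree hm
    by_cases h : m = Finsupp.single x f.totalDegree
    · rw [if_pos h, if_pos (by rw [h]; simp)]
      conv_lhs => rw [h, Finsupp.erase_single]
      rw [← h]
      rfl
    · rw [if_neg h, if_neg]
      intro hx
      apply h
      have h1 : m.degree = (m.erase x).degree + m x := by
        conv_lhs => rw [← Finsupp.erase_add_single x m]
        rw [map_add, Finsupp.degree_single]
      have h2 : (m.erase x).degree = 0 := by omega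
      rw [Finsupp.degree_eq_zero_iff] at h2
      rw [← Finsupp.erase_add_single x m, h2, zero_add, hx]
  rw [Finset.sum_congr rfl hterm, Finset.sum_ite_eq']
  split_ifs with h
  · rfl
  · rw [notMem_support_iff.1 h, C_0]

/-- At s = 1 and all other variables 0 only pure powers of s survive. In the homogenization such a
monomial carries no power of v, hence has full degree. -/
lemma atInfty_eq_coeff (f : Big K) :
    atInfty f = coeff (Finsupp.single Var.s f.totalDegree) f := by
  rw [atInfty, homogenize, map_sum]
  have hterm : ∀ m ∈ f.support,
      eval (fun w => if w = Var.s then (1 : Base K) else 0)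
        (monomial (m + Finsupp.single Var.v (f.totalDegree - m.degree)) (coeff m f))
      = if m = Finsupp.single Var.s f.totalDegree then coeff m f else 0 := by
    intro m hm
    have hdeg : m.degree ≤ f.totalDegree := by
      rw [Finsupp.degree_apply]
      exact le_totalDegree hm
    rw [eval_monomial]
    by_cases h : m = Finsupp.single Var.s f.totalDegree
    · rw [if_pos h]
      have : (m + Finsupp.single Var.v (f.totalDegree - m.degree))
          = Finsupp.single Var.s f.totalDegree := by
        rw [h]
        simp
      rw [this]
      simp
    · rw [if_neg h]
      obtain ⟨w, hw, hw'⟩ : ∃ w, w ≠ Var.s ∧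
          (m + Finsupp.single Var.v (f.totalDegree - m.degree)) w ≠ 0 := by
        by_contra! hcon
        have h1 : m = Finsupp.single Var.s (m Var.s) := by
          ext w
          by_cases hw : w = Var.s
          · rw [hw]; simp
          · have := hcon w hw
            rw [Finsupp.add_apply] at this
            rw [Finsupp.single_eq_of_ne hw]
            omega
        have h2 := hcon Var.v (by simp)
        rw [Finsupp.add_apply, Finsupp.single_eq_same] at h2
        have h3 : m.degree = m Var.s := by
          conv_lhs => rw [h1]
          rw [Finsupp.degree_single]
        apply h
        rw [h1]
        congr 1
        omega
      rw [Finsupp.prod, Finset.prod_eq_zero (Finsupp.mem_support_iff.2 hw'), mul_zero]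
      rw [if_neg hw, zero_pow hw']
  rw [Finset.sum_congr rfl hterm, Finset.sum_ite_eq']
  split_ifs with h
  · rfl
  · rw [notMem_support_iff.1 h]

end WorkingRing

/-! ### Evaluation of the working ring at a point -/

section Evaluation

variable {K A B : Type*} [Field K] [CommRing A] [Algebra K A] [CommRing B] [Algebra K B]

/-- The values of the variables of the working ring at a point. -/
def pointOf (t s : A) (y : Fin 2 → A) : Var → A
  | Var.t => t
  | Var.s => s
  | Var.x1 => y 0
  | Var.x2 => y 1
  | _ => 0

/-- Evaluation of the polynomials of the working ring. -/
def evalBig (β : Base K →ₐ[K] A) (t s : A) (y : Fin 2 → A) : Big K →+* A :=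
  eval₂Hom (β : Base K →+* A) (pointOf t s y)

variable (β : Base K →ₐ[K] A) (t s : A) (y : Fin 2 → A)

@[simp] lemma evalBig_C (b : Base K) : evalBig β t s y (C b) = β b := eval₂Hom_C _ _ _

@[simp] lemma evalBig_X (w : Var) : evalBig β t s y (X w) = pointOf t s y w := eval₂Hom_X' _ _ _

@[simp] lemma pointOf_t : pointOf t s y Var.t = t := rfl

@[simp] lemma pointOf_s : pointOf t s y Var.s = s := rfl

@[simp] lemma pointOf_x1 : pointOf t s y Var.x1 = y 0 := rfl

@[simp] lemma pointOf_x2 : pointOf t s y Var.x2 = y 1 := rfl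

lemma evalBig_X_slope (i : Fin 2) : evalBig β t s y (X (![Var.x1, Var.x2] i)) = y i := by
  fin_cases i <;> simp

@[simp] lemma evalBig_atBar (g : Base K) : evalBig β t s y (atBar g) = β g := evalBig_C _ _ _ _ _

@[simp] lemma evalBig_atTS (g : MvPolynomial (Fin 2) K) :
    evalBig β t s y (atTS g) = aeval ![t, s] g := by
  have : (evalBig β t s y).comp
      ((aeval ![X Var.t, X Var.s] : MvPolynomial (Fin 2) K →ₐ[K] Big K) :
        MvPolynomial (Fin 2) K →+* Big K)
      = ((aeval ![t, s] : MvPolynomial (Fin 2) K →ₐ[K] A) : MvPolynomial (Fin 2) K →+* A) := by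
    apply ringHom_ext
    · intro a
      simp [IsScalarTower.algebraMap_apply K (Base K) (Big K), algebraMap_eq]
    · intro i
      fin_cases i <;> simp
  exact RingHom.congr_fun this g

lemma map_evalBig (φ : A →ₐ[K] B) (f : Big K) :
    φ (evalBig β t s y f) = evalBig (φ.comp β) (φ t) (φ s) (fun i => φ (y i)) f := by
  have : (φ : A →+* B).comp (evalBig β t s y)
      = evalBig (φ.comp β) (φ t) (φ s) (fun i => φ (y i)) := by
    apply ringHom_ext
    · intro a
      simp
    · intro w
      cases w <;> simp [pointOf]
  exact RingHom.congr_fun this f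

end Evaluation

/-! ### Numerators and denominators of the slope functions -/

section Chi

variable {K : Type*} [Field K] (P : Fin 4 → MvPolynomial (Fin 3) K)

/-- The numerator of the difference of the `j`-th components at `(t, s)` and at `(t̄, s̄)`. -/
def crossDiff (j : Fin 3) : Big K :=
  atBar (den P j) * atTS (num P j) - atBar (num P j) * atTS (den P j)

/-- The reduced numerator of `χ_i`. -/
def chiNum (i : Fin 2) : Big K := IsFractionRing.num (Big K) (chi P i)

/-- The reduced denominator of `χ_i`. -/
def chiDen (i : Fin 2) : Big K := (IsFractionRing.den (Big K) (chi P i) : Big K)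

lemma chiDen_ne_zero (i : Fin 2) : chiDen P i ≠ 0 := nonZeroDivisors.coe_ne_zero _

lemma atTS_mem_supported (g : MvPolynomial (Fin 2) K) :
    atTS g ∈ supported (Base K) {Var.t, Var.s} := by
  have h : (aeval ![X Var.t, X Var.s] : MvPolynomial (Fin 2) K →ₐ[K] Big K).range
      ≤ (supported (Base K) {Var.t, Var.s}).restrictScalars K := by
    rw [← Algebra.adjoin_range_eq_range_aeval]
    apply Algebra.adjoin_le
    rintro _ ⟨i, rfl⟩
    fin_cases i
    · exact X_mem_supported.2 (by simp)
    · exact X_mem_supported.2 (by simp)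
  exact h ⟨g, rfl⟩

lemma atBar_mem_supported (g : Base K) (T : Set Var) : atBar g ∈ supported (Base K) T :=
  Subalgebra.algebraMap_mem _ g

lemma crossDiff_mem_supported (j : Fin 3) :
    crossDiff P j ∈ supported (Base K) {Var.t, Var.s} :=
  sub_mem (mul_mem (atBar_mem_supported _ _) (atTS_mem_supported _))
    (mul_mem (atBar_mem_supported _ _) (atTS_mem_supported _))

lemma atBar_ne_zero {g : Base K} (hg : g ≠ 0) : atBar g ≠ 0 := by
  intro h
  exact hg (C_injective _ _ (h.trans C_0.symm))

lemma atTS_ne_zero {g : MvPolynomial (Fin 2) K} (hg : g ≠ 0) : atTS g ≠ 0 := by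
  intro h
  have := evalBig_atTS (Algebra.ofId K (MvPolynomial (Fin 2) K) |>.comp (aeval 0)) (X 0) (X 1) 0 g
  rw [h, map_zero] at this
  have h2 : (![X 0, X 1] : Fin 2 → MvPolynomial (Fin 2) K) = X := by
    funext i; fin_cases i <;> rfl
  rw [h2, aeval_X_left] at this
  exact hg this.symm

variable {P} in
/-- The specialization of the difference of the `j`-th components is not zero. -/
lemma eval_den_mul_num_sub_ne_zero {c : Fin 2 → K} {j : Fin 3}
    (hconst : ∀ a : K, comp P j ≠ algebraMap K _ a) (hc : eval c (den P j) ≠ 0) :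
    C (eval c (den P j)) * num P j - C (eval c (num P j)) * den P j ≠ 0 := by
  intro h
  apply hconst (eval c (num P j) / eval c (den P j))
  have h1 := den_mul_comp P j
  have hne : algebraMap _ (FractionRing (MvPolynomial (Fin 2) K)) (den P j) ≠ 0 := by
    simpa using den_ne_zero P j
  have h2 := congrArg (algebraMap _ (FractionRing (MvPolynomial (Fin 2) K))) (sub_eq_zero.1 h)
  rw [map_mul, map_mul, ← h1, ← algebraMap_eq, ← IsScalarTower.algebraMap_apply,
    ← IsScalarTower.algebraMap_apply] at h2
  have hc' : algebraMap K (FractionRing (MvPolynomial (Fin 2) K)) (eval c (den P j)) ≠ 0 := by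
    simpa using hc
  rw [map_div₀, eq_div_iff hc']
  apply mul_left_cancel₀ hne
  linear_combination h2

/-- The specialization `t̄, s̄ ↦ c` on the part of the working ring generated by `t, s`. -/
def specBar (c : Fin 2 → K) : Big K →+* MvPolynomial (Fin 2) K :=
  evalBig ((Algebra.ofId K (MvPolynomial (Fin 2) K)).comp (aeval c)) (X 0) (X 1) 0

lemma specBar_atTS (c : Fin 2 → K) (g : MvPolynomial (Fin 2) K) : specBar c (atTS g) = g := by
  rw [specBar, evalBig_atTS]
  have h2 : (![X 0, X 1] : Fin 2 → MvPolynomial (Fin 2) K) = X := by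
    funext i; fin_cases i <;> rfl
  rw [h2, aeval_X_left]
  rfl

lemma specBar_C (c : Fin 2 → K) (b : Base K) : specBar c (C b) = C (eval c b) := by
  rw [specBar, evalBig_C, ← aeval_eq_eval]
  rfl

lemma specBar_atBar (c : Fin 2 → K) (b : Base K) : specBar c (atBar b) = C (eval c b) :=
  specBar_C c b

lemma specBar_crossDiff (c : Fin 2 → K) (j : Fin 3) : specBar c (crossDiff P j)
    = C (eval c (den P j)) * num P j - C (eval c (num P j)) * den P j := by
  rw [crossDiff, map_sub, map_mul, map_mul, specBar_atTS, specBar_atTS, specBar_atBar,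
    specBar_atBar]

lemma crossDiff_ne_zero {c : Fin 2 → K} {j : Fin 3}
    (hconst : ∀ a : K, comp P j ≠ algebraMap K _ a) (hc : eval c (den P j) ≠ 0) :
    crossDiff P j ≠ 0 := by
  intro h
  apply eval_den_mul_num_sub_ne_zero hconst hc
  rw [← specBar_crossDiff, h, map_zero]

/-- The cross-multiplied form of the definition of `χ_i`. -/
lemma chiNum_mul_eq (h0 : crossDiff P 0 ≠ 0) (i : Fin 2) :
    chiNum P i * (crossDiff P 0 * (atTS (den P i.succ) * atBar (den P i.succ)))
      = chiDen P i * (crossDiff P i.succ * (atTS (den P 0) * atBar (den P 0))) := by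
  set a := algebraMap (Big K) (FractionRing (Big K)) with ha
  have hinj : Function.Injective a := IsFractionRing.injective _ _
  have hne : ∀ {f : Big K}, f ≠ 0 → a f ≠ 0 := fun h => (map_ne_zero_iff _ hinj).2 h
  apply hinj
  have h1 : a (chiNum P i) / a (chiDen P i) = chi P i := IsFractionRing.mk'_num_den' _ _
  have h2 : chi P i = a (crossDiff P i.succ) / a (crossDiff P 0) *
      (a (atTS (den P 0)) / a (atTS (den P i.succ))) *
      (a (atBar (den P 0)) / a (atBar (den P i.succ))) := rfl
  rw [h2, div_eq_iff (hne (chiDen_ne_zero P i))] at h1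
  have e1 := hne h0
  have e2 := hne (atTS_ne_zero (den_ne_zero P i.succ))
  have e3 := hne (atBar_ne_zero (den_ne_zero P i.succ))
  simp only [map_mul]
  rw [h1]
  field_simp

-- In reduced form the numerator is coprime to the denominator, so by `chiNum_mul_eq` it divides a
-- product of polynomials in t, s only.
variable {P} in
lemma chiNum_mem_supported (h : ∀ j, crossDiff P j ≠ 0) (i : Fin 2) :
    chiNum P i ∈ supported (Base K) {Var.t, Var.s} := by
  have hrel : IsRelPrime (chiNum P i) (chiDen P i) := IsFractionRing.num_den_reduced _ _
  have hdvd := Dvd.intro _ (chiNum_mul_eq P (h 0) i)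
  refine mem_supported_of_dvd (hrel.dvd_of_dvd_mul_left hdvd) ?_ ?_
  · exact mul_ne_zero (h _) (mul_ne_zero (atTS_ne_zero (den_ne_zero P 0))
      (atBar_ne_zero (den_ne_zero P 0)))
  · exact mul_mem (crossDiff_mem_supported P _) (mul_mem (atTS_mem_supported _)
      (atBar_mem_supported _ _))

variable {P} in
lemma chiDen_mem_supported (h : ∀ j, crossDiff P j ≠ 0) (i : Fin 2) :
    chiDen P i ∈ supported (Base K) {Var.t, Var.s} := by
  have hrel : IsRelPrime (chiDen P i) (chiNum P i) := (IsFractionRing.num_den_reduced _ _).symm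
  have hdvd := Dvd.intro _ (chiNum_mul_eq P (h 0) i).symm
  refine mem_supported_of_dvd (hrel.dvd_of_dvd_mul_left hdvd) ?_ ?_
  · exact mul_ne_zero (h _) (mul_ne_zero (atTS_ne_zero (den_ne_zero P _))
      (atBar_ne_zero (den_ne_zero P _)))
  · exact mul_mem (crossDiff_mem_supported P _) (mul_mem (atTS_mem_supported _)
      (atBar_mem_supported _ _))

/-- The variable `𝒳_i`. -/
def slopeVar (i : Fin 2) : Var := ![Var.x1, Var.x2] i

/-- A common factor of num − 𝒳·den and den divides num as well. Hence (num − 𝒳·den)/den is already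
reduced. -/
lemma HPoly_associated (i : Fin 2) :
    Associated (HPoly P i) (chiNum P i - X (slopeVar i) * chiDen P i) := by
  have hrel : IsRelPrime (chiNum P i) (chiDen P i) := IsFractionRing.num_den_reduced _ _
  set a := algebraMap (Big K) (FractionRing (Big K)) with ha
  refine (IsFractionRing.num_den_unique (Big K) _ _ (IsFractionRing.den (Big K) (chi P i)) ?_ ?_).1
  · intro d hd1 hd2
    have hd2' : d ∣ chiDen P i := hd2
    refine hrel ?_ hd2'
    have := dvd_add hd1 (hd2'.mul_left (X (slopeVar i)))
    rwa [sub_add_cancel] at this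
  · rw [IsFractionRing.mk'_eq_div, map_sub, map_mul, sub_div]
    have hne : a (chiDen P i) ≠ 0 := by simpa [ha] using chiDen_ne_zero P i
    congr 1
    · exact IsFractionRing.mk'_num_den' _ _
    · exact mul_div_cancel_right₀ _ hne

variable {P} in
lemma HPoly_mem_supported (h : ∀ j, crossDiff P j ≠ 0) (i : Fin 2)
    (hne : chiNum P i - X (slopeVar i) * chiDen P i ≠ 0) :
    HPoly P i ∈ supported (Base K) {Var.t, Var.s, Var.x1, Var.x2} := by
  refine mem_supported_of_dvd (HPoly_associated P i).dvd hne ?_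
  have hsub : supported (Base K) {Var.t, Var.s} ≤
      supported (Base K) {Var.t, Var.s, Var.x1, Var.x2} := by
    apply supported_mono
    intro w hw
    simp only [Set.mem_insert_iff, Set.mem_singleton_iff] at hw ⊢
    tauto
  refine sub_mem (hsub (chiNum_mem_supported h i)) (mul_mem (X_mem_supported.2 ?_)
    (hsub (chiDen_mem_supported h i)))
  fin_cases i <;> simp [slopeVar]

end Chi

/-! ### Preimages of nearby points under the parametrization -/

lemma fin_two_cons_X {A : Type*} (y : Fin 2 → A) : ![y 0, y 1] = y := by
  funext i; fin_cases i <;> rfl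

namespace Place

variable {K : Type*} [Field K] {c : Fin 2 → K} {V Ω k : Type*} [CommRing V] [Field Ω]
  [Field k] [Algebra K V] [Algebra K Ω] [Algebra K k] (p : Place c V Ω k)

/-- The embedding of `K[t̄, s̄]` into the large field. -/
def emb : Base K →ₐ[K] Ω := p.incl.comp p.par

lemma emb_injective : Function.Injective p.emb := by
  have := p.isDomain
  exact p.incl_injective.comp p.par_injective

/-- A point near the given one, on the line with the slopes of the place. -/
def nearby (a : Fin 3 → V) (v : V) (j : Fin 3) : Ω := p.incl (a j + v * p.dir j)

/-- The preimage of a nearby point under the parametrization is a generic point. -/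
lemma exists_preimage [IsAlgClosed Ω] {P : Fin 4 → MvPolynomial (Fin 3) K} {a : Fin 3 → V}
    (ha : ∀ j, p.par (den P j) * a j = p.par (num P j)) {v : V} (hv : v ≠ 0)
    (hker : ∀ f : MvPolynomial (Fin 3) K, aeval (ParamSurface.comp P) f = 0 → aeval (p.nearby a v) f = 0) :
    ∃ y : Fin 2 → Ω, (∀ j, aeval y (den P j) * p.nearby a v j = aeval y (num P j)) ∧
      (∀ j, aeval y (den P j) ≠ 0) ∧
      ∀ i, ∀ f : Polynomial (Base K), f.eval₂ (p.emb : Base K →+* Ω) (y i) = 0 → f = 0 := by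
  let _ : Algebra (Base K) Ω := (p.emb : Base K →+* Ω).toAlgebra
  have : IsScalarTower K (Base K) Ω :=
    IsScalarTower.of_algebraMap_eq fun r => (p.emb.commutes r).symm
  have hx : AlgebraicIndependent (Base K) (fun i => p.incl (p.x i)) := p.indep
  have hv' : p.incl v ≠ 0 := (map_ne_zero_iff _ p.incl_injective).2 hv
  have hden : ∀ j, p.emb (den P j) ≠ 0 := fun j =>
    (map_ne_zero_iff _ p.emb_injective).2 (den_ne_zero P j)
  have hQ : ∀ j, p.nearby a v j = p.incl (a j) + p.incl v * p.incl (p.dir j) := fun j => by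
    rw [nearby, map_add, map_mul]
  have hdir0 : p.incl (p.dir 0) = 1 := map_one _
  have hdir : ∀ i : Fin 2, p.incl (p.dir i.succ) = p.incl (p.x i) := fun i => rfl
  have hbar : ∀ (S : Subalgebra (Base K) Ω) (g : Base K), IsAlgebraic S (p.emb g) := fun S g =>
    isAlgebraic_algebraMap (R := S) (algebraMap (Base K) S g)
  -- The slopes are quotients of the coordinate differences Qⱼ − aⱼ, and the aⱼ are fractions over
  -- K[t̄, s̄]. So anything that determines Q algebraically also determines x₀, x₁.
  have key : ∀ S : Subalgebra (Base K) Ω, (∀ j, IsAlgebraic S (p.nearby a v j)) →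
      ∀ i, IsAlgebraic S (p.incl (p.x i)) := by
    intro S hS i
    have hA : ∀ j, IsAlgebraic S (p.incl (a j)) := by
      intro j
      have : p.incl (a j) = p.emb (num P j) * (p.emb (den P j))⁻¹ := by
        rw [eq_mul_inv_iff_mul_eq₀ (hden j), mul_comm]
        exact (map_mul p.incl _ _).symm.trans (congrArg p.incl (ha j))
      rw [this]
      exact (hbar S _).mul (hbar S _).inv
    have hx : p.incl (p.x i) = (p.nearby a v i.succ - p.incl (a i.succ)) *
        (p.nearby a v 0 - p.incl (a 0))⁻¹ := by
      rw [hQ, hQ, hdir, hdir0]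
      rw [mul_one, add_sub_cancel_left, add_sub_cancel_left, mul_comm (p.incl v),
        mul_inv_cancel_right₀ hv']
    rw [hx]
    exact ((hS _).sub (hA _)).mul ((hS _).sub (hA _)).inv

  -- Two coordinates of Q are therefore independent over K[t̄, s̄], a fortiori over K, and the
  -- generic point of the surface can be moved to Q.
  obtain ⟨j, l, -, hjl⟩ := exists_pair_algebraicIndependent hx (p.nearby a v) (key _ fun j =>
    isAlgebraic_algebraMap (⟨_, Algebra.subset_adjoin ⟨j, rfl⟩⟩ :
      Algebra.adjoin (Base K) (Set.range (p.nearby a v))))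
  obtain ⟨φ, hφ⟩ := exists_algHom_of_generic_point (ParamSurface.comp P) (p.nearby a v) hker
    (hjl.restrictScalars (C_injective _ _))
  let y : Fin 2 → Ω := fun i => φ (algebraMap (MvPolynomial (Fin 2) K) _ (X i))
  have hy : ∀ g : MvPolynomial (Fin 2) K, φ (algebraMap _ _ g) = aeval y g := by
    intro g
    have : φ.comp (IsScalarTower.toAlgHom K (MvPolynomial (Fin 2) K)
        (FractionRing (MvPolynomial (Fin 2) K))) = aeval y := by
      apply algHom_ext
      intro i
      simp [y]
    exact DFunLike.congr_fun this g
  have h1 : ∀ j, aeval y (den P j) * p.nearby a v j = aeval y (num P j) := by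
    intro j
    rw [← hφ, ← hy, ← hy, ← map_mul, den_mul_comp]
  have h2 : ∀ j, aeval y (den P j) ≠ 0 := by
    intro j
    rw [← hy, Ne, map_eq_zero_iff φ φ.toRingHom.injective]
    simpa using den_ne_zero P j
  refine ⟨y, h1, h2, ?_⟩
  have hmem : ∀ g : MvPolynomial (Fin 2) K,
      IsAlgebraic (Algebra.adjoin (Base K) (Set.range y)) (aeval y g) := by
    intro g
    have : aeval y g ∈ Algebra.adjoin (Base K) (Set.range y) := by
      induction g using MvPolynomial.induction_on with
      | C a =>
        rw [aeval_C, IsScalarTower.algebraMap_apply K (Base K) Ω]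
        exact Subalgebra.algebraMap_mem _ _
      | add f g hf hg => rw [map_add]; exact add_mem hf hg
      | mul_X f i hf =>
        rw [map_mul, aeval_X]
        exact mul_mem hf (Algebra.subset_adjoin ⟨i, rfl⟩)
    exact isAlgebraic_algebraMap (⟨_, this⟩ : Algebra.adjoin (Base K) (Set.range y))
  -- Q is rational in y, so y determines the slopes too. Hence both coordinates of y are independent
  -- over K[t̄, s̄].
  obtain ⟨i₀, i₁, hne, hind⟩ := exists_pair_algebraicIndependent hx y (key _ fun j => by
    have : p.nearby a v j = aeval y (num P j) * (aeval y (den P j))⁻¹ := by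
      rw [eq_mul_inv_iff_mul_eq₀ (h2 j), mul_comm, h1]
    rw [this]
    exact (hmem _).mul (hmem _).inv)
  intro i f hf
  have htr : Transcendental (Base K) (y i) := by
    have h0 := hind.transcendental 0
    have h1 := hind.transcendental 1
    fin_cases i <;> fin_cases i₀ <;> fin_cases i₁ <;> first | exact absurd rfl hne | exact h0 | exact h1
  exact transcendental_iff.1 htr f hf

end Place

/-! ### Slope equations and their leading terms in s -/

lemma range_slopeVar : Set.range slopeVar = {Var.x1, Var.x2} := by
  ext w
  simp only [Set.mem_range, Fin.exists_fin_two, Set.mem_insert_iff, Set.mem_singleton_iff, slopeVar,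
    eq_comm (b := w)]
  rfl

lemma slopeVar_injective : Function.Injective slopeVar := by
  intro i j h
  fin_cases i <;> fin_cases j <;> first | rfl | exact absurd h (by simp [slopeVar])

/-- A polynomial that vanishes at a specialization of `t̄, s̄` and at independent values of the
variables specializes to zero. -/
lemma map_eval_eq_zero_of_algebraicIndependent {K L ι : Type*} [Field K] [CommRing L] [Algebra K L]
    {c : Fin 2 → K} {e : ι → Var} (he : Function.Injective e) {f : Big K}
    (hf : f ∈ supported (Base K) (Set.range e)) {φ : Big K →+* L}
    (hφ : ∀ b, φ (C b) = algebraMap K L (eval c b))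
    (hind : AlgebraicIndependent K fun i => φ (X (e i))) (h : φ f = 0) :
    MvPolynomial.map (eval c) f = 0 := by
  obtain ⟨g, rfl⟩ := exists_rename_eq_of_vars_subset_range f e he (mem_supported.1 hf)
  have h1 : φ.comp ((rename e : MvPolynomial ι (Base K) →ₐ[Base K] Big K) : _ →+* Big K)
      = ((aeval fun i => φ (X (e i)) : MvPolynomial ι K →ₐ[K] L) : MvPolynomial ι K →+* L).comp
        (MvPolynomial.map (eval c)) := by
    apply ringHom_ext
    · intro b
      simp [hφ]
    · intro i
      simp
  have h2 := RingHom.congr_fun h1 g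
  have h3 : aeval (fun i => φ (X (e i))) (MvPolynomial.map (eval c) g) = 0 := h2.symm.trans h
  have h4 := hind (h3.trans (map_zero _).symm)
  rw [map_rename, h4, map_zero]

section Slopes

variable {K : Type*} [Field K] {P : Fin 4 → MvPolynomial (Fin 3) K} {c : Fin 2 → K}

lemma asUni_s_X_slopeVar (i : Fin 2) :
    asUni Var.s (X (slopeVar i) : Big K) = Polynomial.C (X (slopeVar i)) := by
  rw [asUni, aeval_X, if_neg]
  fin_cases i <;> simp [slopeVar]

lemma coeff_asUni_eq_of_totalDegree_le (x : Var) {f : Big K} {n : ℕ} (h : f.totalDegree ≤ n) :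
    (asUni x f).coeff n = if f.totalDegree = n
      then C (coeff (Finsupp.single x f.totalDegree) f) else 0 := by
  split_ifs with h'
  · rw [← h', coeff_totalDegree_asUni]
  · exact Polynomial.coeff_eq_zero_of_natDegree_lt
      ((natDegree_asUni_le_totalDegree x f).trans_lt (lt_of_le_of_ne h h'))

/-- The equation `chiNum - 𝒳 chiDen` of the slope. -/
def slopeEq (P : Fin 4 → MvPolynomial (Fin 3) K) (i : Fin 2) : Big K :=
  chiNum P i - X (slopeVar i) * chiDen P i

/-- Nonvanishing at (0 : 1 : 0) says that numerator and denominator of χ_i each contain, after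
specialization to c, the pure power of s of their total degree. The one of larger total degree
contributes to the coefficient considered here. -/
lemma exists_coeff_slopeEq (hc : c ∉ ZInfty P) (i : Fin 2) : ∃ a b : Base K,
    (asUni Var.s (slopeEq P i)).coeff (max (chiNum P i).totalDegree (chiDen P i).totalDegree)
      = C a - X (slopeVar i) * C b ∧ (eval c a ≠ 0 ∨ eval c b ≠ 0) := by
  simp only [ZInfty, Set.mem_ofPred_eq, not_exists, not_or] at hc
  obtain ⟨h1, h2⟩ := hc i
  rw [atInfty_eq_coeff] at h1 h2
  set N := chiNum P i with hN
  set D := chiDen P i with hD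
  set n := max N.totalDegree D.totalDegree with hn
  refine ⟨if N.totalDegree = n then coeff (Finsupp.single Var.s N.totalDegree) N else 0,
    if D.totalDegree = n then coeff (Finsupp.single Var.s D.totalDegree) D else 0, ?_, ?_⟩
  · rw [slopeEq, map_sub, map_mul, asUni_s_X_slopeVar, Polynomial.coeff_sub, Polynomial.coeff_C_mul,
      coeff_asUni_eq_of_totalDegree_le Var.s (le_max_left N.totalDegree D.totalDegree),
      coeff_asUni_eq_of_totalDegree_le Var.s (le_max_right N.totalDegree D.totalDegree)]
    split_ifs <;> simp
  · rcases max_choice N.totalDegree D.totalDegree with h | h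
    · left
      rw [if_pos (h ▸ hn).symm]
      exact h1
    · right
      rw [if_pos (h ▸ hn).symm]
      exact h2

end Slopes

/-! ### Evaluation at a preimage and its reduction -/

namespace Place

variable {K : Type*} [Field K] {c : Fin 2 → K} {V Ω k : Type*} [CommRing V] [Field Ω]
  [Field k] [Algebra K V] [Algebra K Ω] [Algebra K k] (p : Place c V Ω k)

/-- The generic values of the slopes. -/
def slopes (i : Fin 2) : Ω := p.incl (p.x i)

/-- The reduced values of the slopes. -/
def redSlopes (i : Fin 2) : k := p.red (p.x i)

/-- The value of the variable x is a root of a polynomial with coefficients in the valuation ring;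
`ρ` provides these coefficients. -/
lemma exists_incl_eq_of_asUni (x : Var) {f : Big K} {n : ℕ} (φ : Big K →+* Ω) (ρ : Big K →+* V)
    (hφ : ∀ m, φ ((asUni x f).coeff m) = p.incl (ρ ((asUni x f).coeff m))) (hf : φ f = 0)
    (hn : (asUni x f).natDegree ≤ n) (hred : p.red (ρ ((asUni x f).coeff n)) ≠ 0) :
    ∃ v, p.incl v = φ (X x) := by
  refine p.exists_incl_eq_of_root (f := (asUni x f).map ρ) (n := n)
    (Polynomial.natDegree_map_le.trans hn) (by rwa [Polynomial.coeff_map]) ?_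
  rw [Polynomial.eval₂_map, ← hf, hom_eq_eval₂_asUni φ x f, Polynomial.eval₂_eq_sum,
    Polynomial.eval₂_eq_sum]
  exact Finset.sum_congr rfl fun m _ => congrArg (· * φ (X x) ^ m) (hφ m).symm

/-- The reduction of the parameters `t̄, s̄`. -/
def redBase (c : Fin 2 → K) (k : Type*) [Field k] [Algebra K k] : Base K →ₐ[K] k :=
  (Algebra.ofId K k).comp (aeval c)

lemma redBase_apply (b : Base K) : redBase c k b = algebraMap K k (eval c b) := by
  rw [← aeval_eq_eval]; rfl

lemma red_comp_par : p.red.comp p.par = redBase c k :=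
  AlgHom.ext fun b => (p.red_par b).trans (redBase_apply b).symm

lemma red_evalBig (t s : V) (f : Big K) : p.red (evalBig p.par t s p.x f)
    = evalBig (redBase c k) (p.red t) (p.red s) p.redSlopes f := by
  rw [map_evalBig, red_comp_par]; rfl

lemma incl_evalBig (t s : V) (f : Big K) : p.incl (evalBig p.par t s p.x f)
    = evalBig p.emb (p.incl t) (p.incl s) p.slopes f := by
  rw [map_evalBig]; rfl

lemma evalBig_congr {A : Type*} [CommRing A] [Algebra K A] {β : Base K →ₐ[K] A} {t s t' s' : A}
    {y : Fin 2 → A} {T : Set Var} {f : Big K} (hf : f ∈ supported (Base K) T)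
    (ht : Var.t ∈ T → t = t') (hs : Var.s ∈ T → s = s') :
    evalBig β t s y f = evalBig β t' s' y f := by
  refine hom_congr_supported hf (fun b => by simp) fun w hw => ?_
  cases w <;> simp_all [pointOf]

lemma map_eval_eq_zero_of_evalBig {t s : k} {f : Big K}
    (hf : f ∈ supported (Base K) {Var.x1, Var.x2})
    (h : evalBig (redBase c k) t s p.redSlopes f = 0) : MvPolynomial.map (eval c) f = 0 := by
  rw [← range_slopeVar] at hf
  refine map_eval_eq_zero_of_algebraicIndependent slopeVar_injective hf
    (φ := evalBig (redBase c k) t s p.redSlopes) (fun b => ?_) ?_ h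
  · rw [evalBig_C, redBase_apply]
  · simp only [slopeVar, evalBig_X_slope]
    exact p.indep_red

/-- The point `y` is a preimage under the parametrization of a nearby point that lies on the line
with the given slopes. -/
structure IsPreimage (P : Fin 4 → MvPolynomial (Fin 3) K) (y : Fin 2 → Ω) : Prop where
  crossDiff_ne_zero : ∀ j, crossDiff P j ≠ 0
  chiNum_eq : ∀ i, evalBig p.emb (y 0) (y 1) p.slopes (chiNum P i)
    = p.slopes i * evalBig p.emb (y 0) (y 1) p.slopes (chiDen P i)
  exists_crossDiff_eq : ∃ v : V, p.red v = 0 ∧ ∀ j,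
    evalBig p.emb (y 0) (y 1) p.slopes (crossDiff P j)
      = p.emb (den P j) * aeval y (den P j) * p.incl (v * p.dir j)
  eq_zero_of_eval₂ : ∀ i, ∀ f : Polynomial (Base K),
    f.eval₂ (p.emb : Base K →+* Ω) (y i) = 0 → f = 0

variable {p} in
lemma exists_isPreimage [IsAlgClosed Ω] {P : Fin 4 → MvPolynomial (Fin 3) K} {a : Fin 3 → V}
    (hne : ∀ j, crossDiff P j ≠ 0)
    (ha : ∀ j, p.par (den P j) * a j = p.par (num P j)) {v : V} (hv : v ≠ 0) (hv0 : p.red v = 0)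
    (hker : ∀ f : MvPolynomial (Fin 3) K, aeval (ParamSurface.comp P) f = 0 →
      aeval (p.nearby a v) f = 0) :
    ∃ y, p.IsPreimage P y := by
  obtain ⟨y, h1, h2, h3⟩ := p.exists_preimage ha hv hker
  have hden : ∀ j, p.emb (den P j) ≠ 0 := fun j =>
    (map_ne_zero_iff _ p.emb_injective).2 (den_ne_zero P j)
  have hcross : ∀ j, evalBig p.emb (y 0) (y 1) p.slopes (crossDiff P j)
      = p.emb (den P j) * aeval y (den P j) * p.incl (v * p.dir j) := by
    intro j
    have ha' : p.emb (den P j) * p.incl (a j) = p.emb (num P j) :=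
      (map_mul p.incl _ _).symm.trans (congrArg p.incl (ha j))
    have hj := h1 j
    rw [nearby, map_add] at hj
    rw [crossDiff, map_sub, map_mul, map_mul, evalBig_atBar, evalBig_atBar, evalBig_atTS,
      evalBig_atTS, fin_two_cons_X, ← hj, ← ha']
    ring
  refine ⟨y, hne, fun i => ?_, ⟨v, hv0, hcross⟩, h3⟩
  -- The cross differences at y are, up to the values of the denominators, v times the direction (1,
  -- x₀, x₁). In the quotient defining χ_i everything cancels except the slope.
  have h4 := congrArg (evalBig p.emb (y 0) (y 1) p.slopes) (chiNum_mul_eq P (hne 0) i)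
  have hv' : p.incl v ≠ 0 := (map_ne_zero_iff _ p.incl_injective).2 hv
  have hdir0 : p.incl (p.dir 0) = 1 := map_one _
  have hdir : p.incl (p.dir i.succ) = p.slopes i := rfl
  rw [map_mul, map_mul, map_mul, map_mul, map_mul, map_mul, hcross, hcross, evalBig_atTS,
    evalBig_atTS, evalBig_atBar, evalBig_atBar, fin_two_cons_X, map_mul, map_mul, hdir0, hdir] at h4
  have h5 : p.emb (den P 0) * aeval y (den P 0) * p.incl v * (aeval y (den P i.succ)
      * p.emb (den P i.succ)) ≠ 0 :=
    mul_ne_zero (mul_ne_zero (mul_ne_zero (hden _) (h2 _)) hv') (mul_ne_zero (h2 _) (hden _))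
  apply mul_right_cancel₀ h5
  linear_combination h4

end Place

/-! ### Integrality of the preimage at the place -/

namespace Place

variable {K : Type*} [Field K] {c : Fin 2 → K} {V Ω k : Type*} [CommRing V] [Field Ω]
  [Field k] [Algebra K V] [Algebra K Ω] [Algebra K k] {p : Place c V Ω k}
  {P : Fin 4 → MvPolynomial (Fin 3) K} {y : Fin 2 → Ω}

lemma redSlopes_transcendental (p : Place c V Ω k) (i : Fin 2) :
    Transcendental K (p.redSlopes i) := p.indep_red.transcendental i

lemma algebraMap_sub_redSlopes_mul_ne_zero (p : Place c V Ω k) (i : Fin 2) {a b : K}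
    (h : a ≠ 0 ∨ b ≠ 0) : algebraMap K k a - p.redSlopes i * algebraMap K k b ≠ 0 := by
  intro h0
  have h1 := transcendental_iff.1 (p.redSlopes_transcendental i)
    (Polynomial.C a - Polynomial.X * Polynomial.C b) (by
      rw [map_sub, map_mul, Polynomial.aeval_C, Polynomial.aeval_X, Polynomial.aeval_C]
      exact h0)
  have ha := congrArg (fun f => f.coeff 0) h1
  have hb := congrArg (fun f => f.coeff 1) h1
  simp [Polynomial.coeff_C] at ha hb
  tauto

lemma evalBig_slopeVar {A : Type*} [CommRing A] [Algebra K A] (β : Base K →ₐ[K] A) (t s : A)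
    (z : Fin 2 → A) (i : Fin 2) : evalBig β t s z (X (slopeVar i)) = z i :=
  evalBig_X_slope _ _ _ _ _

/-- The leading terms of the slope equations in direction `s` do not vanish at the place. -/
lemma red_evalBig_coeff_slopeEq_ne_zero (p : Place c V Ω k) (hc : c ∉ ZInfty P) (i : Fin 2)
    (t s : V) : p.red (evalBig p.par t s p.x ((asUni Var.s (slopeEq P i)).coeff
      (max (chiNum P i).totalDegree (chiDen P i).totalDegree))) ≠ 0 := by
  obtain ⟨a, b, h1, h2⟩ := exists_coeff_slopeEq hc i
  rw [h1, red_evalBig, map_sub, map_mul, evalBig_slopeVar, evalBig_C, evalBig_C, redBase_apply,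
    redBase_apply]
  exact p.algebraMap_sub_redSlopes_mul_ne_zero i h2

lemma slopeVar_mem (i : Fin 2) : slopeVar i ∈ ({Var.x1, Var.x2} : Set Var) :=
  range_slopeVar ▸ Set.mem_range_self i

lemma slopeEq_mem_supported (h : ∀ j, crossDiff P j ≠ 0) (i : Fin 2) :
    slopeEq P i ∈ supported (Base K) {Var.t, Var.s, Var.x1, Var.x2} := by
  have hsub : supported (Base K) {Var.t, Var.s} ≤
      supported (Base K) {Var.t, Var.s, Var.x1, Var.x2} := by
    apply supported_mono
    intro w hw
    simp only [Set.mem_insert_iff, Set.mem_singleton_iff] at hw ⊢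
    tauto
  have hi := slopeVar_mem i
  refine sub_mem (hsub (chiNum_mem_supported h i)) (mul_mem (X_mem_supported.2 ?_)
    (hsub (chiDen_mem_supported h i)))
  simp only [Set.mem_insert_iff, Set.mem_singleton_iff] at hi ⊢
  tauto

lemma slopeEq_ne_zero (p : Place c V Ω k) (hc : c ∉ ZInfty P) (i : Fin 2) : slopeEq P i ≠ 0 := by
  intro h0
  apply p.red_evalBig_coeff_slopeEq_ne_zero hc i 0 0
  rw [h0, map_zero, Polynomial.coeff_zero, map_zero, map_zero]

namespace IsPreimage

lemma evalBig_slopeEq (h : p.IsPreimage P y) (i : Fin 2) :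
    evalBig p.emb (y 0) (y 1) p.slopes (slopeEq P i) = 0 := by
  rw [slopeEq, map_sub, map_mul, evalBig_slopeVar, h.chiNum_eq, sub_self]

lemma evalBig_HPoly (h : p.IsPreimage P y) (i : Fin 2) :
    evalBig p.emb (y 0) (y 1) p.slopes (HPoly P i) = 0 := by
  obtain ⟨u, hu⟩ := (HPoly_associated P i).symm.dvd
  rw [hu, map_mul]
  exact mul_eq_zero_of_left (h.evalBig_slopeEq i) _

/-- The coefficient of s to the maximal total degree is nonzero. If the degree in s were 0,
numerator and denominator of χ_i would lie in K[t̄, s̄], and the slope would be a quotient of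
elements of K[t̄, s̄]. -/
lemma natDegree_asUni_HPoly_ne_zero (h : p.IsPreimage P y) (hc : c ∉ ZInfty P) (i : Fin 2) :
    (asUni Var.s (HPoly P i)).natDegree ≠ 0 := by
  intro h0
  obtain ⟨u, hu⟩ := HPoly_associated P i
  have h1 : (asUni Var.s (slopeEq P i)).natDegree = 0 := by
    have h2 : (asUni Var.s (u : Big K)).natDegree = 0 :=
      Polynomial.natDegree_eq_zero_of_isUnit (u.isUnit.map (asUni Var.s))
    have h3 := Polynomial.natDegree_mul_le (p := asUni Var.s (HPoly P i))
      (q := asUni Var.s (u : Big K))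
    rw [← map_mul, hu, h0, h2] at h3
    exact Nat.le_zero.1 h3
  have h2 : (asUni Var.s (slopeEq P i)).coeff
      (max (chiNum P i).totalDegree (chiDen P i).totalDegree) ≠ 0 := by
    intro h3
    apply p.red_evalBig_coeff_slopeEq_ne_zero hc i 0 0
    rw [h3, map_zero, map_zero]
  have h3 := Polynomial.le_natDegree_of_ne_zero h2
  rw [h1] at h3
  have hN := totalDegree_eq_zero_iff_eq_C.1 (Nat.le_zero.1 ((le_max_left _ _).trans h3))
  have hD := totalDegree_eq_zero_iff_eq_C.1 (Nat.le_zero.1 ((le_max_right _ _).trans h3))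
  have h4 := h.chiNum_eq i
  rw [hN, hD, evalBig_C, evalBig_C] at h4
  have h5 : (C (coeff 0 (chiNum P i)) - X i * C (coeff 0 (chiDen P i)) :
      MvPolynomial (Fin 2) (Base K)) = 0 := by
    apply p.indep
    rw [map_zero, map_sub, map_mul, coe_eval₂Hom, eval₂_C, eval₂_C, eval₂_X]
    exact sub_eq_zero.2 h4
  have h6 := congrArg (coeff (Finsupp.single i 1)) h5
  have h7 : (0 : Fin 2 →₀ ℕ) ≠ Finsupp.single i 1 := by
    intro h; simpa using DFunLike.congr_fun h i
  rw [coeff_sub, coeff_C, if_neg h7, mul_comm, coeff_C_mul, coeff_X, if_pos rfl, coeff_zero] at h6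
  apply chiDen_ne_zero P i
  rw [hD]
  have h8 : coeff 0 (chiDen P i) = 0 := by simpa using h6
  rw [h8, C_0]

lemma HPoly_mem (h : p.IsPreimage P y) (hc : c ∉ ZInfty P) (i : Fin 2) :
    HPoly P i ∈ supported (Base K) {Var.t, Var.s, Var.x1, Var.x2} :=
  HPoly_mem_supported h.crossDiff_ne_zero i (p.slopeEq_ne_zero hc i)

lemma RPoly_mem (h : p.IsPreimage P y) (hc : c ∉ ZInfty P) :
    RPoly P ∈ supported (Base K) {Var.t, Var.x1, Var.x2} := by
  refine supported_mono ?_ (res_mem_supported Var.s (h.HPoly_mem hc 0) (h.HPoly_mem hc 1))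
  rintro w ⟨hw, hs⟩
  simp only [Set.mem_insert_iff, Set.mem_singleton_iff] at hw hs ⊢
  tauto

lemma exists_RPoly_eq (h : p.IsPreimage P y) (hc : c ∉ ZInfty P) :
    ∃ u v, RPoly P = HPoly P 0 * u + HPoly P 1 * v :=
  exists_res_eq Var.s _ _ (Or.inl (h.natDegree_asUni_HPoly_ne_zero hc 0))

lemma evalBig_RPoly (h : p.IsPreimage P y) (hc : c ∉ ZInfty P) :
    evalBig p.emb (y 0) (y 1) p.slopes (RPoly P) = 0 := by
  obtain ⟨u, v, huv⟩ := h.exists_RPoly_eq hc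
  rw [huv, map_add, map_mul, map_mul, h.evalBig_HPoly, h.evalBig_HPoly, zero_mul, zero_mul,
    add_zero]

lemma coeff_asUni_RPoly_mem (h : p.IsPreimage P y) (hc : c ∉ ZInfty P) (n : ℕ) :
    (asUni Var.t (RPoly P)).coeff n ∈ supported (Base K) {Var.x1, Var.x2} := by
  refine supported_mono ?_ (coeff_asUni_mem Var.t (h.RPoly_mem hc) n)
  rintro w ⟨hw, hs⟩
  simp only [Set.mem_insert_iff, Set.mem_singleton_iff] at hw hs ⊢
  tauto

/-- The first coordinate is a root of R at the slopes. Outside Δ*₂ the leading coefficient in t, a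
polynomial in 𝒳₁, 𝒳₂, stays nonzero at c, hence also at the independent reduced slopes. -/
lemma exists_incl_eq_zero (h : p.IsPreimage P y) (hc : c ∉ ZInfty P) (h2 : c ∉ DeltaStar2 P) :
    ∃ τ, p.incl τ = y 0 := by
  have h3 : p.red (evalBig p.par 0 0 p.x (lc Var.t (RPoly P))) ≠ 0 := by
    intro h0
    rw [red_evalBig] at h0
    exact h2 (mem_coeffZeros_iff.2
      (p.map_eval_eq_zero_of_evalBig (h.coeff_asUni_RPoly_mem hc _) h0))
  have := p.exists_incl_eq_of_asUni Var.t (evalBig p.emb (y 0) (y 1) p.slopes)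
    (evalBig p.par 0 0 p.x) (fun m => ?_) (h.evalBig_RPoly hc) le_rfl h3
  · simpa using this
  · rw [incl_evalBig]
    exact evalBig_congr (h.coeff_asUni_RPoly_mem hc m) (by simp) (by simp)

/-- Once the first coordinate is integral, the first slope equation is an equation for the second
one over the valuation ring. Its top coefficient in s reduces to a nonzero element by the conditions
at (0 : 1 : 0). -/
lemma exists_incl_eq_one (h : p.IsPreimage P y) (hc : c ∉ ZInfty P) {τ : V}
    (hτ : p.incl τ = y 0) : ∃ σ, p.incl σ = y 1 := by
  have := p.exists_incl_eq_of_asUni Var.s (evalBig p.emb (y 0) (y 1) p.slopes)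
    (evalBig p.par τ 0 p.x) (fun m => ?_) (h.evalBig_slopeEq 0) ?_
    (p.red_evalBig_coeff_slopeEq_ne_zero hc 0 τ 0)
  · simpa using this
  · rw [incl_evalBig, hτ]
    exact evalBig_congr (coeff_asUni_mem Var.s (slopeEq_mem_supported h.crossDiff_ne_zero 0) m)
      (by simp) (by simp)
  · rw [slopeEq, map_sub, map_mul, asUni_s_X_slopeVar]
    refine (Polynomial.natDegree_sub_le _ _).trans (max_le_max
      (natDegree_asUni_le_totalDegree _ _) ?_)
    exact (Polynomial.natDegree_C_mul_le _ _).trans (natDegree_asUni_le_totalDegree _ _)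

end IsPreimage
end Place

/-! ### The coefficients of R with respect to the slopes -/

lemma familyGcd_dvd {R : Type*} [CommRing R] [IsDomain R] [UniqueFactorizationMonoid R]
    {ι : Type*} {J : Finset ι} (f : ι → R) {i : ι} (hi : i ∈ J) : familyGcd J f ∣ f i := by
  let _ : NormalizedGCDMonoid R := Classical.choice inferInstance
  exact Finset.gcd_dvd hi

lemma mul_exactQuot {R : Type*} [CommRing R] {f g : R} (h : g ∣ f) : g * exactQuot f g = f := by
  rw [exactQuot, dif_pos h]
  exact h.choose_spec.symm

section Relation

variable {K : Type*} [Field K]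

lemma content_mul_aRed (P : Fin 4 → MvPolynomial (Fin 3) K) {m : Fin 2 →₀ ℕ} (hm : m ∈ J P) :
    content P * aRed P m = aBar P m :=
  mul_exactQuot (familyGcd_dvd _ hm)

lemma aBar_ne_zero (P : Fin 4 → MvPolynomial (Fin 3) K) {m : Fin 2 →₀ ℕ} (hm : m ∈ J P) :
    aBar P m ≠ 0 :=
  mem_support_iff.1 hm

lemma eq_C_of_mem_supported_of_disjoint {x : Var} {f : Big K} (h1 : f ∈ supported (Base K) {x})
    (h2 : f ∈ supported (Base K) {x}ᶜ) : ∃ b, f = C b := by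
  apply exists_eq_C_of_mem_supported_empty
  rw [mem_supported] at h1 h2 ⊢
  intro w hw
  exact h2 hw (h1 hw)

/-- If a generic combination of polynomials in one variable is constant, so is each of them. -/
lemma eq_C_of_natDegree_combination {n : ℕ} {g₀ : Big K} {g : Fin n → Big K}
    (h₀ : g₀ ∈ supported (Base K) {Var.t}) (h : ∀ i, g i ∈ supported (Base K) {Var.t})
    (hdeg : (asUni Var.t (g₀ + ∑ i : Fin n, X (Var.W i) * g i)).natDegree = 0) :
    (∃ b, g₀ = C b) ∧ ∀ i, ∃ b, g i = C b := by
  set f := g₀ + ∑ i : Fin n, X (Var.W i) * g i with hf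
  have hfmem : f ∈ supported (Base K) {Var.t}ᶜ := by
    have := mem_supported_of_natDegree_asUni_eq_zero (T := Set.univ) (f := f)
      (by rw [supported_univ]; trivial) hdeg
    rwa [← Set.compl_eq_univ_sdiff] at this
  -- The combination is free of t, and this persists when constants are substituted for the W's. The
  -- constants 0 isolate g₀, and the unit vectors isolate g₀ + gᵢ.
  let ε (w : ℕ → Big K) : Big K →ₐ[Base K] Big K :=
    aeval (fun x => match x with | Var.W i => w i | x => X x)
  have hε : ∀ w, ∀ f' ∈ supported (Base K) {Var.t}, ε w f' = f' := by
    intro w f' hf'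
    have := hom_congr_supported hf' (φ := (ε w : Big K →+* Big K)) (ψ := RingHom.id _)
      (fun b => by simp [ε, algebraMap_eq]) (by simp [ε])
    exact this
  have hεmem : ∀ w : ℕ → Base K, ε (fun i => C (w i)) f ∈ supported (Base K) {Var.t}ᶜ := by
    intro w
    have : supported (Base K) {Var.t}ᶜ ≤ (supported (Base K) {Var.t}ᶜ).comap
        (ε fun i => C (w i)) := by
      apply Algebra.adjoin_le
      rintro _ ⟨x, hx, rfl⟩
      rw [SetLike.mem_coe, Subalgebra.mem_comap, aeval_X]
      cases x with
      | W i => exact Subalgebra.algebraMap_mem _ _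
      | _ => exact X_mem_supported.2 hx
    exact this hfmem
  have hεf : ∀ w : ℕ → Base K, ε (fun i => C (w i)) f = g₀ + ∑ i : Fin n, C (w i) * g i := by
    intro w
    rw [hf, map_add, map_sum, hε _ _ h₀]
    congr 1
    refine Finset.sum_congr rfl fun i _ => ?_
    rw [map_mul, hε _ _ (h i), aeval_X]
  have hg₀ : g₀ ∈ supported (Base K) {Var.t}ᶜ := by
    have := hεmem 0
    rw [hεf] at this
    simpa using this
  refine ⟨eq_C_of_mem_supported_of_disjoint h₀ hg₀, fun i =>
    eq_C_of_mem_supported_of_disjoint (h i) ?_⟩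
  have h1 := hεmem (Pi.single i 1)
  rw [hεf, Finset.sum_eq_single i] at h1
  · have h2 := sub_mem h1 hg₀
    simpa using h2
  · intro j _ hj
    rw [Pi.single_eq_of_ne (fun h => hj (Fin.ext h)), C_0, zero_mul]
  · simp

/-- If two polynomials vanish at `t₀` after the specialization of `t̄, s̄`, then so does their
resultant. -/
lemma mem_coeffZeros_res {c : Fin 2 → K} {t₀ : K} {f g : Big K}
    (hdeg : (asUni Var.t f).natDegree ≠ 0 ∨ (asUni Var.t g).natDegree ≠ 0)
    (hf : eval₂Hom (C.comp (eval c))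
      (fun w => if w = Var.t then C t₀ else X w : Var → MvPolynomial Var K) f = 0)
    (hg : eval₂Hom (C.comp (eval c))
      (fun w => if w = Var.t then C t₀ else X w : Var → MvPolynomial Var K) g = 0) :
    c ∈ coeffZeros (res Var.t f g) := by
  set ρ : Big K →+* MvPolynomial Var K :=
    eval₂Hom (C.comp (eval c)) (fun w => if w = Var.t then C t₀ else X w)
  obtain ⟨u, v, huv⟩ := exists_res_eq Var.t f g hdeg
  have h1 : res Var.t f g ∈ supported (Base K) (Set.univ \ {Var.t}) :=
    res_mem_supported Var.t (by rw [supported_univ]; trivial) (by rw [supported_univ]; trivial)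
  rw [mem_coeffZeros_iff]
  -- The resultant is free of t, so the substitution t = t₀ does not affect it.
  have h2 : ρ (res Var.t f g) = MvPolynomial.map (eval c) (res Var.t f g) := by
    refine hom_congr_supported h1 (fun b => ?_) fun w hw => ?_
    · simp [ρ]
    · have : w ≠ Var.t := hw.2
      simp [ρ, this]
  rw [← h2, huv, map_add, map_mul, map_mul, hf, hg, zero_mul, zero_mul, add_zero]

end Relation

/-! ### Transcendence of the first reduced parameter -/

/-- An algebraic element over an algebraically closed field lies in that field. -/
lemma exists_algebraMap_eq_of_isAlgebraic {K L : Type*} [Field K] [IsAlgClosed K] [Field L]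
    [Algebra K L] {x : L} (h : IsAlgebraic K x) : ∃ a, algebraMap K L a = x := by
  have hx := isAlgebraic_iff_isIntegral.1 h
  have h1 : (minpoly K x).degree = 1 :=
    IsAlgClosed.degree_eq_one_of_irreducible K (minpoly.irreducible hx)
  exact minpoly.mem_range_of_degree_eq_one K x h1

lemma exists_polynomial_of_mem_supported {K : Type*} [Field K] {w : Var} {f : Big K}
    (hf : f ∈ supported (Base K) {w}) : ∃ q : Polynomial (Base K), Polynomial.aeval (X w) q = f := by
  rw [supported, Set.image_singleton, Algebra.adjoin_singleton_eq_range_aeval] at hf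
  exact hf

namespace Place

variable {K : Type*} [Field K] {c : Fin 2 → K} {V Ω k : Type*} [CommRing V] [Field Ω]
  [Field k] [Algebra K V] [Algebra K Ω] [Algebra K k] {p : Place c V Ω k}
  {P : Fin 4 → MvPolynomial (Fin 3) K} {y : Fin 2 → Ω}

namespace IsPreimage

/-- The first coordinate of the preimage is transcendental over K[t̄, s̄]. -/
lemma evalBig_ne_zero (h : p.IsPreimage P y) {f : Big K} (hf : f ∈ supported (Base K) {Var.t})
    (hf0 : f ≠ 0) : evalBig p.emb (y 0) (y 1) p.slopes f ≠ 0 := by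
  obtain ⟨q, rfl⟩ := exists_polynomial_of_mem_supported hf
  intro h0
  rw [Polynomial.aeval_def, Polynomial.hom_eval₂] at h0
  have h1 : (evalBig p.emb (y 0) (y 1) p.slopes).comp (algebraMap (Base K) (Big K))
      = (p.emb : Base K →+* Ω) := RingHom.ext fun b => evalBig_C _ _ _ _ b
  rw [h1, evalBig_X] at h0
  exact hf0 (by rw [h.eq_zero_of_eval₂ 0 q h0, map_zero])

lemma aBar_mem (h : p.IsPreimage P y) (hc : c ∉ ZInfty P) (m : Fin 2 →₀ ℕ) :
    aBar P m ∈ supported (Base K) {Var.t} := by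
  refine supported_mono ?_ (coeff_asX_mem (h.RPoly_mem hc) m)
  rintro w ⟨hw, hs⟩
  simp only [Set.mem_insert_iff, Set.mem_singleton_iff] at hw hs ⊢
  tauto

lemma aRed_mem (h : p.IsPreimage P y) (hc : c ∉ ZInfty P) {m : Fin 2 →₀ ℕ} (hm : m ∈ J P) :
    aRed P m ∈ supported (Base K) {Var.t} :=
  mem_supported_of_dvd (Dvd.intro_left _ (content_mul_aRed P hm)) (aBar_ne_zero P hm)
    (h.aBar_mem hc m)

/-- This is R = 0 at the preimage, divided by the content, which is a nonzero polynomial in t and so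
does not vanish there. -/
lemma sum_aRed_eq_zero (h : p.IsPreimage P y) (hc : c ∉ ZInfty P) :
    ∑ m ∈ J P, evalBig p.emb (y 0) (y 1) p.slopes (aRed P m) *
      (p.slopes 0 ^ m 0 * p.slopes 1 ^ m 1) = 0 := by
  rcases (J P).eq_empty_or_nonempty with hJ | ⟨m, hm⟩
  · rw [hJ, Finset.sum_empty]
  have h1 : evalBig p.emb (y 0) (y 1) p.slopes (content P) ≠ 0 := by
    have h2 := h.evalBig_ne_zero (h.aBar_mem hc m) (aBar_ne_zero P hm)
    rw [← content_mul_aRed P hm, map_mul] at h2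
    exact left_ne_zero_of_mul h2
  apply mul_left_cancel₀ h1
  rw [mul_zero, Finset.mul_sum, ← h.evalBig_RPoly hc, hom_eq_sum_asX _ (RPoly P)]
  refine Finset.sum_congr rfl fun m hm => ?_
  rw [← mul_assoc, ← map_mul, content_mul_aRed P hm, evalBig_X, evalBig_X]
  rfl

/-- If the first coordinate reduces to t₀ ∈ K, the reduced relation is a polynomial relation over K
between the independent reduced slopes, so all its coefficients vanish. -/
lemma evalBig_aRed_eq_zero (h : p.IsPreimage P y) (hc : c ∉ ZInfty P) {τ : V}
    (hτ : p.incl τ = y 0) {t₀ : K} (ht₀ : algebraMap K k t₀ = p.red τ) {m : Fin 2 →₀ ℕ}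
    (hm : m ∈ J P) : evalBig (aeval c : Base K →ₐ[K] K) t₀ 0 0 (aRed P m) = 0 := by
  have h1 : ∑ m ∈ J P, evalBig p.par τ 0 p.x (aRed P m) * (p.x 0 ^ m 0 * p.x 1 ^ m 1) = 0 := by
    apply p.incl_injective
    rw [map_zero, ← h.sum_aRed_eq_zero hc, map_sum]
    refine Finset.sum_congr rfl fun m hm => ?_
    rw [map_mul, map_mul, map_pow, map_pow, incl_evalBig, hτ,
      evalBig_congr (h.aRed_mem hc hm) (fun _ => rfl) (s' := y 1) (by simp)]
    rfl
  have h2 := congrArg p.red h1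
  have h3 : ∀ m ∈ J P, p.red (evalBig p.par τ 0 p.x (aRed P m))
      = algebraMap K k (evalBig (aeval c : Base K →ₐ[K] K) t₀ 0 0 (aRed P m)) := by
    intro m hm
    have h4 := map_evalBig (aeval c : Base K →ₐ[K] K) t₀ 0 0 (Algebra.ofId K k) (aRed P m)
    change algebraMap K k _ = _ at h4
    rw [h4, red_evalBig]
    refine hom_congr_supported (h.aRed_mem hc hm) (fun b => ?_) fun w hw => ?_
    · rw [evalBig_C, evalBig_C]
      rfl
    · rw [Set.mem_singleton_iff.1 hw, evalBig_X, evalBig_X]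
      exact ht₀.symm
  have h5 : ∑ m ∈ J P, monomial m (evalBig (aeval c : Base K →ₐ[K] K) t₀ 0 0 (aRed P m)) = 0 := by
    apply p.indep_red
    rw [map_zero, map_sum, ← map_zero p.red, ← h2, map_sum]
    refine Finset.sum_congr rfl fun m hm => ?_
    rw [aeval_monomial, map_mul, h3 m hm, Finsupp.prod_fintype _ _ (by simp), Fin.prod_univ_two,
      map_mul, map_pow, map_pow]
  have h6 := congrArg (coeff m) h5
  rw [coeff_sum, coeff_zero] at h6
  simp only [coeff_monomial] at h6
  rwa [Finset.sum_ite_eq', if_pos hm] at h6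

/-- Otherwise the relation would have coefficients in K[t̄, s̄], over which the slopes are
independent. -/
lemma not_forall_aRed_eq_C (h : p.IsPreimage P y) (hc : c ∉ ZInfty P) {m : Fin 2 →₀ ℕ}
    (hm : m ∈ J P) : ¬ ∀ m ∈ J P, ∃ b, aRed P m = C b := by
  intro hC
  have hC' : ∀ m ∈ J P, aRed P m = C (coeff 0 (aRed P m)) := by
    intro m hm
    obtain ⟨b, hb⟩ := hC m hm
    rw [hb, coeff_zero_C]
  have h5 : ∑ m ∈ J P, monomial m (coeff 0 (aRed P m)) = 0 := by
    apply p.indep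
    rw [map_zero, map_sum, ← h.sum_aRed_eq_zero hc]
    refine Finset.sum_congr rfl fun m hm => ?_
    rw [coe_eval₂Hom, eval₂_monomial, hC' m hm, evalBig_C, coeff_zero_C,
      Finsupp.prod_fintype _ _ (by simp), Fin.prod_univ_two]
    rfl
  have h6 := congrArg (coeff m) h5
  rw [coeff_sum, coeff_zero] at h6
  simp only [coeff_monomial] at h6
  rw [Finset.sum_ite_eq', if_pos hm] at h6
  apply aBar_ne_zero P hm
  rw [← content_mul_aRed P hm, hC' m hm, h6, C_0, mul_zero]

/-- The first parameter of the specialized preimage is transcendental. -/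
lemma red_transcendental [IsAlgClosed K] (h : p.IsPreimage P y) (hc : c ∉ ZInfty P)
    (h2 : c ∉ DeltaStar2 P) {l : List (Fin 2 →₀ ℕ)} (hl : ∀ m, m ∈ l ↔ m ∈ J P)
    (h3 : c ∉ DeltaStar3 P l) {τ : V} (hτ : p.incl τ = y 0) : Transcendental K (p.red τ) := by
  intro halg
  obtain ⟨t₀, ht₀⟩ := exists_algebraMap_eq_of_isAlgebraic halg
  have hzero := fun m (hm : m ∈ J P) => h.evalBig_aRed_eq_zero hc hτ ht₀ hm
  match l, hl, h3 with
  -- Here R = 0, and Δ*₂ is the whole plane.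
  | [], hl, _ =>
    have hJ : asX (RPoly P) = 0 := by
      rw [← support_eq_empty, Finset.eq_empty_iff_forall_notMem]
      intro m hm
      simpa using (hl m).2 hm
    apply h2
    have hR : RPoly P = 0 := by rw [← aeval_asX (RPoly P), hJ, map_zero]
    rw [DeltaStar2, mem_coeffZeros_iff, hR, lc, map_zero, Polynomial.leadingCoeff_zero, map_zero]
  -- A single monomial in the slopes with nonzero coefficient cannot vanish.
  | [m], hl, _ =>
    have hm : m ∈ J P := (hl m).1 (by simp)
    have hJ : J P = {m} := by
      ext m'
      rw [← hl, List.mem_singleton, Finset.mem_singleton]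
    have h4 := h.sum_aRed_eq_zero hc
    rw [hJ, Finset.sum_singleton] at h4
    have h5 : aRed P m ≠ 0 := by
      intro h0
      apply aBar_ne_zero P hm
      rw [← content_mul_aRed P hm, h0, mul_zero]
    have hx : ∀ i, p.slopes i ≠ 0 := by
      intro i h0
      have : (X i : MvPolynomial (Fin 2) (Base K)) = 0 := by
        apply p.indep
        rw [map_zero, coe_eval₂Hom, eval₂_X]
        exact h0
      exact X_ne_zero i this
    exact mul_ne_zero (h.evalBig_ne_zero (h.aRed_mem hc hm) h5)
      (mul_ne_zero (pow_ne_zero _ (hx 0)) (pow_ne_zero _ (hx 1))) h4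
  | m₁ :: m₂ :: r, hl, h3 =>
    have hm₁ : m₁ ∈ J P := (hl _).1 (by simp)
    have hm₂ : m₂ ∈ J P := (hl _).1 (by simp)
    have hr : ∀ i, r.get i ∈ J P := fun i => (hl _).1 (by simp)
    -- For two coefficients the sum over the W's is empty, so both cases of Δ*₃ involve the same
    -- resultant.
    have hres : c ∉ coeffZeros (res Var.t (aRed P m₁)
        (aRed P m₂ + ∑ k : Fin r.length, X (Var.W k) * aRed P (r.get k))) := by
      cases r with
      | nil =>
        intro h4
        apply h3
        right
        simpa using h4
      | cons => exact h3
    have hρ : ∀ m ∈ J P, eval₂Hom (C.comp (eval c))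
        (fun w => if w = Var.t then C t₀ else X w : Var → MvPolynomial Var K) (aRed P m) = 0 := by
      intro m hm
      rw [hom_congr_supported (h.aRed_mem hc hm)
        (ψ := C.comp (evalBig (aeval c : Base K →ₐ[K] K) t₀ 0 0))]
      · rw [RingHom.comp_apply, hzero m hm, C_0]
      · intro b
        simp [aeval_eq_eval]
      · intro w hw
        rw [Set.mem_singleton_iff.1 hw]
        simp
    -- A common zero t₀ of all coefficients kills the resultant at c, unless both polynomials are
    -- constant in t, when the resultant is 1. In that case every coefficient is constant, which is
    -- excluded.
    by_cases hdeg : (asUni Var.t (aRed P m₁)).natDegree ≠ 0 ∨ (asUni Var.t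
        (aRed P m₂ + ∑ k : Fin r.length, X (Var.W k) * aRed P (r.get k))).natDegree ≠ 0
    · refine hres (mem_coeffZeros_res (t₀ := t₀) hdeg (hρ m₁ hm₁) ?_)
      rw [map_add, map_sum, hρ m₂ hm₂, zero_add]
      exact Finset.sum_eq_zero fun i _ => by rw [map_mul, hρ _ (hr i), mul_zero]
    · push Not at hdeg
      obtain ⟨hC₂, hC⟩ := eq_C_of_natDegree_combination (h.aRed_mem hc hm₂)
        (fun i => h.aRed_mem hc (hr i)) hdeg.2
      refine h.not_forall_aRed_eq_C hc hm₁ fun m hm => ?_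
      rcases List.mem_cons.1 ((hl m).2 hm) with rfl | hm'
      · apply exists_eq_C_of_mem_supported_empty
        have := mem_supported_of_natDegree_asUni_eq_zero (h.aRed_mem hc hm) hdeg.1
        rwa [sdiff_self] at this
      · rcases List.mem_cons.1 hm' with rfl | hm''
        · exact hC₂
        · obtain ⟨i, rfl⟩ := List.get_of_mem hm''
          exact hC i

end IsPreimage
end Place

/-! ### Plane curves: common zeros and strict transforms -/

lemma exists_prime_factor_map_eq_zero {R A : Type*} [CommRing R] [IsDomain R]
    [UniqueFactorizationMonoid R] [CommRing A] [IsDomain A] (φ : R →+* A) {f : R} (hf : f ≠ 0)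
    (h : φ f = 0) : ∃ w, Prime w ∧ w ∣ f ∧ φ w = 0 := by
  obtain ⟨s, hs, u, hu⟩ := UniqueFactorizationMonoid.exists_prime_factors f hf
  rw [← hu, map_mul, map_multiset_prod] at h
  have h1 := (mul_eq_zero.1 h).resolve_right (u.isUnit.map φ).ne_zero
  obtain ⟨w, hw, hw0⟩ := Multiset.mem_map.1 (Multiset.prod_eq_zero_iff.1 h1)
  refine ⟨w, hs w hw, ?_, hw0⟩
  rw [← hu]
  exact (Multiset.dvd_prod hw).mul_right _

section Plane

variable {K : Type*} [Field K]

/-- Two polynomials without common factor have no common zero with a transcendental coordinate. -/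
lemma not_aeval_eq_zero_of_isRelPrime {L : Type*} [Field L] [Algebra K L]
    {u v : MvPolynomial (Fin 2) K} (huv : IsRelPrime u v) {x : Fin 2 → L} {i : Fin 2}
    (hx : Transcendental K (x i)) (hu : aeval x u = 0) (hv : aeval x v = 0) : False := by
  by_cases hu0 : u = 0
  · have h1 : IsUnit v := huv (hu0 ▸ dvd_zero v) dvd_rfl
    exact (h1.map (aeval x)).ne_zero hv
  obtain ⟨w, hw, hwu, hw0⟩ := exists_prime_factor_map_eq_zero
    ((aeval x : MvPolynomial (Fin 2) K →ₐ[K] L) : MvPolynomial (Fin 2) K →+* L) hu0 hu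
  have hwv : ¬ w ∣ v := fun h => hw.not_isUnit (huv hwu h)
  let φ : MvPolynomial (Fin 2) K →ₐ[K] L := aeval x
  have hker : (RingHom.ker φ).IsPrime := RingHom.ker_isPrime _
  have hspan : (Ideal.span {w}).IsPrime := (Ideal.span_singleton_prime hw.ne_zero).2 hw
  -- The kernel of evaluation strictly contains the prime ideal (w), since it also contains v. In
  -- dimension 2 there is no room for a larger prime ideal above it.
  have hmax : (RingHom.ker φ).IsMaximal := by
    by_contra hmax
    obtain ⟨M, hM, hle⟩ := Ideal.exists_le_maximal (RingHom.ker φ) hker.ne_top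
    have hMp := hM.isPrime
    have hlt : RingHom.ker φ < M := lt_of_le_of_ne hle fun h => hmax (h ▸ hM)
    have hlt1 : (⊥ : Ideal (MvPolynomial (Fin 2) K)) < Ideal.span {w} := by
      rw [bot_lt_iff_ne_bot, Ne, Ideal.span_singleton_eq_bot]
      exact hw.ne_zero
    have hlt2 : Ideal.span {w} < RingHom.ker φ := by
      refine lt_of_le_of_ne ((Ideal.span_singleton_le_iff_mem _).2 hw0) fun h => hwv ?_
      rw [← Ideal.mem_span_singleton, h]
      exact hv
    let s : LTSeries (PrimeSpectrum (MvPolynomial (Fin 2) K)) :=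
      { length := 3
        toFun := ![⟨⊥, Ideal.isPrime_bot⟩, ⟨_, hspan⟩, ⟨_, hker⟩, ⟨_, hMp⟩]
        step := by
          intro j
          fin_cases j
          · exact hlt1
          · exact hlt2
          · exact hlt }
    have h1 := Order.LTSeries.length_le_krullDim s
    have h2 : ringKrullDim (MvPolynomial (Fin 2) K) = 2 := by
      rw [MvPolynomial.ringKrullDim_of_isNoetherianRing, ringKrullDim_eq_zero_of_field]
      simp
    rw [ringKrullDim] at h2
    rw [h2] at h1
    have h3 : ((3 : ℕ) : WithBot ℕ∞) ≤ ((2 : ℕ) : WithBot ℕ∞) := h1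
    rw [Nat.cast_le] at h3
    omega
  let _ : Field (MvPolynomial (Fin 2) K ⧸ RingHom.ker φ) := Ideal.Quotient.field _
  -- Zariski's lemma: the coordinates of the common zero are algebraic over K.
  have hfin := finite_of_finite_type_of_isJacobsonRing K (MvPolynomial (Fin 2) K ⧸ RingHom.ker φ)
  have halg : IsAlgebraic K (Ideal.Quotient.mk (RingHom.ker φ) (X i)) :=
    Algebra.IsAlgebraic.isAlgebraic _
  have h4 := halg.algHom (Ideal.kerLiftAlg φ)
  apply hx
  rw [Ideal.kerLiftAlg_mk, aeval_X] at h4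
  exact h4

lemma X_zero_dvd_sub (g : MvPolynomial (Fin 2) K) :
    X 0 ∣ g - aeval ![0, X 1] g := by
  induction g using MvPolynomial.induction_on with
  | C a => simp [algebraMap_eq]
  | add f g hf hg =>
    rw [map_add, add_sub_add_comm]
    exact dvd_add hf hg
  | mul_X f i hf =>
    obtain ⟨u, hu⟩ := hf
    rw [map_mul, aeval_X]
    fin_cases i
    · simp
    · refine ⟨u * X 1, ?_⟩
      simp only [Fin.mk_one, Matrix.cons_val_one, Matrix.cons_val_fin_one]
      linear_combination X 1 * hu

/-- The strict transform of a plane curve in a chart of the blow-up of a point. -/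
lemma exists_strict_transform {h : MvPolynomial (Fin 2) K} (h0 : h ≠ 0) (a b : K) :
    ∃ (m : ℕ) (g : MvPolynomial (Fin 2) K),
      aeval ![C a + X 0, C b + X 0 * X 1] h = X 0 ^ m * g ∧
      (aeval ![0, Polynomial.X] g : Polynomial K) ≠ 0 := by
  set f : MvPolynomial (Fin 2) K := aeval ![C a + X 0, C b + X 0 * X 1] h with hf
  have hf0 : f ≠ 0 := by
    intro hf0
    let E := FractionRing (MvPolynomial (Fin 2) K)
    let ι := algebraMap (MvPolynomial (Fin 2) K) E
    have hne : ι (X 0 - C a) ≠ 0 := by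
      rw [Ne, map_eq_zero_iff ι (IsFractionRing.injective _ _)]
      intro h1
      have h2 := congrArg (coeff (Finsupp.single 0 1)) h1
      have h3 : (0 : Fin 2 →₀ ℕ) ≠ Finsupp.single 0 1 := by
        intro h; simpa using DFunLike.congr_fun h 0
      rw [coeff_sub, coeff_X, coeff_C, if_pos rfl, if_neg h3] at h2
      simp at h2
    -- The blow-up chart is birational; this substitution inverts it.
    have h1 : aeval ![ι (X 0 - C a), ι (X 1 - C b) / ι (X 0 - C a)] f = ι h := by
      have h2 : (aeval ![ι (X 0 - C a), ι (X 1 - C b) / ι (X 0 - C a)] :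
          MvPolynomial (Fin 2) K →ₐ[K] E).comp (aeval ![C a + X 0, C b + X 0 * X 1])
          = IsScalarTower.toAlgHom K (MvPolynomial (Fin 2) K) E := by
        have hC : ∀ r : K, algebraMap K E r = ι (C r) := fun r =>
          IsScalarTower.algebraMap_apply K (MvPolynomial (Fin 2) K) E r
        apply algHom_ext
        intro i
        fin_cases i
        · simp only [AlgHom.comp_apply, aeval_X, Fin.zero_eta, Matrix.cons_val_zero, map_add,
            aeval_C, hC]
          rw [← map_add]
          change ι _ = ι _
          congr 1
          ring
        · simp only [AlgHom.comp_apply, aeval_X, Fin.mk_one, Matrix.cons_val_one,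
            Matrix.cons_val_zero, Matrix.cons_val_fin_one, map_add, map_mul, aeval_C, hC]
          rw [mul_div_cancel₀ _ hne, ← map_add]
          change ι _ = ι _
          congr 1
          ring
      exact DFunLike.congr_fun h2 h
    rw [hf0, map_zero, eq_comm, map_eq_zero_iff ι (IsFractionRing.injective _ _)] at h1
    exact h0 h1
  have hX : ¬ IsUnit (X 0 : MvPolynomial (Fin 2) K) := fun h => by
    simpa using h.map (eval (0 : Fin 2 → K))
  -- Dividing out the full power of `X 0` leaves a polynomial that does not vanish identically on
  -- the exceptional line `X 0 = 0`.
  obtain ⟨g, hg, hndvd⟩ := (FiniteMultiplicity.of_not_isUnit hX hf0).exists_eq_pow_mul_and_not_dvd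
  refine ⟨_, g, hg, fun hz => hndvd ?_⟩
  have h1 : aeval ![0, X 1] g = (0 : MvPolynomial (Fin 2) K) := by
    have h2 : ((Polynomial.aeval (X 1) : Polynomial K →ₐ[K] MvPolynomial (Fin 2) K).comp
        (aeval ![0, Polynomial.X])) = aeval ![0, X 1] := by
      apply algHom_ext
      intro i
      fin_cases i <;> simp
    rw [← h2, AlgHom.comp_apply, hz, map_zero]
  have h3 := X_zero_dvd_sub g
  rwa [h1, sub_zero] at h3

end Plane

/-! ### Common factors of the cross differences -/

lemma exists_algebraic_relation {K : Type*} [Field K]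
    (z : Option (Fin 2) → FractionRing (MvPolynomial (Fin 2) K)) :
    ∃ T : MvPolynomial (Option (Fin 2)) K, T ≠ 0 ∧ aeval z T = 0 := by
  by_contra! hcon
  have h1 : AlgebraicIndependent K z := by
    rw [algebraicIndependent_iff]
    intro T hT
    by_contra h0
    exact hcon T h0 hT
  have h2 := h1.lift_cardinalMk_le_trdeg
  rw [trdeg_fractionRing] at h2
  norm_num [Cardinal.mk_option] at h2

universe v

/-- A prime element generates the kernel of a homomorphism to a field. -/
lemma exists_algHom_ker {K : Type*} {R : Type v} [Field K] [CommRing R] [IsDomain R] [Algebra K R] {w : R}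
    (hw : Prime w) : ∃ (L : Type v) (_ : Field L) (_ : Algebra K L) (π : R →ₐ[K] L),
      ∀ f, π f = 0 ↔ w ∣ f := by
  have hprime : (Ideal.span {w}).IsPrime := (Ideal.span_singleton_prime hw.ne_zero).2 hw
  refine ⟨FractionRing (R ⧸ Ideal.span {w}), inferInstance, inferInstance,
    (IsScalarTower.toAlgHom K (R ⧸ Ideal.span {w}) _).comp (Ideal.Quotient.mkₐ K _), fun f => ?_⟩
  rw [AlgHom.comp_apply, IsScalarTower.coe_toAlgHom', map_eq_zero_iff _
    (IsFractionRing.injective (R ⧸ Ideal.span {w}) _), Ideal.Quotient.mkₐ_eq_mk,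
    Ideal.Quotient.eq_zero_iff_mem, Ideal.mem_span_singleton]

section Common

variable {K : Type*} [Field K]

/-- The parameters `t, s`. -/
def paramVar (i : Fin 2) : Var := ![Var.t, Var.s] i

lemma atTS_X (i : Fin 2) : atTS (X i) = (X (paramVar i) : Big K) := by
  rw [atTS, aeval_X]
  fin_cases i <;> rfl

/-- A common factor of two of the equations of the fibre of two independent functions lies over
a curve of parameters `t̄, s̄` only. -/
lemma exists_polynomial_dvd {w : Big K} (hw : Prime w)
    {z : Fin 2 → FractionRing (MvPolynomial (Fin 2) K)} (hind : AlgebraicIndependent K z)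
    {n d : Fin 2 → MvPolynomial (Fin 2) K} (hz : ∀ j, algebraMap _ _ (d j) * z j = algebraMap _ _ (n j))
    (hdvd : ∀ j, w ∣ atBar (d j) * atTS (n j) - atBar (n j) * atTS (d j))
    (hbar : ∀ j, ¬ w ∣ atBar (d j)) (hTS : ∀ j, ¬ w ∣ atTS (d j)) (i : Fin 2) :
    ∃ N : Polynomial (Base K), N ≠ 0 ∧ w ∣ Polynomial.aeval (X (paramVar i)) N := by
  let E := FractionRing (MvPolynomial (Fin 2) K)
  -- The parameter tᵢ is algebraic over K(z₀, z₁). Modulo w the values zⱼ(t, s) and zⱼ(t̄, s̄)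
  -- agree, so T becomes an equation for tᵢ with coefficients in K(t̄, s̄).
  obtain ⟨T, hT0, hT⟩ := exists_algebraic_relation
    (fun o : Option (Fin 2) => o.elim (algebraMap (MvPolynomial (Fin 2) K) E (X i)) z)
  obtain ⟨L, _, _, π, hπ⟩ := exists_algHom_ker (K := K) hw
  let y : Option (Fin 2) → L :=
    fun o => o.elim (π (X (paramVar i))) fun j => π (atBar (n j)) / π (atBar (d j))
  have hy : aeval y T = 0 := by
    refine aeval_eq_zero_of_fractions (π.comp (aeval ![X Var.t, X Var.s]))
      (fun o : Option (Fin 2) => o.elim (X i) n) (fun o => o.elim 1 d) y _ ?_ ?_ ?_ T hT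
    · rintro (_ | j)
      · change π (atTS 1) * π (X (paramVar i)) = π (atTS (X i))
        rw [atTS_X, atTS, map_one, map_one, one_mul]
      · change π (atTS (d j)) * (π (atBar (n j)) / π (atBar (d j))) = π (atTS (n j))
        have h1 : π (atBar (d j)) ≠ 0 := fun h => hbar j ((hπ _).1 h)
        have h2 := (hπ _).2 (hdvd j)
        rw [map_sub, map_mul, map_mul] at h2
        rw [mul_div_assoc', div_eq_iff h1]
        linear_combination -h2
    · rintro (_ | j)
      · change algebraMap _ E 1 * algebraMap _ E (X i) = algebraMap _ E (X i)
        rw [map_one, one_mul]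
      · exact hz j
    · rintro (_ | j)
      · change π (atTS 1) ≠ 0
        rw [atTS, map_one, map_one]
        exact one_ne_zero
      · exact fun h => hTS j ((hπ _).1 h)
  let φ : Polynomial (Base K) →ₐ[K] L :=
    π.comp ((Polynomial.aeval (X (paramVar i)) : Polynomial (Base K) →ₐ[Base K] Big K).restrictScalars K)
  let ψ : Polynomial (Base K) →ₐ[K] Polynomial E :=
    Polynomial.mapAlgHom (IsScalarTower.toAlgHom K (Base K) E)
  have hφC : ∀ b, φ (Polynomial.C b) = π (atBar b) := by
    intro b
    change π (Polynomial.aeval _ (Polynomial.C b)) = _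
    rw [Polynomial.aeval_C]
    rfl
  have hψC : ∀ b, ψ (Polynomial.C b) = Polynomial.C (algebraMap (Base K) E b) := fun b =>
    Polynomial.map_C _
  let z' : Option (Fin 2) → Polynomial E := fun o => o.elim Polynomial.X fun j => Polynomial.C (z j)
  -- Denominators are cleared simultaneously modulo w, where T vanishes, and over K(t̄, s̄), where
  -- independence of z shows that the equation is not trivial.
  obtain ⟨D, N, h1, h2, h3⟩ := exists_clear_denominators φ ψ
    (fun o : Option (Fin 2) => o.elim Polynomial.X fun j => Polynomial.C (n j))
    (fun o => o.elim 1 fun j => Polynomial.C (d j)) y z' (by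
      rintro (_ | j)
      · change φ 1 * π (X (paramVar i)) = π (Polynomial.aeval _ Polynomial.X)
        rw [map_one, one_mul, Polynomial.aeval_X]
      · change φ (Polynomial.C (d j)) * (π (atBar (n j)) / π (atBar (d j)))
          = φ (Polynomial.C (n j))
        rw [hφC, hφC, mul_div_cancel₀]
        exact fun h => hbar j ((hπ _).1 h)) (by
      rintro (_ | j)
      · change ψ 1 * Polynomial.X = Polynomial.map _ Polynomial.X
        rw [map_one, one_mul, Polynomial.map_X]
      · change ψ (Polynomial.C (d j)) * Polynomial.C (z j) = ψ (Polynomial.C (n j))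
        rw [hψC, hψC, ← Polynomial.C_mul, hz]) (by
      rintro (_ | j)
      · change φ 1 ≠ 0
        rw [map_one]
        exact one_ne_zero
      · change φ (Polynomial.C (d j)) ≠ 0
        rw [hφC]
        exact fun h => hbar j ((hπ _).1 h)) T
  refine ⟨N, ?_, ?_⟩
  · rintro rfl
    have h4 : aeval z' T ≠ 0 := by
      have h5 : ((Polynomial.mapAlgHom (aeval z) : Polynomial (MvPolynomial (Fin 2) K) →ₐ[K]
          Polynomial E).comp (optionEquivLeft K (Fin 2) : _ →ₐ[K] _)) = aeval z' := by
        apply algHom_ext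
        rintro (_ | j)
        · simp [z', optionEquivLeft_apply]
        · simp [z', optionEquivLeft_apply]
      rw [← h5]
      change Polynomial.map _ (optionEquivLeft K (Fin 2) T) ≠ 0
      rw [Polynomial.map_ne_zero_iff hind]
      exact (map_ne_zero_iff _ (optionEquivLeft K (Fin 2)).injective).2 hT0
    rw [map_zero] at h3
    have h5 : ψ D = 0 := (mul_eq_zero.1 h3).resolve_right h4
    have h6 : D = 0 := Polynomial.map_injective _ (IsFractionRing.injective (Base K) E)
      (h5.trans (map_zero ψ).symm)
    exact h1 (by rw [h6, map_zero])
  · rw [hy, mul_zero] at h2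
    exact (hπ _).1 h2.symm

end Common

/-! ### The reduction of the preimage -/

lemma map_coeff_asUni_eq_zero {K : Type*} [Field K] {c : Fin 2 → K} (x : Var) {f : Big K}
    (h : MvPolynomial.map (eval c) f = 0) (n : ℕ) :
    MvPolynomial.map (eval c) ((asUni x f).coeff n) = 0 := by
  have h1 : (Polynomial.mapRingHom (MvPolynomial.map (σ := Var) (eval c))).comp
      ((asUni x : Big K →ₐ[Base K] _) : Big K →+* Polynomial (Big K))
      = (eval₂Hom (Polynomial.C.comp C) (fun w => if w = x then Polynomial.X
        else Polynomial.C (X w : MvPolynomial Var K))).comp (MvPolynomial.map (eval c)) := by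
    apply ringHom_ext
    · intro b
      simp [asUni, Polynomial.algebraMap_apply, algebraMap_eq]
    · intro w
      by_cases hw : w = x <;> simp [asUni, hw]
  have h2 := RingHom.congr_fun h1 f
  rw [RingHom.comp_apply, RingHom.comp_apply, h, map_zero] at h2
  have h3 := congrArg (fun g => Polynomial.coeff g n) h2
  simpa using h3

namespace Place

variable {K : Type*} [Field K] {c : Fin 2 → K} {V Ω k : Type*} [CommRing V] [Field Ω]
  [Field k] [Algebra K V] [Algebra K Ω] [Algebra K k] {p : Place c V Ω k}
  {P : Fin 4 → MvPolynomial (Fin 3) K} {y : Fin 2 → Ω}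

/-- Evaluation at the specialized preimage. -/
abbrev redEval (p : Place c V Ω k) (τ σ : V) : Big K →+* k :=
  evalBig (redBase c k) (p.red τ) (p.red σ) p.redSlopes

lemma redEval_C (p : Place c V Ω k) (τ σ : V) (b : Base K) :
    p.redEval τ σ (C b) = algebraMap K k (eval c b) := by
  rw [redEval, evalBig_C, redBase_apply]

lemma redEval_eq_aeval_specBar (p : Place c V Ω k) (τ σ : V) {f : Big K}
    (hf : f ∈ supported (Base K) {Var.t, Var.s}) :
    p.redEval τ σ f = aeval ![p.red τ, p.red σ] (specBar c f) := by
  refine hom_congr_supported hf (ψ := ((aeval ![p.red τ, p.red σ] : MvPolynomial (Fin 2) K →ₐ[K] k) :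
    MvPolynomial (Fin 2) K →+* k).comp (specBar c)) (fun b => ?_) ?_
  · rw [redEval_C, RingHom.comp_apply, specBar_C]
    simp
  · rintro w (rfl | rfl) <;> simp [specBar]

namespace IsPreimage

/-- The cross differences at the preimage are multiples of v, which reduces to 0. -/
lemma redEval_crossDiff (h : p.IsPreimage P y) {τ σ : V} (hτ : p.incl τ = y 0)
    (hσ : p.incl σ = y 1) (j : Fin 3) : p.redEval τ σ (crossDiff P j) = 0 := by
  obtain ⟨v, hv, hE⟩ := h.exists_crossDiff_eq
  have h1 : evalBig p.par τ σ p.x (crossDiff P j)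
      = p.par (den P j) * aeval ![τ, σ] (den P j) * (v * p.dir j) := by
    apply p.incl_injective
    have hcomp : p.incl.comp (aeval ![τ, σ]) = aeval y := by
      apply algHom_ext
      intro i
      fin_cases i
      · simpa using hτ
      · simpa using hσ
    rw [incl_evalBig, hτ, hσ, hE, ← hcomp]
    simp only [map_mul]
    rfl
  rw [redEval, ← red_evalBig, h1, map_mul, map_mul p.red v, hv, zero_mul, mul_zero]

lemma redEval_chiNum (h : p.IsPreimage P y) {τ σ : V} (hτ : p.incl τ = y 0)
    (hσ : p.incl σ = y 1) (i : Fin 2) :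
    p.redEval τ σ (chiNum P i) = p.redSlopes i * p.redEval τ σ (chiDen P i) := by
  have h1 : evalBig p.par τ σ p.x (chiNum P i) = p.x i * evalBig p.par τ σ p.x (chiDen P i) := by
    apply p.incl_injective
    rw [map_mul, incl_evalBig, incl_evalBig, hτ, hσ, h.chiNum_eq]
    rfl
  rw [redEval, ← red_evalBig, ← red_evalBig, h1, map_mul]
  rfl

/-- If both denominators vanished, so would both numerators by the slope equations. Then H₁, H₂ and
R would vanish at the reduced parameters identically in 𝒳₁, 𝒳₂. Since the first parameter is
transcendental, R would vanish identically at c, and c would lie in Δ*₂. -/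
lemma exists_redEval_chiDen_ne_zero (h : p.IsPreimage P y) (hc : c ∉ ZInfty P)
    (h2 : c ∉ DeltaStar2 P) {τ σ : V} (hτ : p.incl τ = y 0) (hσ : p.incl σ = y 1)
    (htr : Transcendental K (p.red τ)) : ∃ i, p.redEval τ σ (chiDen P i) ≠ 0 := by
  by_contra! hD
  have hN : ∀ i, p.redEval τ σ (chiNum P i) = 0 := fun i => by
    rw [h.redEval_chiNum hτ hσ, hD, mul_zero]
  -- Reduced parameters are inserted, but 𝒳₁, 𝒳₂ stay indeterminate.
  let ρ : Big K →+* MvPolynomial (Fin 2) k :=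
    evalBig ((IsScalarTower.toAlgHom K k (MvPolynomial (Fin 2) k)).comp (redBase c k))
      (C (p.red τ)) (C (p.red σ)) X
  have hρ : ∀ f ∈ supported (Base K) {Var.t, Var.s}, ρ f = C (p.redEval τ σ f) := by
    intro f hf
    refine hom_congr_supported hf (φ := ρ) (ψ := C.comp (p.redEval τ σ)) (fun b => ?_) ?_
    · simp [ρ, algebraMap_eq]
    · rintro w (rfl | rfl) <;> simp [ρ]
  have hH : ∀ i, ρ (HPoly P i) = 0 := by
    intro i
    obtain ⟨u, hu⟩ := (HPoly_associated P i).symm.dvd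
    rw [hu, map_mul, map_sub, map_mul, hρ _ (chiNum_mem_supported h.crossDiff_ne_zero i),
      hρ _ (chiDen_mem_supported h.crossDiff_ne_zero i), hN, hD, C_0, mul_zero, sub_zero, zero_mul]
  have hR : ρ (RPoly P) = 0 := by
    obtain ⟨u, v, huv⟩ := h.exists_RPoly_eq hc
    rw [huv, map_add, map_mul, map_mul, hH, hH, zero_mul, zero_mul, add_zero]
  have hsub : supported (Base K) {Var.t} ≤ supported (Base K) {Var.t, Var.s} :=
    supported_mono (by simp)
  have haBar : ∀ m ∈ J P, MvPolynomial.map (eval c) (aBar P m) = 0 := by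
    intro m hm
    rw [hom_eq_sum_asX] at hR
    have h3 : ∑ m ∈ J P, monomial m (p.redEval τ σ (aBar P m)) = 0 := by
      rw [← hR]
      refine Finset.sum_congr rfl fun m hm => ?_
      rw [monomial_eq, Finsupp.prod_fintype _ _ (by simp), Fin.prod_univ_two,
        ← hρ _ (hsub (h.aBar_mem hc m)), evalBig_X, evalBig_X]
      rfl
    have h6 := congrArg (coeff m) h3
    rw [coeff_sum, coeff_zero] at h6
    simp only [coeff_monomial] at h6
    rw [Finset.sum_ite_eq', if_pos hm] at h6
    refine map_eval_eq_zero_of_algebraicIndependent (e := fun _ : Unit => Var.t)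
      (fun _ _ _ => rfl) (φ := p.redEval τ σ) ?_ (p.redEval_C τ σ) ?_ h6
    · simpa using h.aBar_mem hc m
    · rw [algebraicIndependent_unique_type_iff]
      simpa using htr
  apply h2
  rw [DeltaStar2, mem_coeffZeros_iff]
  refine map_coeff_asUni_eq_zero _ ?_ _
  rw [hom_eq_sum_asX]
  exact Finset.sum_eq_zero fun m hm => by
    rw [show MvPolynomial.map (eval c) (coeff m (asX (RPoly P))) = 0 from haBar m hm, zero_mul]

/-- The specialized preimage does not lie on the curves of the denominators. -/
lemma aeval_den_ne_zero (h : p.IsPreimage P y) (hq : ∀ j, eval c (den P j) ≠ 0) {τ σ : V}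
    (hτ : p.incl τ = y 0) (hσ : p.incl σ = y 1) (htr : Transcendental K (p.red τ)) (j : Fin 3) :
    aeval ![p.red τ, p.red σ] (den P j) ≠ 0 := by
  intro h0
  have h1 := h.redEval_crossDiff hτ hσ j
  rw [redEval_eq_aeval_specBar _ _ _ (crossDiff_mem_supported P j), specBar_crossDiff, map_sub,
    map_mul, map_mul, h0, mul_zero, sub_zero, aeval_C] at h1
  have h2 := (mul_eq_zero.1 h1).resolve_left (by simpa using hq j)
  -- If the denominator vanished, so would the numerator; but coprime plane curves meet only in
  -- points algebraic over K.
  exact not_aeval_eq_zero_of_isRelPrime (IsFractionRing.num_den_reduced _ (ParamSurface.comp P j))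
    (x := ![p.red τ, p.red σ]) (i := 0) htr h2 h0

end IsPreimage
end Place

/-! ### Contradiction: dependence and independence of two components -/

namespace Place

variable {K : Type*} [Field K] {c : Fin 2 → K} {V Ω k : Type*} [CommRing V] [Field Ω]
  [Field k] [Algebra K V] [Algebra K Ω] [Algebra K k] {p : Place c V Ω k}
  {P : Fin 4 → MvPolynomial (Fin 3) K} {y : Fin 2 → Ω}

lemma not_dvd_atBar (p : Place c V Ω k) {τ σ : V} {w : Big K} (hw0 : p.redEval τ σ w = 0)
    {g : Base K} (hg : eval c g ≠ 0) : ¬ w ∣ atBar g := by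
  rintro ⟨u, hu⟩
  have h1 := congrArg (p.redEval τ σ) hu
  rw [map_mul, hw0, zero_mul, atBar, redEval_C] at h1
  exact hg (by simpa using h1)

/-- Otherwise w would divide the numerator pⱼ(t, s) too, since qⱼ(c) ≠ 0. After specialization to c
it would divide two coprime polynomials and be a unit, yet it vanishes at the reduced preimage. -/
lemma not_dvd_atTS_den (p : Place c V Ω k) (hq : ∀ j, eval c (den P j) ≠ 0) {τ σ : V}
    {w : Big K} (hw : Prime w) (hw0 : p.redEval τ σ w = 0) {j : Fin 3}
    (hE : w ∣ crossDiff P j) (hE0 : crossDiff P j ≠ 0) : ¬ w ∣ atTS (den P j) := by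
  intro hd
  have h1 : w ∣ atBar (den P j) * atTS (num P j) := by
    have := dvd_add hE (hd.mul_left (atBar (num P j)))
    rwa [crossDiff, sub_add_cancel] at this
  have h2 := (hw.dvd_or_dvd h1).resolve_left (p.not_dvd_atBar hw0 (hq j))
  have h3 := map_dvd (specBar c) h2
  have h4 := map_dvd (specBar c) hd
  rw [specBar_atTS] at h3 h4
  have h5 : IsUnit (specBar c w) :=
    IsFractionRing.num_den_reduced _ (ParamSurface.comp P j) h3 h4
  have h6 := (h5.map (aeval ![p.red τ, p.red σ] : MvPolynomial (Fin 2) K →ₐ[K] k)).ne_zero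
  rw [← redEval_eq_aeval_specBar _ _ _
    (mem_supported_of_dvd hE hE0 (crossDiff_mem_supported P j))] at h6
  exact h6 hw0

lemma mem_supported_of_dvd_aeval {w : Big K} {x : Var} {N : Polynomial (Base K)} (hN : N ≠ 0)
    (h : w ∣ Polynomial.aeval (X x) N) : w ∈ supported (Base K) {x} := by
  refine mem_supported_of_dvd h ?_ ?_
  · intro h0
    exact hN (transcendental_iff.1 (transcendental_X (Base K) x) N h0)
  · rw [supported, Set.image_singleton, Algebra.adjoin_singleton_eq_range_aeval]
    exact ⟨N, rfl⟩

namespace IsPreimage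

/-- The two components are algebraically dependent. -/
lemma not_algebraicIndependent_comp (h : p.IsPreimage P y) (hq : ∀ j, eval c (den P j) ≠ 0)
    (hconst : ∀ j, ∀ a : K, ParamSurface.comp P j ≠ algebraMap K _ a)
    {τ σ : V} (hτ : p.incl τ = y 0) (hσ : p.incl σ = y 1) {i : Fin 2}
    (hD : p.redEval τ σ (chiDen P i) ≠ 0) :
    ¬ AlgebraicIndependent K ![ParamSurface.comp P 0, ParamSurface.comp P i.succ] := by
  intro hind
  obtain ⟨w, hw, hwE, hw0⟩ := exists_prime_factor_map_eq_zero (p.redEval τ σ)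
    (h.crossDiff_ne_zero 0) (h.redEval_crossDiff hτ hσ 0)
  have hTS0 := p.not_dvd_atTS_den hq hw hw0 hwE (h.crossDiff_ne_zero 0)
  have hbar : ∀ j, ¬ w ∣ atBar (den P j) := fun j => p.not_dvd_atBar hw0 (hq j)
  have hwD : ¬ w ∣ chiDen P i := by
    rintro ⟨u, hu⟩
    rw [hu, map_mul, hw0, zero_mul] at hD
    exact hD rfl
  -- The denominator of χ_i does not contain w, so w cannot cancel and passes to the other cross
  -- difference.
  have hwE' : w ∣ crossDiff P i.succ := by
    have h1 : w ∣ chiDen P i * (crossDiff P i.succ * (atTS (den P 0) * atBar (den P 0))) := by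
      rw [← chiNum_mul_eq P (h.crossDiff_ne_zero 0) i]
      exact (hwE.mul_right _).mul_left _
    refine (hw.dvd_or_dvd ((hw.dvd_or_dvd h1).resolve_left hwD)).resolve_right fun h2 => ?_
    exact (hw.dvd_or_dvd h2).elim hTS0 (hbar 0)
  have hTS := p.not_dvd_atTS_den hq hw hw0 hwE' (h.crossDiff_ne_zero _)
  have hvar : ∀ j, w ∈ supported (Base K) {paramVar j} := by
    intro j
    obtain ⟨N, hN, hdvd⟩ := exists_polynomial_dvd hw hind (n := ![num P 0, num P i.succ])
      (d := ![den P 0, den P i.succ])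
      (Fin.forall_fin_two.2 ⟨den_mul_comp P 0, den_mul_comp P i.succ⟩)
      (Fin.forall_fin_two.2 ⟨hwE, hwE'⟩)
      (Fin.forall_fin_two.2 ⟨hbar _, hbar _⟩)
      (Fin.forall_fin_two.2 ⟨hTS0, hTS⟩) j
    exact mem_supported_of_dvd_aeval hN hdvd
  -- A factor involving at most t and at most s involves neither. It lies in K[t̄, s̄] and vanishes
  -- at c, so the first cross difference would vanish identically at c.
  obtain ⟨b, hb⟩ := eq_C_of_mem_supported_of_disjoint (hvar 0)
    (supported_mono (by simp [paramVar]) (hvar 1))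
  rw [hb, redEval_C] at hw0
  have hb0 : eval c b = 0 := by simpa using hw0
  obtain ⟨u, hu⟩ := hwE
  apply eval_den_mul_num_sub_ne_zero (hconst 0) (hq 0)
  rw [← specBar_crossDiff, hu, hb, map_mul, specBar_C, hb0, C_0, zero_mul]

/-- The two components are algebraically independent. -/
lemma algebraicIndependent_comp (h : p.IsPreimage P y) (hq : ∀ j, eval c (den P j) ≠ 0)
    (hconst : ∀ j, ∀ a : K, ParamSurface.comp P j ≠ algebraMap K _ a)
    {τ σ : V} (hτ : p.incl τ = y 0) (hσ : p.incl σ = y 1) (htr : Transcendental K (p.red τ))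
    {i : Fin 2} (hD : p.redEval τ σ (chiDen P i) ≠ 0) :
    AlgebraicIndependent K ![ParamSurface.comp P 0, ParamSurface.comp P i.succ] := by
  rw [algebraicIndependent_iff]
  intro f hf
  by_contra hf0
  let E := FractionRing (MvPolynomial (Fin 2) K)
  let ι := algebraMap (MvPolynomial (Fin 2) K) E
  have hι : ∀ {g}, g ≠ 0 → ι g ≠ 0 := fun hg =>
    (map_ne_zero_iff ι (IsFractionRing.injective _ _)).2 hg
  let A : Fin 3 → K := affinePoint P c
  -- The relation f is treated as a plane curve and blown up at the projection of A. In the chart, λ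
  -- is the first coordinate difference and χ the slope, with t̄, s̄ specialized to c.
  obtain ⟨m, g, hg, hg0⟩ := exists_strict_transform hf0 (A 0) (A i.succ)
  have hchi : ∀ f ∈ supported (Base K) {Var.t, Var.s}, p.redEval τ σ f ≠ 0 → specBar c f ≠ 0 := by
    intro f hf h0 h1
    rw [redEval_eq_aeval_specBar _ _ _ hf, h1, map_zero] at h0
    exact h0 rfl
  have hNmem := chiNum_mem_supported h.crossDiff_ne_zero i
  have hDmem := chiDen_mem_supported h.crossDiff_ne_zero i
  have hDc := hchi _ hDmem hD
  let lam : E := ι (specBar c (crossDiff P 0)) / ι (C (eval c (den P 0)) * den P 0)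
  let χ : E := ι (specBar c (chiNum P i)) / ι (specBar c (chiDen P i))
  have hdenC : ∀ j, C (eval c (den P j)) * den P j ≠ 0 := fun j =>
    mul_ne_zero (by simpa using hq j) (den_ne_zero P j)
  have hE : ∀ j, ParamSurface.comp P j - algebraMap K E (A j)
      = ι (specBar c (crossDiff P j)) / ι (C (eval c (den P j)) * den P j) := by
    intro j
    have hq' : algebraMap K E (eval c (den P j)) ≠ 0 := by simpa using hq j
    have h1 : algebraMap K E (A j) * algebraMap K E (eval c (den P j))
        = algebraMap K E (eval c (num P j)) := by
      rw [← map_mul]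
      congr 1
      exact div_mul_cancel₀ _ (hq j)
    have h2 := den_mul_comp P j
    have hC : ∀ r : K, ι (C r) = algebraMap K E r := fun r =>
      (IsScalarTower.algebraMap_apply K (MvPolynomial (Fin 2) K) E r).symm
    rw [eq_div_iff (hι (hdenC j)), specBar_crossDiff, map_sub, map_mul, map_mul, map_mul, hC, hC,
      ← h1]
    change ι (den P j) * _ = ι (num P j) at h2
    rw [← h2]
    ring
  have hlam0 : lam ≠ 0 := div_ne_zero
    (hι (by rw [specBar_crossDiff]; exact eval_den_mul_num_sub_ne_zero (hconst 0) (hq 0)))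
    (hι (hdenC 0))
  have hlam : algebraMap K E (A 0) + lam = ParamSurface.comp P 0 := by
    rw [eq_comm, ← sub_eq_iff_eq_add', hE]
  have hslope : algebraMap K E (A i.succ) + lam * χ = ParamSurface.comp P i.succ := by
    rw [eq_comm, ← sub_eq_iff_eq_add', hE]
    have h1 := congrArg (fun f => ι (specBar c f)) (chiNum_mul_eq P (h.crossDiff_ne_zero 0) i)
    simp only [map_mul, specBar_atTS, specBar_atBar] at h1
    have e1 := hι (den_ne_zero P 0)
    have e2 := hι (den_ne_zero P i.succ)
    have e3 : ι (C (eval c (den P 0))) ≠ 0 := hι (by simpa using hq 0)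
    have e4 : ι (C (eval c (den P i.succ))) ≠ 0 := hι (by simpa using hq i.succ)
    have e5 := hι hDc
    simp only [lam, χ, map_mul]
    rw [div_mul_div_comm, div_eq_div_iff (mul_ne_zero e4 e2) (mul_ne_zero (mul_ne_zero e3 e1) e5)]
    linear_combination -h1
  have hgE : aeval ![lam, χ] g = 0 := by
    have h1 : (aeval ![lam, χ] : MvPolynomial (Fin 2) K →ₐ[K] E).comp
        (aeval ![C (A 0) + X 0, C (A i.succ) + X 0 * X 1])
        = aeval ![ParamSurface.comp P 0, ParamSurface.comp P i.succ] := by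
      apply algHom_ext
      intro j
      fin_cases j
      · simpa [algebraMap_eq] using hlam
      · simpa [algebraMap_eq] using hslope
    have h2 := DFunLike.congr_fun h1 f
    rw [hf, AlgHom.comp_apply, hg, map_mul, map_pow, aeval_X] at h2
    exact (mul_eq_zero.1 h2).resolve_left (pow_ne_zero _ hlam0)
  -- At the reduced preimage λ becomes 0 and χ becomes the reduced slope; the denominators do not
  -- vanish there. A transcendental slope then forces g to vanish on the whole exceptional line.
  have hgk : aeval ![0, p.redSlopes i] g = 0 := by
    refine aeval_eq_zero_of_fractions (aeval ![p.red τ, p.red σ])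
      ![specBar c (crossDiff P 0), specBar c (chiNum P i)]
      ![C (eval c (den P 0)) * den P 0, specBar c (chiDen P i)] _ ![lam, χ]
      (Fin.forall_fin_two.2 ⟨?_, ?_⟩) (Fin.forall_fin_two.2 ⟨?_, ?_⟩)
      (Fin.forall_fin_two.2 ⟨?_, ?_⟩) g hgE
    · change _ * 0 = aeval _ (specBar c (crossDiff P 0))
      rw [← redEval_eq_aeval_specBar _ _ _ (crossDiff_mem_supported P 0),
        h.redEval_crossDiff hτ hσ, mul_zero]
    · change aeval _ (specBar c (chiDen P i)) * _ = aeval _ (specBar c (chiNum P i))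
      rw [← redEval_eq_aeval_specBar _ _ _ hNmem, ← redEval_eq_aeval_specBar _ _ _ hDmem,
        h.redEval_chiNum hτ hσ, mul_comm]
      rfl
    · exact mul_div_cancel₀ _ (hι (hdenC 0))
    · exact mul_div_cancel₀ _ (hι hDc)
    · change aeval _ (C (eval c (den P 0)) * den P 0) ≠ 0
      rw [map_mul, aeval_C]
      exact mul_ne_zero (by simpa using hq 0) (h.aeval_den_ne_zero hq hτ hσ htr 0)
    · change aeval _ (specBar c (chiDen P i)) ≠ 0
      rwa [← redEval_eq_aeval_specBar _ _ _ hDmem]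
  have h1 : ((Polynomial.aeval (p.redSlopes i) : Polynomial K →ₐ[K] k).comp
      (aeval ![0, Polynomial.X])) = aeval ![0, p.redSlopes i] := by
    apply algHom_ext
    intro j
    fin_cases j <;> simp
  rw [← h1, AlgHom.comp_apply] at hgk
  exact hg0 (transcendental_iff.1 (p.redSlopes_transcendental i) _ hgk)

end IsPreimage

/-- No nearby point has a preimage if the special loci avoid the given point. -/
lemma not_isPreimage [IsAlgClosed K] (hq : ∀ j, eval c (den P j) ≠ 0)
    (hconst : ∀ j, ∀ a : K, ParamSurface.comp P j ≠ algebraMap K _ a) (hc : c ∉ ZInfty P)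
    (h2 : c ∉ DeltaStar2 P) {l : List (Fin 2 →₀ ℕ)} (hl : ∀ m, m ∈ l ↔ m ∈ J P)
    (h3 : c ∉ DeltaStar3 P l) : ¬ p.IsPreimage P y := by
  intro h
  obtain ⟨τ, hτ⟩ := h.exists_incl_eq_zero hc h2
  obtain ⟨σ, hσ⟩ := h.exists_incl_eq_one hc hτ
  have htr := h.red_transcendental hc h2 hl h3 hτ
  obtain ⟨i, hD⟩ := h.exists_redEval_chiDen_ne_zero hc h2 hτ hσ htr
  exact h.not_algebraicIndependent_comp hq hconst hτ hσ hD
    (h.algebraicIndependent_comp hq hconst hτ hσ htr hD)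

end Place

/-! ### Conclusion -/

lemma den_dvd_lcm {K : Type*} [Field K] (P : Fin 4 → MvPolynomial (Fin 3) K) (j : Fin 3) :
    den P j ∣ polyLcm (den P 0) (polyLcm (den P 1) (den P 2)) := by
  let _ : GCDMonoid (MvPolynomial (Fin 2) K) := UniqueFactorizationMonoid.toGCDMonoid _
  change den P j ∣ lcm (den P 0) (lcm (den P 1) (den P 2))
  fin_cases j
  · exact dvd_lcm_left _ _
  · exact (dvd_lcm_left _ _).trans (dvd_lcm_right _ _)
  · exact (dvd_lcm_right _ _).trans (dvd_lcm_right _ _)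

lemma isSimplePoint_of_notMem {K : Type*} [Field K] [IsAlgClosed K] [CharZero K]
    {P : Fin 4 → MvPolynomial (Fin 3) K} {γ : ℕ} (hP : ∀ i, (P i).IsHomogeneous γ)
    (hprop : ∀ i j, i ≠ j → ∀ c : K, P i ≠ C c * P j)
    {F : MvPolynomial (Fin 4) K} {d : ℕ} (hF : F.IsHomogeneous d) (hirr : Irreducible F)
    (hparam : Parametrizes P F) {l : List (Fin 2 →₀ ℕ)} (hl : ∀ m, m ∈ l ↔ m ∈ J P)
    {c : Fin 2 → K} (hc : c ∉ Delta4 P ∪ DeltaStar P l) :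
    IsSimplePoint (affinePoly F) (affinePoint P c) := by
  simp only [DeltaStar, DeltaStar1, Set.mem_union, not_or] at hc
  obtain ⟨hΔ4, ⟨⟨⟨-, -, hZ⟩, h2⟩, h3⟩, -⟩ := hc
  have hq : ∀ j, eval c (den P j) ≠ 0 := by
    intro j h0
    apply hΔ4
    obtain ⟨u, hu⟩ := den_dvd_lcm P j
    change eval c _ = 0
    rw [hu, map_mul, h0, zero_mul]
  have hd3 := dehom_ne_zero hP hprop 3
  have hconst := comp_ne_algebraMap hP hprop
  have hcomp := aeval_comp_affinePoly hF hirr hparam hd3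
  have hzero : eval (affinePoint P c) (affinePoly F) = 0 := by
    have := aeval_eq_zero_of_fractions (aeval c : MvPolynomial (Fin 2) K →ₐ[K] K) (num P) (den P)
      (affinePoint P c) (comp P) (fun j => mul_div_cancel₀ _ (hq j)) (den_mul_comp P) hq _ hcomp
    exact this
  by_contra hsimple
  have hder : ∀ j, eval (affinePoint P c) (pderiv j (affinePoly F)) = 0 := by
    intro j
    by_contra hj
    exact hsimple (isSimplePoint_of_pderiv_ne_zero hzero ⟨j, hj⟩)
  -- Outside Δ₄ the denominators are units at the place, so the generic point has coordinates in the
  -- valuation ring and reduces to A.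
  obtain ⟨Ω, _, _, _, V, _, _, k, _, _, ⟨p⟩⟩ := exists_place c
  have hunit : ∀ j, IsUnit (p.par (den P j)) := fun j =>
    p.isUnit_of_red_ne_zero _ (by rw [p.red_par]; simpa using hq j)
  choose u hu using fun j => (hunit j).exists_right_inv
  have ha : ∀ j, p.par (den P j) * (u j * p.par (num P j)) = p.par (num P j) := fun j => by
    rw [← mul_assoc, hu, one_mul]
  have haA : ∀ j, p.red (u j * p.par (num P j)) = algebraMap K k (affinePoint P c j) := by
    intro j
    have h0 : algebraMap K k (eval c (den P j)) ≠ 0 := by simpa using hq j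
    have h1 := congrArg p.red (ha j)
    rw [map_mul, p.red_par, p.red_par] at h1
    rw [affinePoint, map_div₀, eq_div_iff h0, mul_comm, h1]
  obtain ⟨v, hv, hv0, hvf⟩ := p.exists_intersection (affinePoly_ne_zero hF hirr.ne_zero) hcomp
    (exists_aeval_comp_pderiv_ne_zero hP hF hirr hparam hd3) hder ha haA
  have hne : ∀ j, crossDiff P j ≠ 0 := fun j =>
    crossDiff_ne_zero P (hconst j) (hq j)
  -- The nearby intersection point satisfies f, hence every relation between the components, as
  -- these are multiples of f.
  obtain ⟨y, hy⟩ := Place.exists_isPreimage hne ha hv hv0 (fun f hf => by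
    obtain ⟨g, hg⟩ := affinePoly_dvd_of_aeval_comp_eq_zero hP hirr hparam hd3 f hf
    have h1 := congrArg p.incl hvf
    rw [hg, map_mul]
    refine mul_eq_zero_of_left ?_ _
    rw [map_zero, ← AlgHom.comp_apply, comp_aeval] at h1
    exact h1)
  exact p.not_isPreimage hq hconst hZ h2 hl h3 hy

end ParamSurface

end

theorem mainTheorem7 {K : Type*} [Field K] [IsAlgClosed K] [CharZero K]
    (P : Fin 4 → MvPolynomial (Fin 3) K) (γ : ℕ) (hP : ∀ i, (P i).IsHomogeneous γ)
    (hcoprime : ∀ D : MvPolynomial (Fin 3) K, (∀ i, D ∣ P i) → IsUnit D)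
    (hprop : ∀ i j, i ≠ j → ∀ c : K, P i ≠ MvPolynomial.C c * P j)
    (F : MvPolynomial (Fin 4) K) (d : ℕ) (hF : F.IsHomogeneous d) (hirr : Irreducible F)
    (hplane : d ≠ 1) (hparam : ParamSurface.Parametrizes P F)
    (hinf : ParamSurface.AvoidsInfty P)
    (l : List (Fin 2 →₀ ℕ)) (hnodup : l.Nodup) (hl : ∀ m, m ∈ l ↔ m ∈ ParamSurface.J P) :
    (∃ I : Ideal (MvPolynomial (Fin 2) K),
        ParamSurface.DeltaStar P l = MvPolynomial.zeroLocus K I) ∧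
      ∀ c : Fin 2 → K, c ∉ ParamSurface.Delta4 P ∪ ParamSurface.DeltaStar P l →
        ParamSurface.IsSimplePoint (ParamSurface.affinePoly F)
          (ParamSurface.affinePoint P c) :=
  ⟨ParamSurface.isZariskiClosed_DeltaStar P l, fun _ hc =>
    ParamSurface.isSimplePoint_of_notMem hP hprop hF hirr hparam hl hc⟩
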